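/- Let $k$ be a field and $H$ a Hopf algebra over $k$ with invertible antipode $S$. Let $A$ be a unital associative left $H$-module algebra (so $h(ab)=(h_{(1)}a)(h_{(2)}b)$, $h1_A=\varepsilon(h)1_A$), $C$ a counital coassociative left $H$-module coalgebra (so $(hc)_{(1)}\otimes(hc)_{(2)}=h_{(1)}c_{(1)}\otimes h_{(2)}c_{(2)}$, $\varepsilon(hc)=\varepsilon(h)\varepsilon(c)$), and $M$ a left $H$-module which is also a left $H$-comodule, with no compatibility assumed between the two structures. Suppose that $C$ acts equivariantly on $A$, that is, there is a linear map $\phi\colon C\otimes A\to A$ with $\phi(c,ab)=\phi(c_{(1)},a)\phi(c_{(2)},b)$, $\phi(c,1)=\varepsilon(c)1_A$ and $h\phi(c,a)=\phi(hc,a)$. Definitions. Let $\Lambda$ be Connes' cyclic category; cocyclic (cyclic) $k$-modules are covariant (contravariant) functors from $\Lambda$ to $k$-modules, and $\mathrm{Ext}_\Lambda$ is taken in these abelian categories. Let $k_\bullet$ and $k_\bullet^\vee$ be the cocyclic and the cyclic module of the ground field (constant with value $k$), and $Cyc_\bullet(A)$ the classical cyclic module of the algebra $A$. On $T_n(C,M)=C^{\otimes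 n+1}\otimes M$ let $\partial_0$ comultiply $c^0$, let $\sigma_0$ apply $\varepsilon$ to $c^1$, let $\tau_n(c^0\otimes\cdots\otimes c^n\otimes m)=c^1\otimes\cdots\otimes c^n\otimes m_{(-1)}c^0\otimes m_{(0)}$, and $\partial_j=\tau^{-j}\partial_0\tau^j$, $\sigma_j=\tau^{-j}\sigma_0\tau^j$. On $T_n(A,M)=A^{\otimes n+1}\otimes M$ let $\partial_0$ multiply $a_0$ and $a_1$, let $\sigma_0$ insert $1_A$ after $a_0$, let $\tau_n(a_0\otimes\cdots\otimes a_n\otimes m)=S^{-1}(m_{(-1)})a_n\otimes a_0\otimes\cdots\otimes a_{n-1}\otimes m_{(0)}$, and $\partial_j=\tau^{j}\partial_0\tau^{-j}$, $\sigma_j=\tau^{j}\sigma_0\tau^{-j}$. For $X=C,A$ let $J_\bullet(X,M)\subseteq T_\bullet(X,M)$ be the smallest graded $k$-submodule stable under all $\partial_j,\sigma_j,\tau^{\pm1}$ and under the diagonal $H$-action $L_h$ that contains all $[L_h,\tau_n^i](\Psi)+(\tau_n^{n+1}-\mathrm{id})(\Phi)$ with $h\in H$, $i\in\mathbb Z$,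 $\Psi,\Phi\in T_n(X,M)$. Put $C_\bullet(X,M)=k\otimes_H\bigl(T_\bullet(X,M)/J_\bullet(X,M)\bigr)$; this is a cocyclic module for $X=C$ and a cyclic module for $X=A$. Define $$HC^p_{\rm Hopf}(C,M)=\mathrm{Ext}^p_\Lambda(k_\bullet,C_\bullet(C,M)),\quad HC^q_{\rm Hopf}(A,M)=\mathrm{Ext}^q_\Lambda(C_\bullet(A,M),k^\vee_\bullet),\quad HC^n(A)=\mathrm{Ext}^n_\Lambda(Cyc_\bullet(A),k^\vee_\bullet).$$ For a cocyclic module $X_\bullet$ and a cyclic module $Y_\bullet$ let $\mathrm{diagHom}_k(X_\bullet,Y_\bullet)$ be the cyclic module $n\mapsto\mathrm{Hom}_k(X_n,Y_n)$ whose structure maps are $f\mapsto d^Y\circ f\circ d^X$ for corresponding structure maps $d$; it is exact in both variables and so acts on (Yoneda) $\mathrm{Ext}$-classes in each variable, and $\mathrm{diagHom}_k(k_\bullet,Y_\bullet)\cong Y_\bullet$. The formula $\alpha_n(a_0\otimes\cdots\otimes a_n)(c^0\otimes\cdots\otimes c^n\otimes m)=\phi(c^0,a_0)\otimes\cdots\otimes\phi(c^n,a_n)\otimes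 m$ induces a morphism of cyclic modules $\alpha_\bullet\colon Cyc_\bullet(A)\to\mathrm{diagHom}_k(C_\bullet(C,M),C_\bullet(A,M))$. For $\xi\in HC^p_{\rm Hopf}(C,M)$ and $\nu\in HC^q_{\rm Hopf}(A,M)$ define elements of $HC^{p+q}(A)$ by $$\xi\smile\nu=\alpha_\bullet^*\bigl(\mathrm{diagHom}_k(\xi,C_\bullet(A,M))\circ\nu\bigr),\qquad \nu\smile\xi=\alpha_\bullet^*\bigl(\mathrm{diagHom}_k(C_\bullet(C,M),\nu)\circ\mathrm{diagHom}_k(\xi,k_\bullet^\vee)\bigr),$$ where $\circ\colon\mathrm{Ext}^i_\Lambda(X,Y)\otimes\mathrm{Ext}^j_\Lambda(Y,Z)\to\mathrm{Ext}^{i+j}_\Lambda(X,Z)$ is the Yoneda product (splicing of exact sequences) and $\alpha_\bullet^*=\mathrm{Ext}^{p+q}_\Lambda(\alpha_\bullet,k_\bullet^\vee)$. Proposition. For all $p,q\ge 0$, $\xi\in HC^p_{\rm Hopf}(C,M)$ and $\nu\in HC^q_{\rm Hopf}(A,M)$ one has $$\xi\smile\nu=(-1)^{pq}\,\nu\smile\xi\quad\text{in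 } HC^{p+q}(A).$$ -/

import Mathlib

namespace HopfCyclic

noncomputable section

open CategoryTheory

universe u v w u' v' w'

set_option linter.unusedSectionVars false

/-- Objects `[n]` of the quiver of generators of Connes' cyclic category. -/
structure CycQuiver where
  len : ℕ

/-- Generators of the cyclic category: cofaces, codegeneracies and cyclic operators. -/
inductive CycQuiver.Hom : CycQuiver → CycQuiver → Type
  | δ {n : ℕ} (i : Fin (n + 2)) : Hom ⟨n⟩ ⟨n + 1⟩
  | σ {n : ℕ} (i : Fin (n + 1)) : Hom ⟨n + 1⟩ ⟨n⟩
  | τ (n : ℕ) : Hom ⟨n⟩ ⟨n⟩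

instance : Quiver CycQuiver where
  Hom := CycQuiver.Hom

namespace CycQuiver

/-- The `n`-th object in the path category. -/
abbrev pob (n : ℕ) : Paths CycQuiver := (Paths.of CycQuiver).obj ⟨n⟩

/-- The coface `[n] ⟶ [n+1]` in the path category. -/
abbrev pδ {n : ℕ} (i : Fin (n + 2)) : pob n ⟶ pob (n + 1) :=
  (Paths.of CycQuiver).map (show (⟨n⟩ : CycQuiver) ⟶ ⟨n + 1⟩ from Hom.δ i)

/-- The codegeneracy `[n+1] ⟶ [n]` in the path category. -/
abbrev pσ {n : ℕ} (i : Fin (n + 1)) : pob (n + 1) ⟶ pob n :=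
  (Paths.of CycQuiver).map (show (⟨n + 1⟩ : CycQuiver) ⟶ ⟨n⟩ from Hom.σ i)

/-- The cyclic operator `[n] ⟶ [n]` in the path category. -/
abbrev pτ (n : ℕ) : pob n ⟶ pob n :=
  (Paths.of CycQuiver).map (show (⟨n⟩ : CycQuiver) ⟶ ⟨n⟩ from Hom.τ n)

/-- The defining relations of the cyclic category: the cosimplicial identities and the relations
of the cyclic operators with the cofaces and codegeneracies. -/
inductive Rel : HomRel (Paths CycQuiver)
  | δ_comp_δ {n : ℕ} {i j : Fin (n + 2)} (H : i ≤ j) :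
      Rel (pδ i ≫ pδ j.succ) (pδ j ≫ pδ i.castSucc)
  | δ_comp_σ_of_le {n : ℕ} {i : Fin (n + 2)} {j : Fin (n + 1)} (H : i ≤ j.castSucc) :
      Rel (pδ i.castSucc ≫ pσ j.succ) (pσ j ≫ pδ i)
  | δ_comp_σ_self {n : ℕ} {i : Fin (n + 1)} : Rel (pδ i.castSucc ≫ pσ i) (𝟙 _)
  | δ_comp_σ_succ {n : ℕ} {i : Fin (n + 1)} : Rel (pδ i.succ ≫ pσ i) (𝟙 _)
  | δ_comp_σ_of_gt {n : ℕ} {i : Fin (n + 2)} {j : Fin (n + 1)} (H : j.castSucc < i) :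
      Rel (pδ i.succ ≫ pσ j.castSucc) (pσ j ≫ pδ i)
  | σ_comp_σ {n : ℕ} {i j : Fin (n + 1)} (H : i ≤ j) :
      Rel (pσ i.castSucc ≫ pσ j) (pσ j.succ ≫ pσ i)
  | δ_comp_τ {n : ℕ} (i : Fin (n + 1)) : Rel (pδ i.succ ≫ pτ (n + 1)) (pτ n ≫ pδ i.castSucc)
  | δ_zero_comp_τ {n : ℕ} : Rel (pδ (0 : Fin (n + 2)) ≫ pτ (n + 1)) (pδ (Fin.last (n + 1)))
  | σ_comp_τ {n : ℕ} (j : Fin n) : Rel (pσ j.succ ≫ pτ n) (pτ (n + 1) ≫ pσ j.castSucc)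
  | σ_zero_comp_τ {n : ℕ} :
      Rel (pσ (0 : Fin (n + 1)) ≫ pτ n) (pτ (n + 1) ≫ pτ (n + 1) ≫ pσ (Fin.last n))
  | τ_pow {n : ℕ} : Rel ((End.of (pτ n)) ^ (n + 1) : End (pob n)) (𝟙 _)

end CycQuiver

/-- Connes' cyclic category `Λ`, presented by generators and relations. -/
abbrev CyclicCat : Type := CategoryTheory.Quotient CycQuiver.Rel

namespace CyclicCat

/-- The object `[n]` of `Λ`. -/
abbrev ob (n : ℕ) : CyclicCat := ⟨CycQuiver.pob n⟩

/-- The coface of `Λ`. -/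
abbrev δ {n : ℕ} (i : Fin (n + 2)) : ob n ⟶ ob (n + 1) :=
  (CategoryTheory.Quotient.functor CycQuiver.Rel).map (CycQuiver.pδ i)

/-- The codegeneracy of `Λ`. -/
abbrev σ {n : ℕ} (i : Fin (n + 1)) : ob (n + 1) ⟶ ob n :=
  (CategoryTheory.Quotient.functor CycQuiver.Rel).map (CycQuiver.pσ i)

/-- The cyclic operator of `Λ`. -/
abbrev τ (n : ℕ) : ob n ⟶ ob n :=
  (CategoryTheory.Quotient.functor CycQuiver.Rel).map (CycQuiver.pτ n)

/-- Naturality of a family of maps may be checked on the generators of `Λ`. -/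
theorem natural_of_generators {D : Type w} [Category.{v} D] {F G : CyclicCatᵒᵖ ⥤ D}
    (a : ∀ n : ℕ, F.obj (.op (ob n)) ⟶ G.obj (.op (ob n)))
    (hδ : ∀ (n : ℕ) (i : Fin (n + 2)), F.map (δ i).op ≫ a n = a (n + 1) ≫ G.map (δ i).op)
    (hσ : ∀ (n : ℕ) (i : Fin (n + 1)), F.map (σ i).op ≫ a (n + 1) = a n ≫ G.map (σ i).op)
    (hτ : ∀ n : ℕ, F.map (τ n).op ≫ a n = a n ≫ G.map (τ n).op)
    {x y : CyclicCat} (f : x ⟶ y) :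
    F.map f.op ≫ a x.as.len = a y.as.len ≫ G.map f.op := by
  obtain ⟨x⟩ := x
  obtain ⟨y⟩ := y
  obtain ⟨f, rfl⟩ : ∃ g : x ⟶ y, (CategoryTheory.Quotient.functor CycQuiver.Rel).map g = f := by
    exact (CategoryTheory.Quotient.functor CycQuiver.Rel).map_surjective f
  induction f using Paths.induction with
  | id =>
    erw [(CategoryTheory.Quotient.functor CycQuiver.Rel).map_id]
    erw [op_id, F.map_id, G.map_id, Category.id_comp, Category.comp_id]
  | comp p q hp =>
    rename_i u v w
    have key : ∀ {v w : CycQuiver} (q : CycQuiver.Hom v w), F.map ((CategoryTheory.Quotient.functor CycQuiver.Rel).map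
        ((Paths.of CycQuiver).map (show v ⟶ w from q))).op ≫ a v.len = a w.len ≫
        G.map ((CategoryTheory.Quotient.functor CycQuiver.Rel).map
        ((Paths.of CycQuiver).map (show v ⟶ w from q))).op := by
      intro v w q
      cases q with
      | δ i => exact hδ _ i
      | σ i => exact hσ _ i
      | τ n => exact hτ n
    have hq := key q
    have e (K : CyclicCatᵒᵖ ⥤ D) : K.map ((CategoryTheory.Quotient.functor CycQuiver.Rel).map
        (p ≫ (Paths.of CycQuiver).map q)).op =
        K.map ((CategoryTheory.Quotient.functor CycQuiver.Rel).map
        ((Paths.of CycQuiver).map q)).op ≫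
        K.map ((CategoryTheory.Quotient.functor CycQuiver.Rel).map p).op := by
      rw [(CategoryTheory.Quotient.functor CycQuiver.Rel).map_comp, op_comp, K.map_comp]
    refine (congrArg (· ≫ a u.len) (e F)).trans ?_
    refine Eq.trans ?_ (congrArg (a w.len ≫ ·) (e G)).symm
    refine (Category.assoc _ _ _).trans ?_
    refine (congrArg (_ ≫ ·) hp).trans ?_
    refine (Category.assoc _ _ _).symm.trans ?_
    refine (congrArg (· ≫ _) hq).trans ?_
    exact Category.assoc _ _ _

end CyclicCat

/-- Operators satisfying a set of identities which, by conjugation with the cyclic operator,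
imply all the defining relations of `Λ`. Indices out of range are never used. -/
structure CocyclicData (D : Type w) [Category.{v} D] where
  X : ℕ → D
  δ (n : ℕ) (i : ℕ) : X n ⟶ X (n + 1)
  σ (n : ℕ) (i : ℕ) : X (n + 1) ⟶ X n
  τ (n : ℕ) : X n ⟶ X n
  δ_τ (n i : ℕ) (h : i ≤ n) : δ n (i + 1) ≫ τ (n + 1) = τ n ≫ δ n i
  δ_zero_τ (n : ℕ) : δ n 0 ≫ τ (n + 1) = δ n (n + 1)
  σ_τ (n j : ℕ) (h : j < n) : σ n (j + 1) ≫ τ n = τ (n + 1) ≫ σ n j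
  σ_zero_τ (n : ℕ) : σ n 0 ≫ τ n = τ (n + 1) ≫ τ (n + 1) ≫ σ n n
  τ_pow (n : ℕ) : ((End.of (τ n)) ^ (n + 1) : End (X n)) = 𝟙 _
  δ_δ (n j : ℕ) (h : j ≤ n) : δ n 0 ≫ δ (n + 1) (j + 1) = δ n j ≫ δ (n + 1) 0
  σ_σ (n j : ℕ) (h : j ≤ n) : σ (n + 1) 0 ≫ σ n j = σ (n + 1) (j + 1) ≫ σ n 0
  δ_σ_lt (n j : ℕ) (h : j ≤ n) : δ (n + 1) 0 ≫ σ (n + 1) (j + 1) = σ n j ≫ δ n 0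
  δ_σ_self (n : ℕ) : δ n 0 ≫ σ n 0 = 𝟙 _
  δ_σ_succ (n : ℕ) : δ n 1 ≫ σ n 0 = 𝟙 _
  δ_σ_gt (n j : ℕ) (h : 1 ≤ j) (h' : j ≤ n) : δ (n + 1) (j + 1) ≫ σ (n + 1) 0 = σ n 0 ≫ δ n j

namespace CocyclicData

variable {D : Type w} [Category.{v} D] (Z : CocyclicData D)

instance isIso_τ (n : ℕ) : IsIso (Z.τ n) := by
  have h := Z.τ_pow n
  refine ⟨(End.of (Z.τ n)) ^ n, ?_, ?_⟩
  · rw [pow_succ] at h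
    exact h
  · rw [pow_succ'] at h
    exact h

theorem δ_δ' (n i j : ℕ) (h : i ≤ j) (hj : j ≤ n + 1) :
    Z.δ n i ≫ Z.δ (n + 1) (j + 1) = Z.δ n j ≫ Z.δ (n + 1) i := by
  induction i generalizing j with
  | zero =>
    rcases Nat.lt_or_ge n j with h1 | h1
    · obtain rfl : j = n + 1 := by omega
      rw [← Z.δ_zero_τ (n + 1), ← Z.δ_zero_τ n, Category.assoc, ← Z.δ_τ (n + 1) 0 (by omega),
        ← Category.assoc, ← Z.δ_δ n 0 (by omega), Category.assoc]
    · exact Z.δ_δ n j h1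
  | succ i ih =>
    obtain ⟨j, rfl⟩ : ∃ j', j = j' + 1 := ⟨j - 1, by omega⟩
    rw [← cancel_mono (Z.τ (n + 2)), Category.assoc, Category.assoc, Z.δ_τ (n + 1) _ (by omega),
      Z.δ_τ (n + 1) _ (by omega), ← Category.assoc, Z.δ_τ n _ (by omega), Category.assoc,
      ih j (by omega) (by omega), ← Category.assoc (Z.δ n (j + 1)), Z.δ_τ n _ (by omega),
      Category.assoc]

theorem σ_σ' (n i j : ℕ) (h : i ≤ j) (hj : j ≤ n) :
    Z.σ (n + 1) i ≫ Z.σ n j = Z.σ (n + 1) (j + 1) ≫ Z.σ n i := by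
  induction i generalizing j with
  | zero => exact Z.σ_σ n j hj
  | succ i ih =>
    obtain ⟨j, rfl⟩ : ∃ j', j = j' + 1 := ⟨j - 1, by omega⟩
    rw [← cancel_mono (Z.τ n), Category.assoc, Category.assoc, Z.σ_τ n _ (by omega),
      Z.σ_τ n _ (by omega), ← Category.assoc, Z.σ_τ (n + 1) _ (by omega), Category.assoc,
      ih j (by omega) (by omega), ← Category.assoc (Z.σ (n + 1) (j + 1 + 1)),
      Z.σ_τ (n + 1) _ (by omega), Category.assoc]

theorem δ_σ_lt' (n i j : ℕ) (h : i ≤ j) (hj : j ≤ n) :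
    Z.δ (n + 1) i ≫ Z.σ (n + 1) (j + 1) = Z.σ n j ≫ Z.δ n i := by
  induction i generalizing j with
  | zero => exact Z.δ_σ_lt n j hj
  | succ i ih =>
    obtain ⟨j, rfl⟩ : ∃ j', j = j' + 1 := ⟨j - 1, by omega⟩
    rw [← cancel_mono (Z.τ (n + 1)), Category.assoc, Category.assoc, Z.σ_τ (n + 1) _ (by omega),
      Z.δ_τ n _ (by omega), ← Category.assoc, Z.δ_τ (n + 1) _ (by omega), Category.assoc,
      ih j (by omega) (by omega), ← Category.assoc (Z.σ n (j + 1)), Z.σ_τ n _ (by omega),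
      Category.assoc]

theorem δ_σ_self' (n i : ℕ) (h : i ≤ n) : Z.δ n i ≫ Z.σ n i = 𝟙 _ := by
  induction i with
  | zero => exact Z.δ_σ_self n
  | succ i ih =>
    rw [← cancel_mono (Z.τ n), Category.assoc, Z.σ_τ n _ (by omega), ← Category.assoc,
      Z.δ_τ n _ (by omega), Category.assoc, ih (by omega), Category.comp_id, Category.id_comp]

theorem δ_σ_succ' (n i : ℕ) (h : i ≤ n) : Z.δ n (i + 1) ≫ Z.σ n i = 𝟙 _ := by
  induction i with
  | zero => exact Z.δ_σ_succ n
  | succ i ih =>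
    rw [← cancel_mono (Z.τ n), Category.assoc, Z.σ_τ n _ (by omega), ← Category.assoc,
      Z.δ_τ n _ (by omega), Category.assoc, ih (by omega), Category.comp_id, Category.id_comp]

theorem δ_σ_gt' (n i j : ℕ) (h : j < i) (hi : i ≤ n + 1) :
    Z.δ (n + 1) (i + 1) ≫ Z.σ (n + 1) j = Z.σ n j ≫ Z.δ n i := by
  induction j generalizing i with
  | zero =>
    rcases Nat.lt_or_ge n i with h1 | h1
    · obtain rfl : i = n + 1 := by omega
      rw [← Z.δ_zero_τ (n + 1), ← Z.δ_zero_τ n, Category.assoc, ← Z.σ_τ (n + 1) 0 (by omega),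
        ← Category.assoc, Z.δ_σ_lt n 0 (by omega), Category.assoc]
    · exact Z.δ_σ_gt n i (by omega) h1
  | succ j ih =>
    obtain ⟨i, rfl⟩ : ∃ i', i = i' + 1 := ⟨i - 1, by omega⟩
    rw [← cancel_mono (Z.τ (n + 1)), Category.assoc, Category.assoc, Z.σ_τ (n + 1) _ (by omega),
      Z.δ_τ n _ (by omega), ← Category.assoc, Z.δ_τ (n + 1) _ (by omega), Category.assoc,
      ih i (by omega) (by omega), ← Category.assoc (Z.σ n (j + 1)), Z.σ_τ n _ (by omega),
      Category.assoc]

/-- The operators as a map of quivers. -/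
def prefunctor : CycQuiver ⥤q D where
  obj x := Z.X x.len
  map f := match f with
    | .δ (n := n) i => Z.δ n i
    | .σ (n := n) i => Z.σ n i
    | .τ n => Z.τ n

/-- The functor on `Λ` given by the operators. -/
def toFunctor : CyclicCat ⥤ D :=
  CategoryTheory.Quotient.lift CycQuiver.Rel (Paths.lift Z.prefunctor) (by
    have hδ (n : ℕ) (i : Fin (n + 2)) : (Paths.lift Z.prefunctor).map (CycQuiver.pδ i) =
      Z.δ n i := Paths.lift_toPath _ _
    have hσ (n : ℕ) (i : Fin (n + 1)) : (Paths.lift Z.prefunctor).map (CycQuiver.pσ i) =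
      Z.σ n i := Paths.lift_toPath _ _
    have hτ (n : ℕ) : (Paths.lift Z.prefunctor).map (CycQuiver.pτ n) =
      Z.τ n := Paths.lift_toPath _ _
    intro x y f g h
    cases h with
    | δ_comp_δ H =>
      rw [Functor.map_comp, Functor.map_comp, hδ, hδ, hδ, hδ]
      exact Z.δ_δ' _ _ _ (by simpa using H) (by omega)
    | δ_comp_σ_of_le H =>
      rw [Functor.map_comp, Functor.map_comp, hδ, hδ, hσ, hσ]
      exact Z.δ_σ_lt' _ _ _ (by simpa using! H) (by omega)
    | δ_comp_σ_self =>
      rw [Functor.map_comp, CategoryTheory.Functor.map_id, hδ, hσ]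
      rename_i n i
      exact Z.δ_σ_self' n i (by omega)
    | δ_comp_σ_succ =>
      rw [Functor.map_comp, CategoryTheory.Functor.map_id, hδ, hσ]
      rename_i n i
      exact Z.δ_σ_succ' n i (by omega)
    | δ_comp_σ_of_gt H =>
      rw [Functor.map_comp, Functor.map_comp, hδ, hδ, hσ, hσ]
      exact Z.δ_σ_gt' _ _ _ (by simpa using! H) (by omega)
    | σ_comp_σ H =>
      rw [Functor.map_comp, Functor.map_comp, hσ, hσ, hσ, hσ]
      exact Z.σ_σ' _ _ _ (by simpa using H) (by omega)
    | δ_comp_τ i =>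
      rw [Functor.map_comp, Functor.map_comp, hδ, hδ, hτ, hτ]
      exact Z.δ_τ _ _ (by omega)
    | δ_zero_comp_τ =>
      rw [Functor.map_comp, hδ, hδ, hτ]
      exact Z.δ_zero_τ _
    | σ_comp_τ j =>
      rw [Functor.map_comp, Functor.map_comp, hσ, hσ, hτ, hτ]
      exact Z.σ_τ _ _ (by omega)
    | σ_zero_comp_τ =>
      rw [Functor.map_comp, Functor.map_comp, Functor.map_comp, hσ, hσ, hτ, hτ]
      exact Z.σ_zero_τ _
    | τ_pow =>
      rename_i n
      rw [CategoryTheory.Functor.map_id]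
      have := ((Paths.lift Z.prefunctor).mapEnd (CycQuiver.pob n)).map_pow
        (End.of (CycQuiver.pτ n)) (n + 1)
      refine this.trans ?_
      refine Eq.trans ?_ (Z.τ_pow n)
      congr 1
      exact hτ n)

theorem toFunctor_δ (n : ℕ) (i : Fin (n + 2)) : Z.toFunctor.map (CyclicCat.δ i) = Z.δ n i :=
  Paths.lift_toPath _ _

theorem toFunctor_σ (n : ℕ) (i : Fin (n + 1)) : Z.toFunctor.map (CyclicCat.σ i) = Z.σ n i :=
  Paths.lift_toPath _ _

theorem toFunctor_τ (n : ℕ) : Z.toFunctor.map (CyclicCat.τ n) = Z.τ n :=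
  Paths.lift_toPath _ _

end CocyclicData

end

end HopfCyclic

namespace HopfCyclic

noncomputable section

open CategoryTheory CategoryTheory.Limits

universe u v w u' v' w'

set_option linter.unusedSectionVars false

/-! Yoneda extensions -/

open Abelian in
/-- `YonedaSeq X Y n` is the type of `n`-fold extensions
`0 ← X ← E¹ ← ⋯ ← Eⁿ ← K ← 0` (built by splicing short exact sequences) together with a
morphism `K ⟶ Y`. An `n`-fold exact sequence from `Y` to `X` is the case `K = Y`. -/
inductive YonedaSeq (C : Type u) [Category.{v} C] [Abelian C] : C → C → ℕ → Type (max u v)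
  | hom {X Y : C} (f : X ⟶ Y) : YonedaSeq C X Y 0
  | splice {K E X Y : C} {n : ℕ} (i : K ⟶ E) (π : E ⟶ X) (w : i ≫ π = 0)
      (h : (ShortComplex.mk i π w).ShortExact) (e : YonedaSeq C K Y n) : YonedaSeq C X Y (n + 1)

namespace YonedaSeq

open Abelian

variable {C : Type u} [Category.{v} C] [Abelian C] [HasExt.{w} C]

/-- The class in `Ext` of a Yoneda sequence. -/
def toExt {X Y : C} {n : ℕ} : YonedaSeq C X Y n → Ext.{w} X Y n
  | hom f => Ext.mk₀ f
  | splice _ _ _ h e => h.extClass.comp e.toExt (Nat.add_comm 1 _)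

variable {D : Type u'} [Category.{v'} D] [Abelian D] [HasExt.{w'} D]
  (F : Cᵒᵖ ⥤ D) [F.Additive] [PreservesFiniteLimits F] [PreservesFiniteColimits F]

/-- The class in `Ext¹(F K, F X)` of the short exact sequence `0 → F X → F E → F K → 0`. -/
def contraClass {K E X : C} {i : K ⟶ E} {π : E ⟶ X} {w : i ≫ π = 0}
    (h : (ShortComplex.mk i π w).ShortExact) : Ext.{w'} (F.obj (.op K)) (F.obj (.op X)) 1 :=
  (h.op.map_of_exact F).extClass

/-- The class of the sequence obtained by applying an exact contravariant functor. -/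
def contra {X Y : C} {n : ℕ} : YonedaSeq C X Y n → Ext.{w'} (F.obj (.op Y)) (F.obj (.op X)) n
  | hom f => Ext.mk₀ (F.map f.op)
  | splice _ _ _ h e => e.contra.comp (contraClass F h) rfl

theorem toExt_surjective [EnoughProjectives C] {n : ℕ} {X Y : C} (ξ : Ext.{w} X Y n) :
    ∃ E : YonedaSeq C X Y n, E.toExt = ξ := by
  induction n generalizing X with
  | zero =>
    obtain ⟨f, rfl⟩ := Ext.homEquiv₀.symm.surjective ξ
    exact ⟨hom f, rfl⟩
  | succ n ih =>
    have h : (ShortComplex.mk (kernel.ι (Projective.π X)) (Projective.π X)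
      (kernel.condition _)).ShortExact :=
      { exact := ShortComplex.exact_of_f_is_kernel _ (kernelIsKernel _) }
    obtain ⟨η, hη⟩ := Ext.contravariant_sequence_exact₃ h Y ξ
      (Ext.eq_zero_of_projective _) (Nat.add_comm 1 n)
    obtain ⟨E, rfl⟩ := ih η
    exact ⟨splice _ _ _ h E, hη⟩

/-- Comparison of a short exact sequence with one whose middle term is projective. -/
theorem exists_lift {L P X' K E X : C} {i' : L ⟶ P} {π' : P ⟶ X'} {w'} [Projective P]
    {i : K ⟶ E} {π : E ⟶ X} {w}
    (h' : (ShortComplex.mk i' π' w').ShortExact) (h : (ShortComplex.mk i π w).ShortExact)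
    (l : X' ⟶ X) : ∃ l₁ : L ⟶ K,
      h'.extClass.comp (Ext.mk₀ l₁) (add_zero 1) = (Ext.mk₀ l).comp h.extClass (zero_add 1) ∧
      (Ext.mk₀ (F.map l₁.op)).comp (contraClass F h') (zero_add 1) =
        (contraClass F h).comp (Ext.mk₀ (F.map l.op)) (add_zero 1) := by
  have : Epi π := h.epi_g
  have : Mono i := h.mono_f
  let g : P ⟶ E := Projective.factorThru (π' ≫ l) π
  have hg : g ≫ π = π' ≫ l := Projective.factorThru_comp _ _
  let l₁ : L ⟶ K := h.exact.lift (i' ≫ g) (by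
    dsimp; rw [Category.assoc, hg, ← Category.assoc, w', zero_comp])
  have hl₁ : l₁ ≫ i = i' ≫ g := h.exact.lift_f _ _
  refine ⟨l₁, ?_, ?_⟩
  · exact ShortComplex.ShortExact.extClass_naturality h' h
      { τ₁ := l₁, τ₂ := g, τ₃ := l, comm₁₂ := hl₁, comm₂₃ := hg }
  · refine (ShortComplex.ShortExact.extClass_naturality (h.op.map_of_exact F)
      (h'.op.map_of_exact F)
      { τ₁ := F.map l.op, τ₂ := F.map g.op, τ₃ := F.map l₁.op, comm₁₂ := ?_, comm₂₃ := ?_ }).symm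
    · exact ((F.map_comp _ _).symm.trans (congrArg (fun z ↦ F.map z.op) hg.symm)).trans (F.map_comp _ _)
    · exact ((F.map_comp _ _).symm.trans (congrArg (fun z ↦ F.map z.op) hl₁.symm)).trans (F.map_comp _ _)

theorem exists_pullback [EnoughProjectives C] {n : ℕ} {K L Y : C} (e : YonedaSeq C K Y n)
    (l : L ⟶ K) : ∃ e' : YonedaSeq C L Y n,
      e'.toExt = (Ext.mk₀ l).comp e.toExt (zero_add n) ∧
      e'.contra F = (e.contra F).comp (Ext.mk₀ (F.map l.op)) (add_zero n) := by
  induction n generalizing K L with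
  | zero =>
    cases e with
    | hom f => exact ⟨hom (l ≫ f), by simp [toExt], by simp [contra]⟩
  | succ n ih =>
    cases e with
    | splice i π w h e =>
      have h' : (ShortComplex.mk (kernel.ι (Projective.π L)) (Projective.π L)
        (kernel.condition _)).ShortExact :=
        { exact := ShortComplex.exact_of_f_is_kernel _ (kernelIsKernel _) }
      obtain ⟨l₁, h₁, h₂⟩ := exists_lift F h' h l
      obtain ⟨e', h₃, h₄⟩ := ih e l₁
      refine ⟨splice _ _ _ h' e', ?_, ?_⟩
      · dsimp [toExt]
        rw [h₃, ← Ext.comp_assoc _ _ _ (add_zero 1) (zero_add n) (by omega), h₁]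
        exact Ext.comp_assoc _ _ _ _ _ (by omega)
      · dsimp [contra]
        rw [h₄]
        refine (Ext.comp_assoc _ _ _ _ (zero_add 1) (by omega)).trans ?_
        rw [h₂]
        exact (Ext.comp_assoc _ _ _ _ _ (by omega)).symm

/-- Applying an exact contravariant functor to Yoneda sequences is compatible with the equality
of classes in `Ext`. -/
theorem contra_eq_of_toExt_eq [EnoughProjectives C] {n : ℕ} {X Y : C} (E E' : YonedaSeq C X Y n)
    (hE : E.toExt = E'.toExt) : E.contra F = E'.contra F := by
  induction n generalizing X with
  | zero =>
    cases E with
    | hom f =>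
      cases E' with
      | hom g =>
        obtain rfl : f = g := Ext.homEquiv₀.symm.injective hE
        rfl
  | succ n ih =>
    cases E with
    | splice i₁ π₁ w₁ h₁ e₁ =>
      cases E' with
      | splice i₂ π₂ w₂ h₂ e₂ =>
        have h : (ShortComplex.mk (kernel.ι (Projective.π X)) (Projective.π X)
          (kernel.condition _)).ShortExact :=
          { exact := ShortComplex.exact_of_f_is_kernel _ (kernelIsKernel _) }
        obtain ⟨l₁, a₁, b₁⟩ := exists_lift F h h₁ (𝟙 X)
        obtain ⟨l₂, a₂, b₂⟩ := exists_lift F h h₂ (𝟙 X)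
        obtain ⟨e₁', c₁, d₁⟩ := exists_pullback F e₁ l₁
        obtain ⟨e₂', c₂, d₂⟩ := exists_pullback F e₂ l₂
        rw [Ext.mk₀_id_comp] at a₁ a₂
        rw [op_id, CategoryTheory.Functor.map_id, Ext.comp_mk₀_id] at b₁ b₂
        dsimp [toExt] at hE
        rw [← a₁, ← a₂, Ext.comp_assoc _ _ _ _ (zero_add n) (by omega),
          Ext.comp_assoc _ _ _ _ (zero_add n) (by omega), ← c₁, ← c₂] at hE
        have key : (e₁'.contra F).comp (contraClass F h) rfl =
            (e₂'.contra F).comp (contraClass F h) rfl := by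
          have hz : h.extClass.comp (e₁'.toExt - e₂'.toExt) (Nat.add_comm 1 n) = 0 := by
            rw [sub_eq_add_neg, Ext.comp_add, Ext.comp_neg, hE, add_neg_cancel]
          obtain ⟨y, hy⟩ := Ext.contravariant_sequence_exact₁ h Y _ (Nat.add_comm 1 n) hz
          cases n with
          | zero =>
            obtain ⟨y, rfl⟩ := Ext.homEquiv₀.symm.surjective y
            cases e₁' with
            | hom f₁ =>
              cases e₂' with
              | hom f₂ =>
                have hf' : f₁ = f₂ + kernel.ι (Projective.π X) ≫ y := by
                  apply Ext.homEquiv₀.symm.injective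
                  replace hy : Ext.mk₀ (kernel.ι (Projective.π X) ≫ y) =
                      Ext.mk₀ f₁ - Ext.mk₀ f₂ := by simpa [toExt, Ext.homEquiv₀] using hy
                  change Ext.mk₀ f₁ = Ext.mk₀ (f₂ + kernel.ι (Projective.π X) ≫ y)
                  rw [Ext.mk₀_add, hy]
                  abel
                dsimp [contra]
                rw [hf', op_add, F.map_add, Ext.mk₀_add, Ext.add_comp, op_comp, F.map_comp,
                  ← Ext.mk₀_comp_mk₀, Ext.comp_assoc _ _ _ _ (zero_add 1) (by omega)]
                have : (Ext.mk₀ (F.map (kernel.ι (Projective.π X)).op)).comp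
                  (contraClass F h) (zero_add 1) = 0 :=
                  (h.op.map_of_exact F).comp_extClass
                rw [this, Ext.comp_zero, add_zero]
          | succ n =>
            rw [Ext.eq_zero_of_projective y, Ext.comp_zero] at hy
            rw [ih e₁' e₂' (sub_eq_zero.1 hy.symm)]
        rw [d₁, d₂] at key
        dsimp [contra]
        rw [← b₁, ← b₂]
        refine (Ext.comp_assoc _ _ _ (add_zero n) (zero_add 1) (by omega)).symm.trans ?_
        refine key.trans ?_
        exact (Ext.comp_assoc _ _ _ (add_zero n) (zero_add 1) (by omega))

end YonedaSeq

open Abelian in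
/-- The map on `Ext` induced by an exact contravariant functor: represent the class by an exact
sequence and apply the functor to it. -/
def extContra {C : Type u} [Category.{v} C] [Abelian C] [HasExt.{w} C] [EnoughProjectives C]
    {D : Type u'} [Category.{v'} D] [Abelian D] [HasExt.{w'} D]
    (F : Cᵒᵖ ⥤ D) [F.Additive] [PreservesFiniteLimits F] [PreservesFiniteColimits F]
    {X Y : C} {n : ℕ} (ξ : Ext.{w} X Y n) : Ext.{w'} (F.obj (.op Y)) (F.obj (.op X)) n :=
  (YonedaSeq.toExt_surjective ξ).choose.contra F

open Abelian in
/-- The map `extContra` may be computed from any representing sequence. -/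
theorem extContra_toExt {C : Type u} [Category.{v} C] [Abelian C] [HasExt.{w} C]
    [EnoughProjectives C] {D : Type u'} [Category.{v'} D] [Abelian D] [HasExt.{w'} D]
    (F : Cᵒᵖ ⥤ D) [F.Additive] [PreservesFiniteLimits F] [PreservesFiniteColimits F]
    {X Y : C} {n : ℕ} (E : YonedaSeq C X Y n) :
    extContra F (E.toExt : Ext.{w} X Y n) = (E.contra F : Ext.{w'} _ _ n) :=
  YonedaSeq.contra_eq_of_toExt_eq F _ E (YonedaSeq.toExt_surjective E.toExt).choose_spec

end

end HopfCyclic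

namespace HopfCyclic

noncomputable section

open CategoryTheory CategoryTheory.Limits

universe u v w u' v' w'

set_option linter.unusedSectionVars false

section FunctorCategory

variable (J : Type) [SmallCategory J] (k : Type u) [Field k]

theorem projective_sigma {D : Type v} [Category.{w} D] {I : Type} (G : I → D) [HasCoproduct G]
    (_ : ∀ i, Projective (G i)) : Projective (∐ G) where
  factors f e _ := ⟨Sigma.desc fun i ↦ Projective.factorThru (Sigma.ι G i ≫ f) e,
    Sigma.hom_ext _ _ fun i ↦ by
      rw [← Category.assoc, Sigma.ι_desc, Projective.factorThru_comp]⟩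

instance enoughProjectives_functor : EnoughProjectives (J ⥤ ModuleCat.{u} k) where
  presentation Y := by
    let G (c : J) : J ⥤ ModuleCat.{u} k := (evaluationLeftAdjoint (ModuleCat.{u} k) c).obj (Y.obj c)
    let f : (∐ G) ⟶ Y :=
      Sigma.desc fun c ↦ (evaluationAdjunctionRight (ModuleCat.{u} k) c).counit.app Y
    have hp (c : J) : Projective (Y.obj c) :=
      ModuleCat.projective_of_free (Module.Free.chooseBasis k (Y.obj c))
    have hp' (c : J) : Projective (G c) :=
      (evaluationAdjunctionRight (ModuleCat.{u} k) c).map_projective _ (hp c)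
    have hf : Epi f := by
      rw [NatTrans.epi_iff_epi_app]
      intro c
      have h : (evaluationAdjunctionRight (ModuleCat.{u} k) c).unit.app (Y.obj c) ≫
          (Sigma.ι G c).app c
          ≫ f.app c = 𝟙 _ := by
        rw [← NatTrans.comp_app, Sigma.ι_desc]
        exact (evaluationAdjunctionRight (ModuleCat.{u} k) c).right_triangle_components Y
      have : IsSplitEpi (f.app c) := ⟨⟨⟨_, by rw [Category.assoc]; exact h⟩⟩⟩
      infer_instance
    exact ⟨{ p := _, projective := projective_sigma G hp', f := f, epi := hf }⟩

instance hasExt_functor : HasExt.{u} (J ⥤ ModuleCat.{u} k) :=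
  hasExt_of_enoughProjectives _

variable {k} in
/-- The map `f ↦ b ∘ f ∘ a` between spaces of `k`-linear maps. -/
def homMap {X X' Y Y' : ModuleCat.{u} k} (a : X' ⟶ X) (b : Y ⟶ Y') :
    ModuleCat.of k (X ⟶ Y) ⟶ ModuleCat.of k (X' ⟶ Y') :=
  ModuleCat.ofHom ((Linear.leftComp k Y' a) ∘ₗ (Linear.rightComp k X b))

variable {k} in
theorem homMap_apply {X X' Y Y' : ModuleCat.{u} k} (a : X' ⟶ X) (b : Y ⟶ Y') (f : X ⟶ Y) :
    (homMap a b).hom f = a ≫ f ≫ b := rfl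

variable {k} in
theorem homMap_id (X Y : ModuleCat.{u} k) : homMap (𝟙 X) (𝟙 Y) = 𝟙 _ :=
  ModuleCat.hom_ext (LinearMap.ext fun f ↦ by
    change 𝟙 X ≫ f ≫ 𝟙 Y = f
    rw [Category.id_comp, Category.comp_id])

variable {k} in
theorem homMap_comp {X X' X'' Y Y' Y'' : ModuleCat.{u} k} (a : X' ⟶ X) (b : Y ⟶ Y')
    (a' : X'' ⟶ X') (b' : Y' ⟶ Y'') : homMap a b ≫ homMap a' b' = homMap (a' ≫ a) (b ≫ b') :=
  ModuleCat.hom_ext (LinearMap.ext fun f ↦ by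
    change a' ≫ (a ≫ f ≫ b) ≫ b' = (a' ≫ a) ≫ f ≫ b ≫ b'
    simp only [Category.assoc])

variable {J k} in
/-- The diagonal Hom of a covariant functor `X` and a contravariant functor `Y`: its value at `n`
is `Hom_k(X n, Y n)`, and `g : m ⟶ n` acts as `f ↦ Y g ∘ f ∘ X g`. -/
def diagHomObj (X : J ⥤ ModuleCat.{u} k) (Y : Jᵒᵖ ⥤ ModuleCat.{u} k) :
    Jᵒᵖ ⥤ ModuleCat.{u} k where
  obj n := ModuleCat.of k (X.obj n.unop ⟶ Y.obj n)
  map g := homMap (X.map g.unop) (Y.map g)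
  map_id n := by rw [unop_id, X.map_id, Y.map_id, homMap_id]
  map_comp g g' := by rw [homMap_comp, unop_comp, X.map_comp, Y.map_comp]

variable {J k} in
/-- The functoriality of `diagHomObj`: a pair `(a, b)` acts as `f ↦ b ∘ f ∘ a`. -/
def diagHomMap {X X' : J ⥤ ModuleCat.{u} k} {Y Y' : Jᵒᵖ ⥤ ModuleCat.{u} k}
    (a : X' ⟶ X) (b : Y ⟶ Y') : diagHomObj X Y ⟶ diagHomObj X' Y' where
  app n := homMap (a.app n.unop) (b.app n)
  naturality m n g := by
    refine (homMap_comp _ _ _ _).trans (Eq.trans ?_ (homMap_comp _ _ _ _).symm)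
    rw [a.naturality, b.naturality]

variable {J k} in
theorem diagHomMap_id (X : J ⥤ ModuleCat.{u} k) (Y : Jᵒᵖ ⥤ ModuleCat.{u} k) :
    diagHomMap (𝟙 X) (𝟙 Y) = 𝟙 _ :=
  NatTrans.ext (funext fun _ ↦ homMap_id _ _)

variable {J k} in
theorem diagHomMap_comp {X X' X'' : J ⥤ ModuleCat.{u} k} {Y Y' Y'' : Jᵒᵖ ⥤ ModuleCat.{u} k}
    (a : X' ⟶ X) (b : Y ⟶ Y') (a' : X'' ⟶ X') (b' : Y' ⟶ Y'') :
    diagHomMap a b ≫ diagHomMap a' b' = diagHomMap (a' ≫ a) (b ≫ b') :=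
  NatTrans.ext (funext fun _ ↦ homMap_comp _ _ _ _)

/-- The bifunctor `diagHom`, contravariant in the first and covariant in the second variable. -/
def diagHom : (J ⥤ ModuleCat.{u} k)ᵒᵖ ⥤ (Jᵒᵖ ⥤ ModuleCat.{u} k) ⥤ (Jᵒᵖ ⥤ ModuleCat.{u} k) where
  obj X :=
    { obj := fun Y ↦ diagHomObj X.unop Y
      map := fun b ↦ diagHomMap (𝟙 X.unop) b
      map_id := fun Y ↦ diagHomMap_id _ _
      map_comp := fun b b' ↦ by rw [diagHomMap_comp, Category.id_comp] }
  map a :=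
    { app := fun Y ↦ diagHomMap a.unop (𝟙 Y)
      naturality := fun Y Y' b ↦ by
        simp only [diagHomMap_comp, Category.id_comp, Category.comp_id] }
  map_id X := NatTrans.ext (funext fun Y ↦ diagHomMap_id _ _)
  map_comp a a' := NatTrans.ext (funext fun Y ↦ by
    refine Eq.trans ?_ (diagHomMap_comp _ _ _ _).symm
    exact congrArg (diagHomMap _) (Category.id_comp (𝟙 Y)).symm)

/-! Exactness of `diagHom` in both variables: over a field, every short exact sequence of modules
splits. -/

variable {k} in
theorem homFunctor_exact (X : ModuleCat.{u} k) :
    PreservesFiniteLimits ((linearCoyoneda k (ModuleCat.{u} k)).obj (.op X)) ∧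
      PreservesFiniteColimits ((linearCoyoneda k (ModuleCat.{u} k)).obj (.op X)) := by
  refine ((Functor.exact_tfae _).out 0 3).1 fun S hS ↦ ?_
  have : Projective S.X₃ := ModuleCat.projective_of_free (Module.Free.chooseBasis k S.X₃)
  exact (hS.splittingOfProjective.map _).shortExact

variable {k} in
theorem homFunctor_exact' (Y : ModuleCat.{u} k) :
    PreservesFiniteLimits ((linearYoneda k (ModuleCat.{u} k)).obj Y) ∧
      PreservesFiniteColimits ((linearYoneda k (ModuleCat.{u} k)).obj Y) := by
  refine ((Functor.exact_tfae _).out 0 3).1 fun S hS ↦ ?_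
  have : Projective S.X₁.unop :=
    ModuleCat.projective_of_free (Module.Free.chooseBasis k S.X₁.unop)
  have : Injective S.X₁ := inferInstanceAs (Injective (Opposite.op S.X₁.unop))
  exact (hS.splittingOfInjective.map _).shortExact

instance diagHom_additive (X : (J ⥤ ModuleCat.{u} k)ᵒᵖ) : ((diagHom J k).obj X).Additive where
  map_add {Y Y'} b b' := NatTrans.ext (funext fun n ↦ ModuleCat.hom_ext (LinearMap.ext
    fun (f : X.unop.obj n.unop ⟶ Y.obj n) ↦ by
    change 𝟙 _ ≫ f ≫ (b.app n + b'.app n) = 𝟙 _ ≫ f ≫ b.app n + 𝟙 _ ≫ f ≫ b'.app n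
    simp only [Category.id_comp, Preadditive.comp_add]))

instance diagHom_flip_additive (Y : Jᵒᵖ ⥤ ModuleCat.{u} k) :
    ((diagHom J k).flip.obj Y).Additive where
  map_add {X X'} a a' := NatTrans.ext (funext fun n ↦ ModuleCat.hom_ext (LinearMap.ext
    fun (f : X.unop.obj n.unop ⟶ Y.obj n) ↦ by
    change (a.unop.app n.unop + a'.unop.app n.unop) ≫ f ≫ 𝟙 _ =
      a.unop.app n.unop ≫ f ≫ 𝟙 _ + a'.unop.app n.unop ≫ f ≫ 𝟙 _
    simp only [Category.comp_id, Preadditive.add_comp]))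

/-- Evaluation of `diagHom X` at `n` is `Hom_k(X n, ev_n)`. -/
def diagHomEval (X : (J ⥤ ModuleCat.{u} k)ᵒᵖ) (n : Jᵒᵖ) :
    (diagHom J k).obj X ⋙ (evaluation _ _).obj n ≅
      (evaluation _ _).obj n ⋙ (linearCoyoneda k (ModuleCat.{u} k)).obj (.op (X.unop.obj n.unop)) :=
  NatIso.ofComponents (fun Y ↦ Iso.refl _) fun {Y Y'} b ↦ by
    refine (Category.comp_id _).trans (Eq.trans ?_ (Category.id_comp _).symm)
    exact ModuleCat.hom_ext (LinearMap.ext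
      fun (f : X.unop.obj n.unop ⟶ Y.obj n) ↦ Category.id_comp (f ≫ b.app n))

/-- Evaluation of `diagHom (-, Y)` at `n` is `Hom_k(ev_n, Y n)`. -/
def diagHomFlipEval (Y : Jᵒᵖ ⥤ ModuleCat.{u} k) (n : Jᵒᵖ) :
    (diagHom J k).flip.obj Y ⋙ (evaluation _ _).obj n ≅
      ((evaluation _ _).obj n.unop).op ⋙ (linearYoneda k (ModuleCat.{u} k)).obj (Y.obj n) :=
  NatIso.ofComponents (fun X ↦ Iso.refl _) fun {X X'} a ↦ by
    refine (Category.comp_id _).trans (Eq.trans ?_ (Category.id_comp _).symm)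
    exact ModuleCat.hom_ext (LinearMap.ext
      fun (f : X.unop.obj n.unop ⟶ Y.obj n) ↦
        congrArg (a.unop.app n.unop ≫ ·) (Category.comp_id f))

instance diagHom_preservesFiniteLimits (X : (J ⥤ ModuleCat.{u} k)ᵒᵖ) :
    PreservesFiniteLimits ((diagHom J k).obj X) where
  preservesFiniteLimits K _ _ := preservesLimitsOfShape_of_evaluation _ _ fun n ↦ by
    have := (homFunctor_exact (X.unop.obj n.unop)).1
    exact preservesLimitsOfShape_of_natIso (diagHomEval J k X n).symm

instance diagHom_preservesFiniteColimits (X : (J ⥤ ModuleCat.{u} k)ᵒᵖ) :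
    PreservesFiniteColimits ((diagHom J k).obj X) where
  preservesFiniteColimits K _ _ := preservesColimitsOfShape_of_evaluation _ _ fun n ↦ by
    have := (homFunctor_exact (X.unop.obj n.unop)).2
    exact preservesColimitsOfShape_of_natIso (diagHomEval J k X n).symm

instance diagHom_flip_preservesFiniteLimits (Y : Jᵒᵖ ⥤ ModuleCat.{u} k) :
    PreservesFiniteLimits ((diagHom J k).flip.obj Y) where
  preservesFiniteLimits K _ _ := preservesLimitsOfShape_of_evaluation _ _ fun n ↦ by
    have := (homFunctor_exact' (Y.obj n)).1
    exact preservesLimitsOfShape_of_natIso (diagHomFlipEval J k Y n).symm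

instance diagHom_flip_preservesFiniteColimits (Y : Jᵒᵖ ⥤ ModuleCat.{u} k) :
    PreservesFiniteColimits ((diagHom J k).flip.obj Y) where
  preservesFiniteColimits K _ _ := preservesColimitsOfShape_of_evaluation _ _ fun n ↦ by
    have := (homFunctor_exact' (Y.obj n)).2
    exact preservesColimitsOfShape_of_natIso (diagHomFlipEval J k Y n).symm

variable {J} in
/-- The constant functor with value the ground field, all structure maps being the identity. -/
abbrev constField (J' : Type) [SmallCategory J'] : J' ⥤ ModuleCat.{u} k :=
  (Functor.const J').obj (ModuleCat.of k k)

variable {J k} in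
/-- The isomorphism `diagHom(k, Y) ≅ Y`, `f ↦ f(1)`. -/
def diagHomConst (Y : Jᵒᵖ ⥤ ModuleCat.{u} k) :
    ((diagHom J k).obj (.op (constField k J))).obj Y ≅ Y :=
  NatIso.ofComponents
    (fun n ↦ (ModuleCat.homLinearEquiv (S := k) ≪≫ₗ
      LinearMap.ringLmapEquivSelf k k (Y.obj n)).toModuleIso) fun _ ↦
      ModuleCat.hom_ext (LinearMap.ext fun _ ↦ rfl)

end FunctorCategory

end

end HopfCyclic

namespace HopfCyclic

noncomputable section

open CategoryTheory CategoryTheory.Limits TensorProduct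

universe u v w u' v' w'

set_option linter.unusedSectionVars false

section Tensor

variable (k V M : Type u) [Field k] [AddCommGroup V] [Module k V] [AddCommGroup M] [Module k M]

/-- `V ⊗ (V ⊗ ⋯ ⊗ (V ⊗ M))` with `n` factors `V`. -/
@[reducible] def TP : ℕ → ModuleCat.{u} k
  | 0 => .of k M
  | n + 1 => .of k (V ⊗[k] TP n)

variable {k V M}

/-- Given `χ : V ⊗ M ≃ V ⊗ M`, the operator
`v₀ ⊗ ⋯ ⊗ vₙ ⊗ m ↦ v₁ ⊗ ⋯ ⊗ vₙ ⊗ χ(v₀ ⊗ m)` on `V^{⊗ n+1} ⊗ M`. -/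
def rot (χ : V ⊗[k] M ≃ₗ[k] V ⊗[k] M) : (n : ℕ) → TP k V M (n + 1) ≃ₗ[k] TP k V M (n + 1)
  | 0 => χ
  | n + 1 => (TensorProduct.leftComm k V V (TP k V M n)).trans
      (TensorProduct.congr (LinearEquiv.refl k V) (rot χ n))

section
variable (χ : V ⊗[k] M ≃ₗ[k] V ⊗[k] M)

theorem rot_succ (n : ℕ) (a b : V) (x : TP k V M n) :
    rot χ (n + 1) (a ⊗ₜ (b ⊗ₜ x)) = b ⊗ₜ rot χ n (a ⊗ₜ x) := rfl

/-- Two linear maps on `V ⊗ V ⊗ X` agree if they agree on pure tensors. -/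
theorem ext2 {X Y : Type u} [AddCommGroup X] [Module k X] [AddCommGroup Y] [Module k Y]
    {f g : V ⊗[k] (V ⊗[k] X) →ₗ[k] Y} (h : ∀ a b x, f (a ⊗ₜ (b ⊗ₜ x)) = g (a ⊗ₜ (b ⊗ₜ x))) :
    f = g := by
  ext a b x
  exact h a b x

end

section Coalg
variable [Coalgebra k V]

variable (k V M) in
/-- Comultiplication of the `j`-th tensor factor (`j ≤ n`). -/
def spl : (j n : ℕ) → TP k V M (n + 1) →ₗ[k] TP k V M (n + 2)
  | 0, n => (TensorProduct.assoc k V V (TP k V M n)).toLinearMap ∘ₗ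
      (Coalgebra.comul (R := k) (A := V)).rTensor (TP k V M n)
  | _ + 1, 0 => 0
  | j + 1, n + 1 => (spl j n).lTensor V

variable (k V M) in
/-- Counit applied to the `j+1`-st tensor factor (`j ≤ n`). -/
def ctr : (j n : ℕ) → TP k V M (n + 2) →ₗ[k] TP k V M (n + 1)
  | 0, n => ((TensorProduct.lid k (TP k V M n)).toLinearMap ∘ₗ
      (Coalgebra.counit (R := k) (A := V)).rTensor (TP k V M n)).lTensor V
  | _ + 1, 0 => 0
  | j + 1, n + 1 => (ctr j n).lTensor V

variable (χ : V ⊗[k] M ≃ₗ[k] V ⊗[k] M)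

/-- The cofaces `∂_j = τ^{-j} ∂_0 τ^j`. -/
def coface (n : ℕ) : ℕ → (TP k V M (n + 1) →ₗ[k] TP k V M (n + 2))
  | 0 => spl k V M 0 n
  | j + 1 => (rot χ (n + 1)).symm.toLinearMap ∘ₗ coface n j ∘ₗ (rot χ n).toLinearMap

/-- The codegeneracies `σ_j = τ^{-j} σ_0 τ^j`. -/
def codeg (n : ℕ) : ℕ → (TP k V M (n + 2) →ₗ[k] TP k V M (n + 1))
  | 0 => ctr k V M 0 n
  | j + 1 => (rot χ n).symm.toLinearMap ∘ₗ codeg n j ∘ₗ (rot χ (n + 1)).toLinearMap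

theorem spl_succ (j n : ℕ) (a : V) (x : TP k V M (n + 1)) :
    spl k V M (j + 1) (n + 1) (a ⊗ₜ x) = a ⊗ₜ spl k V M j n x := rfl

theorem ctr_succ (j n : ℕ) (a : V) (x : TP k V M (n + 2)) :
    ctr k V M (j + 1) (n + 1) (a ⊗ₜ x) = a ⊗ₜ ctr k V M j n x := rfl

theorem ctr_zero (n : ℕ) (a b : V) (x : TP k V M n) :
    ctr k V M 0 n (a ⊗ₜ (b ⊗ₜ x)) = a ⊗ₜ (Coalgebra.counit (R := k) b • x) := rfl

theorem spl_zero (n : ℕ) (a : V) (x : TP k V M n) :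
    spl k V M 0 n (a ⊗ₜ x) =
      TensorProduct.assoc k V V (TP k V M n) (Coalgebra.comul (R := k) a ⊗ₜ x) := rfl

theorem rot_spl (j n : ℕ) (h : j + 1 ≤ n) (x : TP k V M (n + 1)) :
    rot χ (n + 1) (spl k V M (j + 1) n x) = spl k V M j n (rot χ n x) := by
  induction n generalizing j with
  | zero => omega
  | succ n ih =>
    suffices (rot χ (n + 2)).toLinearMap ∘ₗ spl k V M (j + 1) (n + 1) =
      spl k V M j (n + 1) ∘ₗ (rot χ (n + 1)).toLinearMap from LinearMap.congr_fun this x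
    refine ext2 fun a b x ↦ ?_
    change rot χ (n + 2) (spl k V M (j + 1) (n + 1) (a ⊗ₜ (b ⊗ₜ x))) =
      spl k V M j (n + 1) (rot χ (n + 1) (a ⊗ₜ (b ⊗ₜ x)))
    rw [rot_succ, spl_succ]
    cases j with
    | zero =>
      rw [spl_zero, spl_zero]
      generalize Coalgebra.comul (R := k) b = z
      induction z with
      | zero => simp
      | add z z' hz hz' => simp only [add_tmul, map_add, tmul_add, hz, hz']
      | tmul p q => rfl
    | succ j =>
      rw [spl_succ]
      cases n with
      | zero => omega
      | succ n =>
        have := ih j (by omega) (a ⊗ₜ x)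
        rw [← this]
        rfl

theorem rot_ctr (j n : ℕ) (h : j + 1 ≤ n) (x : TP k V M (n + 2)) :
    rot χ n (ctr k V M (j + 1) n x) = ctr k V M j n (rot χ (n + 1) x) := by
  induction n generalizing j with
  | zero => omega
  | succ n ih =>
    suffices (rot χ (n + 1)).toLinearMap ∘ₗ ctr k V M (j + 1) (n + 1) =
      ctr k V M j (n + 1) ∘ₗ (rot χ (n + 2)).toLinearMap from LinearMap.congr_fun this x
    refine ext2 fun a b x ↦ ?_
    change rot χ (n + 1) (ctr k V M (j + 1) (n + 1) (a ⊗ₜ (b ⊗ₜ x))) =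
      ctr k V M j (n + 1) (rot χ (n + 2) (a ⊗ₜ (b ⊗ₜ x)))
    rw [rot_succ, ctr_succ]
    cases j with
    | zero =>
      induction x using TensorProduct.induction_on with
      | zero => simp
      | add z z' hz hz' => simp only [map_add, tmul_add, hz, hz']
      | tmul p q =>
        rw [ctr_zero, rot_succ, rot_succ, ctr_zero, tmul_smul, map_smul]
    | succ j =>
      rw [ctr_succ]
      cases n with
      | zero => omega
      | succ n =>
        have := ih j (by omega) (a ⊗ₜ x)
        rw [← this]
        rfl

theorem coface_eq_spl (n j : ℕ) (h : j ≤ n) : coface χ n j = spl k V M j n := by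
  induction j with
  | zero => rfl
  | succ j ih =>
    refine LinearMap.ext fun x ↦ ?_
    change (rot χ (n + 1)).symm (coface χ n j (rot χ n x)) = _
    rw [ih (by omega), ← rot_spl χ j n h, LinearEquiv.symm_apply_apply]

theorem codeg_eq_ctr (n j : ℕ) (h : j ≤ n) : codeg χ n j = ctr k V M j n := by
  induction j with
  | zero => rfl
  | succ j ih =>
    refine LinearMap.ext fun x ↦ ?_
    change (rot χ n).symm (codeg χ n j (rot χ (n + 1) x)) = _
    rw [ih (by omega), ← rot_ctr χ j n h, LinearEquiv.symm_apply_apply]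

theorem rot_coface (n j : ℕ) (x : TP k V M (n + 1)) :
    rot χ (n + 1) (coface χ n (j + 1) x) = coface χ n j (rot χ n x) := by
  change rot χ (n + 1) ((rot χ (n + 1)).symm (coface χ n j (rot χ n x))) = _
  rw [LinearEquiv.apply_symm_apply]

theorem rot_codeg (n j : ℕ) (x : TP k V M (n + 2)) :
    rot χ n (codeg χ n (j + 1) x) = codeg χ n j (rot χ (n + 1) x) := by
  change rot χ n ((rot χ n).symm (codeg χ n j (rot χ (n + 1) x))) = _
  rw [LinearEquiv.apply_symm_apply]

/-- Compatibility of `χ` with the comultiplication and the counit. -/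
structure CoCompat (χ : V ⊗[k] M ≃ₗ[k] V ⊗[k] M) : Prop where
  comul (x : TP k V M 1) : spl k V M 0 0 (rot χ 0 x) = rot χ 1 (rot χ 1 (spl k V M 0 0 x))
  counit (x : TP k V M 1) : (Coalgebra.counit (R := k) (A := V)).rTensor M (χ x) =
    (Coalgebra.counit (R := k) (A := V)).rTensor M x

variable {χ}

theorem CoCompat.spl_last (hχ : CoCompat χ) (n : ℕ) (x : TP k V M (n + 1)) :
    spl k V M n n (rot χ n x) = rot χ (n + 1) (rot χ (n + 1) (spl k V M 0 n x)) := by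
  induction n with
  | zero => exact hχ.comul x
  | succ n ih =>
    suffices spl k V M (n + 1) (n + 1) ∘ₗ (rot χ (n + 1)).toLinearMap =
      (rot χ (n + 2)).toLinearMap ∘ₗ (rot χ (n + 2)).toLinearMap ∘ₗ spl k V M 0 (n + 1) from
      LinearMap.congr_fun this x
    refine ext2 fun a b x ↦ ?_
    change spl k V M (n + 1) (n + 1) (rot χ (n + 1) (a ⊗ₜ (b ⊗ₜ x))) =
      rot χ (n + 2) (rot χ (n + 2) (spl k V M 0 (n + 1) (a ⊗ₜ (b ⊗ₜ x))))
    rw [rot_succ, spl_succ, ih, spl_zero, spl_zero]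
    generalize Coalgebra.comul (R := k) a = z
    induction z with
    | zero => simp
    | add z z' hz hz' => simp only [add_tmul, map_add, tmul_add, hz, hz']
    | tmul p q =>
      change b ⊗ₜ[k] rot χ (n + 1) (q ⊗ₜ rot χ n (p ⊗ₜ x)) =
        rot χ (n + 2) (q ⊗ₜ (b ⊗ₜ (rot χ n (p ⊗ₜ x))))
      rw [rot_succ χ (n + 1)]

theorem CoCompat.ctr_last (hχ : CoCompat χ) (n : ℕ) (x : TP k V M (n + 2)) :
    ctr k V M n n (rot χ (n + 1) (rot χ (n + 1) x)) = rot χ n (ctr k V M 0 n x) := by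
  induction n with
  | zero =>
    suffices ctr k V M 0 0 ∘ₗ (rot χ 1).toLinearMap ∘ₗ (rot χ 1).toLinearMap =
      (rot χ 0).toLinearMap ∘ₗ ctr k V M 0 0 from LinearMap.congr_fun this x
    refine ext2 fun a b x ↦ ?_
    change ctr k V M 0 0 (rot χ 1 (rot χ 1 (a ⊗ₜ (b ⊗ₜ x)))) =
      rot χ 0 (ctr k V M 0 0 (a ⊗ₜ (b ⊗ₜ x)))
    rw [rot_succ, ctr_zero, tmul_smul, map_smul]
    generalize rot χ 0 (a ⊗ₜ x) = z
    induction z using TensorProduct.induction_on with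
    | zero => simp
    | add z z' hz hz' => simp only [map_add, tmul_add, hz, hz', smul_add]
    | tmul p q =>
      rw [rot_succ]
      change p ⊗ₜ[k] (TensorProduct.lid k M)
        ((Coalgebra.counit (R := k) (A := V)).rTensor M (χ (b ⊗ₜ q))) = _
      rw [hχ.counit]
      change p ⊗ₜ[k] (Coalgebra.counit (R := k) b • q) = _
      rw [tmul_smul]
  | succ n ih =>
    suffices ctr k V M (n + 1) (n + 1) ∘ₗ (rot χ (n + 2)).toLinearMap ∘ₗ
        (rot χ (n + 2)).toLinearMap =
      (rot χ (n + 1)).toLinearMap ∘ₗ ctr k V M 0 (n + 1) from LinearMap.congr_fun this x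
    refine ext2 fun a b x ↦ ?_
    change ctr k V M (n + 1) (n + 1) (rot χ (n + 2) (rot χ (n + 2) (a ⊗ₜ (b ⊗ₜ x)))) =
      rot χ (n + 1) (ctr k V M 0 (n + 1) (a ⊗ₜ (b ⊗ₜ x)))
    induction x using TensorProduct.induction_on with
    | zero => simp
    | add z z' hz hz' => simp only [map_add, tmul_add, hz, hz']
    | tmul c x =>
      rw [rot_succ χ (n + 1), rot_succ χ n, rot_succ χ (n + 1), ctr_succ, ctr_zero, tmul_smul,
        map_smul, rot_succ]
      have := ih (a ⊗ₜ (b ⊗ₜ x))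
      rw [rot_succ, ctr_zero] at this
      rw [this, tmul_smul, map_smul, tmul_smul]

theorem CoCompat.coface_last (hχ : CoCompat χ) (n : ℕ) (x : TP k V M (n + 1)) :
    coface χ n (n + 1) x = rot χ (n + 1) (coface χ n 0 x) := by
  apply (rot χ (n + 1)).injective
  rw [rot_coface, coface_eq_spl χ n n le_rfl, coface_eq_spl χ n 0 (by omega), hχ.spl_last]

theorem CoCompat.codeg_last (hχ : CoCompat χ) (n : ℕ) (x : TP k V M (n + 2)) :
    codeg χ n n (rot χ (n + 1) (rot χ (n + 1) x)) = rot χ n (codeg χ n 0 x) := by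
  rw [codeg_eq_ctr χ n n le_rfl, codeg_eq_ctr χ n 0 (by omega), hχ.ctr_last]

theorem spl_spl (n j : ℕ) (h : j ≤ n) (x : TP k V M (n + 1)) :
    spl k V M (j + 1) (n + 1) (spl k V M 0 n x) = spl k V M 0 (n + 1) (spl k V M j n x) := by
  suffices spl k V M (j + 1) (n + 1) ∘ₗ spl k V M 0 n =
    spl k V M 0 (n + 1) ∘ₗ spl k V M j n from LinearMap.congr_fun this x
  refine TensorProduct.ext' fun a x ↦ ?_
  change spl k V M (j + 1) (n + 1) (spl k V M 0 n (a ⊗ₜ x)) =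
    spl k V M 0 (n + 1) (spl k V M j n (a ⊗ₜ x))
  cases j with
  | zero =>
    have h1 (z : V ⊗[k] V) : spl k V M 1 (n + 1) (TensorProduct.assoc k V V (TP k V M n) (z ⊗ₜ x)) =
        (TensorProduct.assoc k V V (TP k V M n)).toLinearMap.lTensor V
          (TensorProduct.assoc k V (V ⊗[k] V) (TP k V M n)
            ((Coalgebra.comul (R := k) (A := V)).lTensor V z ⊗ₜ x)) := by
      induction z with
      | zero => simp
      | add z z' hz hz' => simp only [add_tmul, map_add, hz, hz']
      | tmul p q => rfl
    have h2 (z : V ⊗[k] V) : spl k V M 0 (n + 1) (TensorProduct.assoc k V V (TP k V M n) (z ⊗ₜ x)) =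
        (TensorProduct.assoc k V (V) (V ⊗[k] TP k V M n))
          (TensorProduct.assoc k (V ⊗[k] V) V (TP k V M n)
            ((Coalgebra.comul (R := k) (A := V)).rTensor V z ⊗ₜ x)) := by
      induction z with
      | zero => simp
      | add z z' hz hz' => simp only [add_tmul, map_add, hz, hz']
      | tmul p q =>
        change TensorProduct.assoc k V V (V ⊗[k] TP k V M n)
          (Coalgebra.comul (R := k) p ⊗ₜ (q ⊗ₜ x)) = _
        rfl
    rw [spl_zero, h1, h2, ← Coalgebra.coassoc_apply]
    generalize (Coalgebra.comul (R := k) (A := V)).rTensor V (Coalgebra.comul a) = z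
    induction z with
    | zero => simp
    | add z z' hz hz' => simp only [add_tmul, map_add, hz, hz']
    | tmul p q =>
      induction p with
      | zero => simp
      | add z z' hz hz' => simp only [add_tmul, map_add, hz, hz']
      | tmul p r => rfl
  | succ j =>
    cases n with
    | zero => omega
    | succ n =>
      rw [spl_succ, spl_zero, spl_zero]
      generalize Coalgebra.comul (R := k) a = z
      induction z with
      | zero => simp
      | add z z' hz hz' => simp only [add_tmul, map_add, hz, hz']
      | tmul p q => rfl

theorem ctr_ctr (n j : ℕ) (h : j ≤ n) (x : TP k V M (n + 3)) :
    ctr k V M j n (ctr k V M 0 (n + 1) x) = ctr k V M 0 n (ctr k V M (j + 1) (n + 1) x) := by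
  suffices ctr k V M j n ∘ₗ ctr k V M 0 (n + 1) =
    ctr k V M 0 n ∘ₗ ctr k V M (j + 1) (n + 1) from LinearMap.congr_fun this x
  refine ext2 fun a b x ↦ ?_
  change ctr k V M j n (ctr k V M 0 (n + 1) (a ⊗ₜ (b ⊗ₜ x))) =
    ctr k V M 0 n (ctr k V M (j + 1) (n + 1) (a ⊗ₜ (b ⊗ₜ x)))
  rw [ctr_succ, ctr_zero, tmul_smul, map_smul]
  cases j with
  | zero =>
    induction x using TensorProduct.induction_on with
    | zero => simp
    | add z z' hz hz' => simp only [map_add, tmul_add, hz, hz', smul_add]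
    | tmul c x =>
      rw [ctr_zero, ctr_zero, ctr_zero, tmul_smul, tmul_smul, tmul_smul, smul_comm]
  | succ j =>
    cases n with
    | zero => omega
    | succ n => rw [ctr_succ, ctr_succ, ctr_zero, tmul_smul]

theorem ctr_spl_lt (n j : ℕ) (h : j ≤ n) (x : TP k V M (n + 2)) :
    ctr k V M (j + 1) (n + 1) (spl k V M 0 (n + 1) x) = spl k V M 0 n (ctr k V M j n x) := by
  suffices ctr k V M (j + 1) (n + 1) ∘ₗ spl k V M 0 (n + 1) =
    spl k V M 0 n ∘ₗ ctr k V M j n from LinearMap.congr_fun this x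
  refine ext2 fun a b x ↦ ?_
  change ctr k V M (j + 1) (n + 1) (spl k V M 0 (n + 1) (a ⊗ₜ (b ⊗ₜ x))) =
    spl k V M 0 n (ctr k V M j n (a ⊗ₜ (b ⊗ₜ x)))
  have key (y : TP k V M (n + 1)) (y' : TP k V M n)
      (H : ∀ p q : V, ctr k V M (j + 1) (n + 1) (p ⊗ₜ (q ⊗ₜ y)) = p ⊗ₜ (q ⊗ₜ y')) :
      ctr k V M (j + 1) (n + 1) (spl k V M 0 (n + 1) (a ⊗ₜ y)) = spl k V M 0 n (a ⊗ₜ y') := by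
    rw [spl_zero, spl_zero]
    generalize Coalgebra.comul (R := k) a = z
    induction z with
    | zero => simp
    | add z z' hz hz' => simp only [add_tmul, map_add, hz, hz']
    | tmul p q => exact H p q
  cases j with
  | zero => exact key _ _ fun p q ↦ rfl
  | succ j =>
    cases n with
    | zero => omega
    | succ n => exact key _ _ fun p q ↦ rfl

theorem ctr_spl_self (n : ℕ) (x : TP k V M (n + 1)) :
    ctr k V M 0 n (spl k V M 0 n x) = x := by
  suffices ctr k V M 0 n ∘ₗ spl k V M 0 n = LinearMap.id from LinearMap.congr_fun this x
  refine TensorProduct.ext' fun a x ↦ ?_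
  change ctr k V M 0 n (spl k V M 0 n (a ⊗ₜ x)) = a ⊗ₜ x
  have key (z : V ⊗[k] V) : ctr k V M 0 n (TensorProduct.assoc k V V (TP k V M n) (z ⊗ₜ x)) =
      (TensorProduct.rid k V ((Coalgebra.counit (R := k) (A := V)).lTensor V z)) ⊗ₜ x := by
    induction z with
    | zero => simp
    | add z z' hz hz' => simp only [add_tmul, map_add, hz, hz']
    | tmul p q =>
      change p ⊗ₜ[k] (Coalgebra.counit (R := k) q • x) = (Coalgebra.counit (R := k) q • p) ⊗ₜ x
      rw [tmul_smul, smul_tmul']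
  rw [spl_zero, key, Coalgebra.lTensor_counit_comul]
  simp

theorem ctr_spl_succ (n : ℕ) (x : TP k V M (n + 2)) :
    ctr k V M 0 (n + 1) (spl k V M 1 (n + 1) x) = x := by
  suffices ctr k V M 0 (n + 1) ∘ₗ spl k V M 1 (n + 1) = LinearMap.id from LinearMap.congr_fun this x
  refine ext2 fun a b x ↦ ?_
  change ctr k V M 0 (n + 1) (a ⊗ₜ spl k V M 0 n (b ⊗ₜ x)) = a ⊗ₜ (b ⊗ₜ x)
  have key (z : V ⊗[k] V) :
      ctr k V M 0 (n + 1) (a ⊗ₜ TensorProduct.assoc k V V (TP k V M n) (z ⊗ₜ x)) =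
      a ⊗ₜ ((TensorProduct.lid k V ((Coalgebra.counit (R := k) (A := V)).rTensor V z)) ⊗ₜ x) := by
    induction z with
    | zero => simp
    | add z z' hz hz' => simp only [add_tmul, tmul_add, map_add, hz, hz']
    | tmul p q => rfl
  rw [spl_zero, key, Coalgebra.rTensor_counit_comul]
  simp

theorem CoCompat.codeg_coface_one (hχ : CoCompat χ) (n : ℕ) (x : TP k V M (n + 1)) :
    codeg χ n 0 (coface χ n 1 x) = x := by
  cases n with
  | zero =>
    rw [hχ.coface_last, codeg_eq_ctr χ 0 0 le_rfl, coface_eq_spl χ 0 0 le_rfl]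
    suffices ctr k V M 0 0 ∘ₗ (rot χ 1).toLinearMap ∘ₗ spl k V M 0 0 = LinearMap.id from
      LinearMap.congr_fun this x
    refine TensorProduct.ext' fun a x ↦ ?_
    change ctr k V M 0 0 (rot χ 1 (spl k V M 0 0 (a ⊗ₜ x))) = a ⊗ₜ x
    have key (z : V ⊗[k] V) :
        ctr k V M 0 0 (rot χ 1 (TensorProduct.assoc k V V (TP k V M 0) (z ⊗ₜ x))) =
        (TensorProduct.lid k V ((Coalgebra.counit (R := k) (A := V)).rTensor V z)) ⊗ₜ x := by
      induction z with
      | zero => simp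
      | add z z' hz hz' => simp only [add_tmul, map_add, hz, hz']
      | tmul p q =>
        change q ⊗ₜ[k] (TensorProduct.lid k M)
          ((Coalgebra.counit (R := k) (A := V)).rTensor M (χ (p ⊗ₜ x))) = _
        rw [hχ.counit]
        change q ⊗ₜ[k] (Coalgebra.counit (R := k) p • x) = (Coalgebra.counit (R := k) p • q) ⊗ₜ x
        rw [tmul_smul, smul_tmul']
    rw [spl_zero, key, Coalgebra.rTensor_counit_comul]
    simp
  | succ n =>
    rw [coface_eq_spl χ _ _ (by omega), codeg_eq_ctr χ _ _ (by omega), ctr_spl_succ]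

theorem ctr_spl_gt (n j : ℕ) (h : 1 ≤ j) (h' : j ≤ n) (x : TP k V M (n + 2)) :
    ctr k V M 0 (n + 1) (spl k V M (j + 1) (n + 1) x) = spl k V M j n (ctr k V M 0 n x) := by
  suffices ctr k V M 0 (n + 1) ∘ₗ spl k V M (j + 1) (n + 1) =
    spl k V M j n ∘ₗ ctr k V M 0 n from LinearMap.congr_fun this x
  refine ext2 fun a b x ↦ ?_
  obtain ⟨j, rfl⟩ : ∃ i, j = i + 1 := ⟨j - 1, by omega⟩
  cases n with
  | zero => omega
  | succ n =>
    change ctr k V M 0 (n + 2) (a ⊗ₜ (b ⊗ₜ spl k V M j n x)) =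
      spl k V M (j + 1) (n + 1) (a ⊗ₜ (Coalgebra.counit (R := k) b • x))
    rw [ctr_zero, spl_succ, map_smul]

end Coalg

end Tensor

section Alg

variable {k R M : Type u} [Field k] [Ring R] [Algebra k R] [AddCommGroup M] [Module k M]

variable (k R M) in
/-- Multiplication of the `j`-th and the `j+1`-st tensor factor (`j ≤ n`). -/
def mrg : (j n : ℕ) → TP k R M (n + 2) →ₗ[k] TP k R M (n + 1)
  | 0, n => (LinearMap.mul' k R).rTensor (TP k R M n) ∘ₗ
      (TensorProduct.assoc k R R (TP k R M n)).symm.toLinearMap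
  | _ + 1, 0 => 0
  | j + 1, n + 1 => (mrg j n).lTensor R

variable (k R M) in
/-- Insertion of `1` after the `j`-th tensor factor (`j ≤ n`). -/
def ins : (j n : ℕ) → TP k R M (n + 1) →ₗ[k] TP k R M (n + 2)
  | 0, n => (TensorProduct.mk k R (TP k R M n) 1).lTensor R
  | _ + 1, 0 => 0
  | j + 1, n + 1 => (ins j n).lTensor R

variable (χ : R ⊗[k] M ≃ₗ[k] R ⊗[k] M)

/-- The faces `∂_j = τ^j ∂_0 τ^{-j}`, where `τ` is the inverse of `rot`. -/
def face (n : ℕ) : ℕ → (TP k R M (n + 2) →ₗ[k] TP k R M (n + 1))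
  | 0 => mrg k R M 0 n
  | j + 1 => (rot χ n).symm.toLinearMap ∘ₗ face n j ∘ₗ (rot χ (n + 1)).toLinearMap

/-- The degeneracies `σ_j = τ^j σ_0 τ^{-j}`, where `τ` is the inverse of `rot`. -/
def degen (n : ℕ) : ℕ → (TP k R M (n + 1) →ₗ[k] TP k R M (n + 2))
  | 0 => ins k R M 0 n
  | j + 1 => (rot χ (n + 1)).symm.toLinearMap ∘ₗ degen n j ∘ₗ (rot χ n).toLinearMap

theorem mrg_succ (j n : ℕ) (a : R) (x : TP k R M (n + 2)) :
    mrg k R M (j + 1) (n + 1) (a ⊗ₜ x) = a ⊗ₜ mrg k R M j n x := rfl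

theorem ins_succ (j n : ℕ) (a : R) (x : TP k R M (n + 1)) :
    ins k R M (j + 1) (n + 1) (a ⊗ₜ x) = a ⊗ₜ ins k R M j n x := rfl

theorem mrg_zero (n : ℕ) (a b : R) (x : TP k R M n) :
    mrg k R M 0 n (a ⊗ₜ (b ⊗ₜ x)) = (a * b) ⊗ₜ x := rfl

theorem ins_zero (n : ℕ) (a : R) (x : TP k R M n) :
    ins k R M 0 n (a ⊗ₜ x) = a ⊗ₜ ((1 : R) ⊗ₜ x) := rfl

theorem rot_mrg (j n : ℕ) (h : j + 1 ≤ n) (x : TP k R M (n + 2)) :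
    rot χ n (mrg k R M (j + 1) n x) = mrg k R M j n (rot χ (n + 1) x) := by
  induction n generalizing j with
  | zero => omega
  | succ n ih =>
    suffices (rot χ (n + 1)).toLinearMap ∘ₗ mrg k R M (j + 1) (n + 1) =
      mrg k R M j (n + 1) ∘ₗ (rot χ (n + 2)).toLinearMap from LinearMap.congr_fun this x
    refine ext2 fun a b x ↦ ?_
    change rot χ (n + 1) (mrg k R M (j + 1) (n + 1) (a ⊗ₜ (b ⊗ₜ x))) =
      mrg k R M j (n + 1) (rot χ (n + 2) (a ⊗ₜ (b ⊗ₜ x)))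
    rw [rot_succ, mrg_succ]
    cases j with
    | zero =>
      induction x using TensorProduct.induction_on with
      | zero => simp
      | add z z' hz hz' => simp only [map_add, tmul_add, hz, hz']
      | tmul p q => rw [mrg_zero, rot_succ, rot_succ, mrg_zero]
    | succ j =>
      rw [mrg_succ]
      cases n with
      | zero => omega
      | succ n =>
        have := ih j (by omega) (a ⊗ₜ x)
        rw [← this]
        rfl

theorem rot_ins (j n : ℕ) (h : j + 1 ≤ n) (x : TP k R M (n + 1)) :
    rot χ (n + 1) (ins k R M (j + 1) n x) = ins k R M j n (rot χ n x) := by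
  induction n generalizing j with
  | zero => omega
  | succ n ih =>
    suffices (rot χ (n + 2)).toLinearMap ∘ₗ ins k R M (j + 1) (n + 1) =
      ins k R M j (n + 1) ∘ₗ (rot χ (n + 1)).toLinearMap from LinearMap.congr_fun this x
    refine ext2 fun a b x ↦ ?_
    change rot χ (n + 2) (ins k R M (j + 1) (n + 1) (a ⊗ₜ (b ⊗ₜ x))) =
      ins k R M j (n + 1) (rot χ (n + 1) (a ⊗ₜ (b ⊗ₜ x)))
    rw [rot_succ, ins_succ]
    cases j with
    | zero => rfl
    | succ j =>
      rw [ins_succ]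
      cases n with
      | zero => omega
      | succ n =>
        have := ih j (by omega) (a ⊗ₜ x)
        rw [← this]
        rfl

theorem face_eq_mrg (n j : ℕ) (h : j ≤ n) : face χ n j = mrg k R M j n := by
  induction j with
  | zero => rfl
  | succ j ih =>
    refine LinearMap.ext fun x ↦ ?_
    change (rot χ n).symm (face χ n j (rot χ (n + 1) x)) = _
    rw [ih (by omega), ← rot_mrg χ j n h, LinearEquiv.symm_apply_apply]

theorem degen_eq_ins (n j : ℕ) (h : j ≤ n) : degen χ n j = ins k R M j n := by
  induction j with
  | zero => rfl
  | succ j ih =>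
    refine LinearMap.ext fun x ↦ ?_
    change (rot χ (n + 1)).symm (degen χ n j (rot χ n x)) = _
    rw [ih (by omega), ← rot_ins χ j n h, LinearEquiv.symm_apply_apply]

theorem rot_face (n j : ℕ) (x : TP k R M (n + 2)) :
    rot χ n (face χ n (j + 1) x) = face χ n j (rot χ (n + 1) x) := by
  change rot χ n ((rot χ n).symm (face χ n j (rot χ (n + 1) x))) = _
  rw [LinearEquiv.apply_symm_apply]

theorem rot_degen (n j : ℕ) (x : TP k R M (n + 1)) :
    rot χ (n + 1) (degen χ n (j + 1) x) = degen χ n j (rot χ n x) := by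
  change rot χ (n + 1) ((rot χ (n + 1)).symm (degen χ n j (rot χ n x))) = _
  rw [LinearEquiv.apply_symm_apply]

/-- Compatibility of `χ` with the multiplication and the unit. -/
structure AlgCompat (χ : R ⊗[k] M ≃ₗ[k] R ⊗[k] M) : Prop where
  mul (x : TP k R M 2) : mrg k R M 0 0 (rot χ 1 (rot χ 1 x)) = rot χ 0 (mrg k R M 0 0 x)
  one (m : M) : χ ((1 : R) ⊗ₜ m) = (1 : R) ⊗ₜ m

variable {χ}

theorem AlgCompat.mrg_last (hχ : AlgCompat χ) (n : ℕ) (x : TP k R M (n + 2)) :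
    mrg k R M n n (rot χ (n + 1) (rot χ (n + 1) x)) = rot χ n (mrg k R M 0 n x) := by
  induction n with
  | zero => exact hχ.mul x
  | succ n ih =>
    suffices mrg k R M (n + 1) (n + 1) ∘ₗ (rot χ (n + 2)).toLinearMap ∘ₗ
        (rot χ (n + 2)).toLinearMap =
      (rot χ (n + 1)).toLinearMap ∘ₗ mrg k R M 0 (n + 1) from LinearMap.congr_fun this x
    refine ext2 fun a b x ↦ ?_
    change mrg k R M (n + 1) (n + 1) (rot χ (n + 2) (rot χ (n + 2) (a ⊗ₜ (b ⊗ₜ x)))) =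
      rot χ (n + 1) (mrg k R M 0 (n + 1) (a ⊗ₜ (b ⊗ₜ x)))
    induction x using TensorProduct.induction_on with
    | zero => simp
    | add z z' hz hz' => simp only [map_add, tmul_add, hz, hz']
    | tmul c x =>
      rw [rot_succ χ (n + 1), rot_succ χ n, rot_succ χ (n + 1), mrg_succ, mrg_zero, rot_succ]
      have := ih (a ⊗ₜ (b ⊗ₜ x))
      rw [rot_succ, mrg_zero] at this
      rw [this]

theorem AlgCompat.ins_last (hχ : AlgCompat χ) (n : ℕ) (x : TP k R M (n + 1)) :
    ins k R M n n (rot χ n x) = rot χ (n + 1) (rot χ (n + 1) (ins k R M 0 n x)) := by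
  induction n with
  | zero =>
    suffices ins k R M 0 0 ∘ₗ (rot χ 0).toLinearMap =
      (rot χ 1).toLinearMap ∘ₗ (rot χ 1).toLinearMap ∘ₗ ins k R M 0 0 from
      LinearMap.congr_fun this x
    refine TensorProduct.ext' fun a x ↦ ?_
    change ins k R M 0 0 (rot χ 0 (a ⊗ₜ x)) = rot χ 1 (rot χ 1 (ins k R M 0 0 (a ⊗ₜ x)))
    rw [ins_zero, rot_succ]
    generalize rot χ 0 (a ⊗ₜ x) = z
    induction z using TensorProduct.induction_on with
    | zero => simp
    | add z z' hz hz' => simp only [map_add, tmul_add, hz, hz']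
    | tmul p q =>
      rw [rot_succ]
      change p ⊗ₜ[k] ((1 : R) ⊗ₜ[k] q) = p ⊗ₜ[k] (χ ((1 : R) ⊗ₜ q))
      rw [hχ.one]
  | succ n ih =>
    suffices ins k R M (n + 1) (n + 1) ∘ₗ (rot χ (n + 1)).toLinearMap =
      (rot χ (n + 2)).toLinearMap ∘ₗ (rot χ (n + 2)).toLinearMap ∘ₗ ins k R M 0 (n + 1) from
      LinearMap.congr_fun this x
    refine ext2 fun a b x ↦ ?_
    change ins k R M (n + 1) (n + 1) (rot χ (n + 1) (a ⊗ₜ (b ⊗ₜ x))) =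
      rot χ (n + 2) (rot χ (n + 2) (ins k R M 0 (n + 1) (a ⊗ₜ (b ⊗ₜ x))))
    rw [rot_succ, ins_succ, ih, ins_zero, ins_zero, rot_succ χ n, rot_succ χ (n + 1),
      rot_succ χ n, rot_succ χ (n + 1)]

theorem AlgCompat.face_last (hχ : AlgCompat χ) (n : ℕ) (x : TP k R M (n + 2)) :
    face χ n (n + 1) (rot χ (n + 1) x) = face χ n 0 x := by
  apply (rot χ n).injective
  rw [rot_face, face_eq_mrg χ n n le_rfl, face_eq_mrg χ n 0 (by omega), hχ.mrg_last]

theorem AlgCompat.degen_last (hχ : AlgCompat χ) (n : ℕ) (x : TP k R M (n + 1)) :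
    degen χ n n (rot χ n x) = rot χ (n + 1) (rot χ (n + 1) (degen χ n 0 x)) := by
  rw [degen_eq_ins χ n n le_rfl, degen_eq_ins χ n 0 (by omega), hχ.ins_last]

theorem mrg_mrg (n j : ℕ) (h : j ≤ n) (x : TP k R M (n + 3)) :
    mrg k R M 0 n (mrg k R M (j + 1) (n + 1) x) = mrg k R M j n (mrg k R M 0 (n + 1) x) := by
  suffices mrg k R M 0 n ∘ₗ mrg k R M (j + 1) (n + 1) =
    mrg k R M j n ∘ₗ mrg k R M 0 (n + 1) from LinearMap.congr_fun this x
  refine ext2 fun a b x ↦ ?_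
  change mrg k R M 0 n (mrg k R M (j + 1) (n + 1) (a ⊗ₜ (b ⊗ₜ x))) =
    mrg k R M j n (mrg k R M 0 (n + 1) (a ⊗ₜ (b ⊗ₜ x)))
  rw [mrg_succ, mrg_zero]
  cases j with
  | zero =>
    induction x using TensorProduct.induction_on with
    | zero => simp
    | add z z' hz hz' => simp only [map_add, tmul_add, hz, hz']
    | tmul c x => rw [mrg_zero, mrg_zero, mrg_zero, mul_assoc]
  | succ j =>
    cases n with
    | zero => omega
    | succ n => rw [mrg_succ, mrg_succ, mrg_zero]

theorem ins_ins (n j : ℕ) (h : j ≤ n) (x : TP k R M (n + 1)) :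
    ins k R M 0 (n + 1) (ins k R M j n x) = ins k R M (j + 1) (n + 1) (ins k R M 0 n x) := by
  suffices ins k R M 0 (n + 1) ∘ₗ ins k R M j n =
    ins k R M (j + 1) (n + 1) ∘ₗ ins k R M 0 n from LinearMap.congr_fun this x
  refine TensorProduct.ext' fun a x ↦ ?_
  change ins k R M 0 (n + 1) (ins k R M j n (a ⊗ₜ x)) =
    ins k R M (j + 1) (n + 1) (ins k R M 0 n (a ⊗ₜ x))
  cases j with
  | zero => rfl
  | succ j =>
    cases n with
    | zero => omega
    | succ n => rfl

theorem mrg_ins_lt (n j : ℕ) (h : j ≤ n) (x : TP k R M (n + 2)) :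
    mrg k R M 0 (n + 1) (ins k R M (j + 1) (n + 1) x) = ins k R M j n (mrg k R M 0 n x) := by
  suffices mrg k R M 0 (n + 1) ∘ₗ ins k R M (j + 1) (n + 1) =
    ins k R M j n ∘ₗ mrg k R M 0 n from LinearMap.congr_fun this x
  refine ext2 fun a b x ↦ ?_
  change mrg k R M 0 (n + 1) (ins k R M (j + 1) (n + 1) (a ⊗ₜ (b ⊗ₜ x))) =
    ins k R M j n (mrg k R M 0 n (a ⊗ₜ (b ⊗ₜ x)))
  cases j with
  | zero => rfl
  | succ j =>
    cases n with
    | zero => omega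
    | succ n => rfl

theorem mrg_ins_self (n : ℕ) (x : TP k R M (n + 1)) :
    mrg k R M 0 n (ins k R M 0 n x) = x := by
  suffices mrg k R M 0 n ∘ₗ ins k R M 0 n = LinearMap.id from LinearMap.congr_fun this x
  refine TensorProduct.ext' fun a x ↦ ?_
  change mrg k R M 0 n (ins k R M 0 n (a ⊗ₜ x)) = a ⊗ₜ x
  rw [ins_zero, mrg_zero, mul_one]

theorem mrg_ins_succ (n : ℕ) (x : TP k R M (n + 2)) :
    mrg k R M 1 (n + 1) (ins k R M 0 (n + 1) x) = x := by
  suffices mrg k R M 1 (n + 1) ∘ₗ ins k R M 0 (n + 1) = LinearMap.id from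
    LinearMap.congr_fun this x
  refine ext2 fun a b x ↦ ?_
  change mrg k R M 1 (n + 1) (ins k R M 0 (n + 1) (a ⊗ₜ (b ⊗ₜ x))) = a ⊗ₜ (b ⊗ₜ x)
  rw [ins_zero, mrg_succ, mrg_zero, one_mul]

theorem AlgCompat.face_one_degen (hχ : AlgCompat χ) (n : ℕ) (x : TP k R M (n + 1)) :
    face χ n 1 (degen χ n 0 x) = x := by
  cases n with
  | zero =>
    have h := hχ.face_last 0 ((rot χ 1).symm (degen χ 0 0 x))
    rw [LinearEquiv.apply_symm_apply] at h
    refine h.trans ?_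
    rw [face_eq_mrg χ 0 0 le_rfl, degen_eq_ins χ 0 0 le_rfl]
    suffices mrg k R M 0 0 ∘ₗ (rot χ 1).symm.toLinearMap ∘ₗ ins k R M 0 0 = LinearMap.id from
      LinearMap.congr_fun this x
    refine TensorProduct.ext' fun a x ↦ ?_
    change mrg k R M 0 0 ((rot χ 1).symm (ins k R M 0 0 (a ⊗ₜ x))) = a ⊗ₜ x
    have h2 : (rot χ 1).symm (ins k R M 0 0 (a ⊗ₜ x)) = ((1 : R) ⊗ₜ[k] (a ⊗ₜ[k] x)) := by
      rw [LinearEquiv.symm_apply_eq, rot_succ, ins_zero]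
      exact congrArg (a ⊗ₜ[k] ·) (hχ.one x).symm
    rw [h2, mrg_zero, one_mul]
  | succ n =>
    rw [face_eq_mrg χ _ _ (by omega), degen_eq_ins χ _ _ (by omega), mrg_ins_succ]

theorem mrg_ins_gt (n j : ℕ) (h : 1 ≤ j) (h' : j ≤ n) (x : TP k R M (n + 2)) :
    mrg k R M (j + 1) (n + 1) (ins k R M 0 (n + 1) x) = ins k R M 0 n (mrg k R M j n x) := by
  suffices mrg k R M (j + 1) (n + 1) ∘ₗ ins k R M 0 (n + 1) =
    ins k R M 0 n ∘ₗ mrg k R M j n from LinearMap.congr_fun this x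
  refine ext2 fun a b x ↦ ?_
  obtain ⟨j, rfl⟩ : ∃ i, j = i + 1 := ⟨j - 1, by omega⟩
  cases n with
  | zero => omega
  | succ n => rfl

end Alg

end

end HopfCyclic

namespace HopfCyclic

noncomputable section

open CategoryTheory CategoryTheory.Limits TensorProduct

universe u v w u' v' w'

set_option linter.unusedSectionVars false

/-- A left comodule `M` over a coalgebra `H`, with coaction `m ↦ m₍₋₁₎ ⊗ m₍₀₎`. -/
class LeftComodule (k H M : Type u) [Field k] [Ring H] [Bialgebra k H]
    [AddCommGroup M] [Module k M] where
  coact : M →ₗ[k] H ⊗[k] M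
  coassoc (m : M) : TensorProduct.assoc k H H M
    ((Coalgebra.comul (R := k) (A := H)).rTensor M (coact m)) = coact.lTensor H (coact m)
  counit (m : M) : (Coalgebra.counit (R := k) (A := H)).rTensor M (coact m) = (1 : k) ⊗ₜ[k] m

/-- The antipode of the Hopf algebra `H` is invertible. -/
class InvertibleAntipode (k H : Type u) [Field k] [Ring H] [HopfAlgebra k H] : Prop where
  bijective : Function.Bijective (HopfAlgebra.antipode k (A := H))

section Diag

variable {k H V W : Type u} [Field k] [Ring H] [HopfAlgebra k H] [AddCommGroup V] [Module k V]
  [AddCommGroup W] [Module k W]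

variable (k H V) in
/-- The left action `h ↦ (v ↦ h • v)` of `H` on a module. -/
def lact [Module H V] [IsScalarTower k H V] : H →ₗ[k] Module.End k V :=
  (Algebra.lsmul k k V).toLinearMap

/-- The diagonal action `h (v ⊗ w) = h₍₁₎ v ⊗ h₍₂₎ w`. -/
def diagAct (ρ : H →ₗ[k] Module.End k V) (ρ' : H →ₗ[k] Module.End k W) :
    H →ₗ[k] Module.End k (V ⊗[k] W) :=
  TensorProduct.homTensorHomMap (RingHom.id k) V W V W ∘ₗ
    TensorProduct.map ρ ρ' ∘ₗ Coalgebra.comul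

theorem diagAct_apply (ρ : H →ₗ[k] Module.End k V) (ρ' : H →ₗ[k] Module.End k W) (h : H)
    (v : V) (w : W) : diagAct ρ ρ' h (v ⊗ₜ w) =
      TensorProduct.map (ρ.flip v) (ρ'.flip w) (Coalgebra.comul (R := k) h) := by
  change TensorProduct.homTensorHomMap (RingHom.id k) V W V W
    (TensorProduct.map ρ ρ' (Coalgebra.comul (R := k) h)) (v ⊗ₜ w) = _
  induction Coalgebra.comul (R := k) h with
  | zero => simp
  | add z z' hz hz' => simp only [map_add, LinearMap.add_apply, hz, hz']
  | tmul p q => rfl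

end Diag

section Classes

variable (k H A C : Type u) [Field k] [Ring H] [HopfAlgebra k H]

/-- A left `H`-module algebra: `h (a b) = (h₍₁₎ a) (h₍₂₎ b)` and `h 1 = ε(h) 1`. -/
class HModuleAlgebra [Ring A] [Algebra k A] [Module H A] [IsScalarTower k H A] : Prop where
  smul_mul (h : H) (a b : A) : h • (a * b) =
    LinearMap.mul' k A (diagAct (lact k H A) (lact k H A) h (a ⊗ₜ[k] b))
  smul_one (h : H) : h • (1 : A) = Coalgebra.counit (R := k) h • (1 : A)

/-- A left `H`-module coalgebra: `Δ(h c) = h₍₁₎ c₍₁₎ ⊗ h₍₂₎ c₍₂₎` and `ε(h c) = ε(h) ε(c)`. -/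
class HModuleCoalgebra [AddCommGroup C] [Module k C] [Coalgebra k C] [Module H C]
    [IsScalarTower k H C] : Prop where
  comul_smul (h : H) (c : C) : Coalgebra.comul (R := k) (h • c) =
    diagAct (lact k H C) (lact k H C) h (Coalgebra.comul (R := k) c)
  counit_smul (h : H) (c : C) : Coalgebra.counit (R := k) (h • c) =
    Coalgebra.counit (R := k) h * Coalgebra.counit (R := k) c

/-- An equivariant action `φ : C ⊗ A → A` of a module coalgebra on a module algebra:
`φ(c, a b) = φ(c₍₁₎, a) φ(c₍₂₎, b)`, `φ(c, 1) = ε(c) 1` and `h φ(c, a) = φ(h c, a)`. -/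
structure EquivariantAction [Ring A] [Algebra k A] [Module H A]
    [AddCommGroup C] [Module k C] [Coalgebra k C] [Module H C] where
  φ : C →ₗ[k] A →ₗ[k] A
  map_mul (c : C) (a b : A) : φ c (a * b) =
    LinearMap.mul' k A (TensorProduct.map (φ.flip a) (φ.flip b) (Coalgebra.comul (R := k) c))
  map_one (c : C) : φ c 1 = Coalgebra.counit (R := k) c • (1 : A)
  smul_map (h : H) (c : C) (a : A) : h • φ c a = φ (h • c) a

end Classes

section Antipode

variable (k H : Type u) [Field k] [Ring H] [HopfAlgebra k H] [InvertibleAntipode k H]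

/-- The inverse of the antipode. -/
def antipodeInv : H →ₗ[k] H :=
  (LinearEquiv.ofBijective (HopfAlgebra.antipode k (A := H))
    InvertibleAntipode.bijective).symm.toLinearMap

variable {k H} in
theorem antipode_antipodeInv (h : H) : HopfAlgebra.antipode k (antipodeInv k H h) = h :=
  (LinearEquiv.ofBijective (HopfAlgebra.antipode k (A := H))
    InvertibleAntipode.bijective).apply_symm_apply h

/-- The map `h ↦ t(h₍₂₎) s(h₍₁₎)`. -/
def opConv {k H : Type u} [Field k] [Ring H] [HopfAlgebra k H] (s t : H →ₗ[k] H) : H →ₗ[k] H :=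
  LinearMap.mul' k H ∘ₗ (TensorProduct.comm k H H).toLinearMap ∘ₗ TensorProduct.map s t ∘ₗ
    Coalgebra.comul

theorem antipode_opConv {k H : Type u} [Field k] [Ring H] [HopfAlgebra k H] (s t : H →ₗ[k] H)
    (h : H) : HopfAlgebra.antipode k (opConv s t h) =
      LinearMap.mul' k H (TensorProduct.map (HopfAlgebra.antipode k ∘ₗ s)
        (HopfAlgebra.antipode k ∘ₗ t) (Coalgebra.comul (R := k) h)) := by
  change HopfAlgebra.antipode k (LinearMap.mul' k H (TensorProduct.comm k H H
    (TensorProduct.map s t (Coalgebra.comul (R := k) h)))) = _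
  induction Coalgebra.comul (R := k) h with
  | zero => simp
  | add z z' hz hz' => simp only [map_add, hz, hz']
  | tmul p q => exact HopfAlgebra.antipode_mul_antidistrib _ _

theorem antipodeInv_comp : HopfAlgebra.antipode k ∘ₗ antipodeInv k H = LinearMap.id :=
  LinearMap.ext antipode_antipodeInv

theorem opConv_inv_id (h : H) : opConv (antipodeInv k H) LinearMap.id h =
    Coalgebra.counit (R := k) h • (1 : H) := by
  apply (InvertibleAntipode.bijective (k := k) (H := H)).injective
  rw [antipode_opConv, antipodeInv_comp, map_smul, HopfAlgebra.antipode_one]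
  refine (HopfAlgebra.mul_antipode_lTensor_comul_apply h).trans ?_
  rw [Algebra.algebraMap_eq_smul_one]

theorem opConv_id_inv (h : H) : opConv LinearMap.id (antipodeInv k H) h =
    Coalgebra.counit (R := k) h • (1 : H) := by
  apply (InvertibleAntipode.bijective (k := k) (H := H)).injective
  rw [antipode_opConv, antipodeInv_comp, map_smul, HopfAlgebra.antipode_one]
  refine (HopfAlgebra.mul_antipode_rTensor_comul_apply h).trans ?_
  rw [Algebra.algebraMap_eq_smul_one]

end Antipode

section Twist

variable {k H : Type u} (V M : Type u) [Field k] [Ring H] [HopfAlgebra k H]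
  [AddCommGroup V] [Module k V] [Module H V] [IsScalarTower k H V]
  [AddCommGroup M] [Module k M] [LeftComodule k H M]

/-- The map `v ⊗ m ↦ s(m₍₋₁₎) v ⊗ m₍₀₎`. -/
def twist (s : H →ₗ[k] H) : V ⊗[k] M →ₗ[k] V ⊗[k] M :=
  (TensorProduct.lift (lact k H V ∘ₗ s).flip).rTensor M ∘ₗ
    (TensorProduct.assoc k V H M).symm.toLinearMap ∘ₗ (LeftComodule.coact (k := k)).lTensor V

variable {V M} in
theorem twist_apply (s : H →ₗ[k] H) (v : V) (m : M) : twist V M s (v ⊗ₜ m) =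
    ((lact k H V ∘ₗ s).flip v).rTensor M (LeftComodule.coact (k := k) (H := H) m) := by
  change (TensorProduct.lift (lact k H V ∘ₗ s).flip).rTensor M
    ((TensorProduct.assoc k V H M).symm (v ⊗ₜ LeftComodule.coact (k := k) m)) = _
  induction LeftComodule.coact (k := k) (H := H) m using TensorProduct.induction_on with
  | zero => simp
  | add z z' hz hz' => simp only [map_add, tmul_add, hz, hz']
  | tmul p q => rfl

theorem twist_twist (s t : H →ₗ[k] H) (x : V ⊗[k] M) :
    twist V M t (twist V M s x) = twist V M (opConv s t) x := by
  induction x with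
  | zero => simp
  | add z z' hz hz' => simp only [map_add, hz, hz']
  | tmul v m =>
    rw [twist_apply, twist_apply]
    let G : H ⊗[k] (H ⊗[k] M) →ₗ[k] V ⊗[k] M :=
      (TensorProduct.lift (lact k H V).flip ∘ₗ
        (LinearMap.mul' k H ∘ₗ (TensorProduct.comm k H H).toLinearMap ∘ₗ
          TensorProduct.map s t).lTensor V ∘ₗ TensorProduct.mk k V (H ⊗[k] H) v).rTensor M ∘ₗ
        (TensorProduct.assoc k H H M).symm.toLinearMap
    have h1 (z : H ⊗[k] M) : twist V M t (((lact k H V ∘ₗ s).flip v).rTensor M z) =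
        G ((LeftComodule.coact (k := k)).lTensor H z) := by
      induction z using TensorProduct.induction_on with
      | zero => simp
      | add z z' hz hz' => simp only [map_add, hz, hz']
      | tmul p m =>
        change twist V M t ((s p • v) ⊗ₜ m) = G (p ⊗ₜ LeftComodule.coact (k := k) m)
        rw [twist_apply]
        induction LeftComodule.coact (k := k) (H := H) m using TensorProduct.induction_on with
        | zero => simp
        | add z z' hz hz' => simp only [map_add, tmul_add, hz, hz']
        | tmul q m =>
          change (t q • s p • v) ⊗ₜ[k] m = ((t q * s p) • v) ⊗ₜ[k] m
          rw [mul_smul]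
    have h2 (z : H ⊗[k] M) : ((lact k H V ∘ₗ opConv s t).flip v).rTensor M z =
        G (TensorProduct.assoc k H H M
          ((Coalgebra.comul (R := k) (A := H)).rTensor M z)) := by
      induction z using TensorProduct.induction_on with
      | zero => simp
      | add z z' hz hz' => simp only [map_add, hz, hz']
      | tmul p m =>
        change (LinearMap.mul' k H (TensorProduct.comm k H H
          (TensorProduct.map s t (Coalgebra.comul (R := k) p))) • v) ⊗ₜ[k] m =
          G (TensorProduct.assoc k H H M (Coalgebra.comul (R := k) p ⊗ₜ m))
        induction Coalgebra.comul (R := k) p with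
        | zero => simp
        | add z z' hz hz' => simp only [map_add, add_tmul, add_smul, hz, hz']
        | tmul q m => rfl
    rw [h1, h2, LeftComodule.coassoc]

theorem twist_counit (s : H →ₗ[k] H)
    (hs : ∀ h, s h = Coalgebra.counit (R := k) h • (1 : H)) (x : V ⊗[k] M) :
    twist V M s x = x := by
  induction x with
  | zero => simp
  | add z z' hz hz' => simp only [map_add, hz, hz']
  | tmul v m =>
    have h (z : H ⊗[k] M) : ((lact k H V ∘ₗ s).flip v).rTensor M z =
        v ⊗ₜ[k] TensorProduct.lid k M ((Coalgebra.counit (R := k) (A := H)).rTensor M z) := by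
      induction z using TensorProduct.induction_on with
      | zero => simp
      | add z z' hz hz' => simp only [map_add, tmul_add, hz, hz']
      | tmul p m =>
        change (s p • v) ⊗ₜ[k] m = v ⊗ₜ[k] (Coalgebra.counit (R := k) p • m)
        rw [hs, smul_assoc, one_smul, tmul_smul, smul_tmul']
    rw [twist_apply, h, LeftComodule.counit]
    simp

variable (k H) in
/-- The isomorphism `v ⊗ m ↦ m₍₋₁₎ v ⊗ m₍₀₎`, with inverse `v ⊗ m ↦ S⁻¹(m₍₋₁₎) v ⊗ m₍₀₎`. -/
def chi [InvertibleAntipode k H] : V ⊗[k] M ≃ₗ[k] V ⊗[k] M where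
  __ := twist V M (LinearMap.id : H →ₗ[k] H)
  invFun := twist V M (antipodeInv k H)
  left_inv x := by
    refine (twist_twist V M _ _ x).trans (twist_counit V M _ (opConv_id_inv k H) x)
  right_inv x := by
    refine (twist_twist V M _ _ x).trans (twist_counit V M _ (opConv_inv_id k H) x)

variable [InvertibleAntipode k H]

variable {V M} in
theorem chi_apply (v : V) (m : M) : chi k H V M (v ⊗ₜ m) =
    ((lact k H V).flip v).rTensor M (LeftComodule.coact (k := k) (H := H) m) :=
  twist_apply LinearMap.id v m

theorem rot_rot_chi (a b : V) (m : M) :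
    rot (chi k H V M) 1 (rot (chi k H V M) 1 (a ⊗ₜ (b ⊗ₜ m))) =
      TensorProduct.assoc k V V M (((diagAct (lact k H V) (lact k H V)).flip (a ⊗ₜ b)).rTensor M
        (LeftComodule.coact (k := k) m)) := by
  let G : H ⊗[k] (H ⊗[k] M) →ₗ[k] V ⊗[k] (V ⊗[k] M) :=
    TensorProduct.map ((lact k H V).flip a) (((lact k H V).flip b).rTensor M)
  have h1 (z : H ⊗[k] M) : rot (chi k H V M) 1 (b ⊗ₜ (((lact k H V).flip a).rTensor M z)) =
      G ((LeftComodule.coact (k := k)).lTensor H z) := by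
    induction z using TensorProduct.induction_on with
    | zero => simp
    | add z z' hz hz' => simp only [map_add, tmul_add, hz, hz']
    | tmul p m =>
      change (p • a) ⊗ₜ[k] chi k H V M (b ⊗ₜ m) = G (p ⊗ₜ LeftComodule.coact (k := k) m)
      rw [chi_apply]
      rfl
  have h2 (z : H ⊗[k] M) : TensorProduct.assoc k V V M
      (((diagAct (lact k H V) (lact k H V)).flip (a ⊗ₜ b)).rTensor M z) =
      G (TensorProduct.assoc k H H M ((Coalgebra.comul (R := k) (A := H)).rTensor M z)) := by
    induction z using TensorProduct.induction_on with
    | zero => simp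
    | add z z' hz hz' => simp only [map_add, hz, hz']
    | tmul p m =>
      change TensorProduct.assoc k V V M
        ((diagAct (lact k H V) (lact k H V) p (a ⊗ₜ b)) ⊗ₜ m) =
        G (TensorProduct.assoc k H H M (Coalgebra.comul (R := k) p ⊗ₜ m))
      rw [diagAct_apply]
      induction Coalgebra.comul (R := k) p with
      | zero => simp
      | add z z' hz hz' => simp only [map_add, add_tmul, hz, hz']
      | tmul q m => rfl
  rw [rot_succ]
  change rot (chi k H V M) 1 (b ⊗ₜ (chi k H V M (a ⊗ₜ m))) = _
  rw [chi_apply, h1, h2, LeftComodule.coassoc]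

end Twist

section Compat

variable {k H : Type u} (A C M : Type u) [Field k] [Ring H] [HopfAlgebra k H]
  [InvertibleAntipode k H] [AddCommGroup M] [Module k M] [LeftComodule k H M]

theorem coCompat_chi [AddCommGroup C] [Module k C] [Coalgebra k C] [Module H C]
    [IsScalarTower k H C] [HModuleCoalgebra k H C] : CoCompat (chi k H C M) where
  comul x := by
    suffices spl k C M 0 0 ∘ₗ (rot (chi k H C M) 0).toLinearMap =
      (rot (chi k H C M) 1).toLinearMap ∘ₗ (rot (chi k H C M) 1).toLinearMap ∘ₗ spl k C M 0 0 from
      LinearMap.congr_fun this x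
    refine TensorProduct.ext' fun c m ↦ ?_
    change spl k C M 0 0 (chi k H C M (c ⊗ₜ m)) =
      rot (chi k H C M) 1 (rot (chi k H C M) 1 (spl k C M 0 0 (c ⊗ₜ m)))
    have h1 (z : C ⊗[k] C) : rot (chi k H C M) 1 (rot (chi k H C M) 1
        (TensorProduct.assoc k C C (TP k C M 0) (z ⊗ₜ m))) =
        TensorProduct.assoc k C C M (((diagAct (lact k H C) (lact k H C)).flip z).rTensor M
        (LeftComodule.coact (k := k) m)) := by
      induction z with
      | zero => simp
      | add z z' hz hz' => simp only [map_add, add_tmul, LinearMap.rTensor_add,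
          LinearMap.add_apply, hz, hz']
      | tmul a b => exact rot_rot_chi C M a b m
    rw [spl_zero, h1, chi_apply]
    induction LeftComodule.coact (k := k) (H := H) m using TensorProduct.induction_on with
    | zero => simp
    | add z z' hz hz' => simp only [map_add, hz, hz']
    | tmul h m =>
      change TensorProduct.assoc k C C M (Coalgebra.comul (R := k) (h • c) ⊗ₜ m) =
        TensorProduct.assoc k C C M (diagAct (lact k H C) (lact k H C) h (Coalgebra.comul c) ⊗ₜ m)
      rw [HModuleCoalgebra.comul_smul]
  counit x := by
    induction x using TensorProduct.induction_on with
    | zero => simp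
    | add z z' hz hz' => simp only [map_add, hz, hz']
    | tmul c m =>
      have h (z : H ⊗[k] M) : (Coalgebra.counit (R := k) (A := C)).rTensor M
          (((lact k H C).flip c).rTensor M z) = Coalgebra.counit (R := k) c •
          ((Coalgebra.counit (R := k) (A := H)).rTensor M z) := by
        induction z using TensorProduct.induction_on with
        | zero => simp
        | add z z' hz hz' => simp only [map_add, smul_add, hz, hz']
        | tmul p m =>
          change Coalgebra.counit (R := k) (p • c) ⊗ₜ[k] m =
            Coalgebra.counit (R := k) c • (Coalgebra.counit (R := k) p ⊗ₜ[k] m)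
          rw [HModuleCoalgebra.counit_smul, mul_comm, smul_tmul', smul_eq_mul]
      rw [chi_apply, h, LeftComodule.counit, smul_tmul', smul_eq_mul, mul_one]
      rfl

theorem algCompat_chi [Ring A] [Algebra k A] [Module H A] [IsScalarTower k H A]
    [HModuleAlgebra k H A] : AlgCompat (chi k H A M) where
  mul x := by
    suffices mrg k A M 0 0 ∘ₗ (rot (chi k H A M) 1).toLinearMap ∘ₗ
        (rot (chi k H A M) 1).toLinearMap =
      (rot (chi k H A M) 0).toLinearMap ∘ₗ mrg k A M 0 0 from LinearMap.congr_fun this x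
    refine ext2 fun a b m ↦ ?_
    change mrg k A M 0 0 (rot (chi k H A M) 1 (rot (chi k H A M) 1 (a ⊗ₜ (b ⊗ₜ m)))) =
      chi k H A M ((a * b) ⊗ₜ m)
    rw [rot_rot_chi, chi_apply]
    induction LeftComodule.coact (k := k) (H := H) m using TensorProduct.induction_on with
    | zero => simp
    | add z z' hz hz' => simp only [map_add, hz, hz']
    | tmul h m =>
      have h1 (z : A ⊗[k] A) : mrg k A M 0 0 (TensorProduct.assoc k A A M (z ⊗ₜ m)) =
          (LinearMap.mul' k A z) ⊗ₜ[k] m := by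
        induction z with
        | zero => simp
        | add z z' hz hz' => simp only [map_add, add_tmul, hz, hz']
        | tmul a b => rfl
      change mrg k A M 0 0 (TensorProduct.assoc k A A M
        (diagAct (lact k H A) (lact k H A) h (a ⊗ₜ b) ⊗ₜ m)) = (h • (a * b)) ⊗ₜ[k] m
      rw [h1, HModuleAlgebra.smul_mul (k := k)]
  one m := by
    have h (z : H ⊗[k] M) : ((lact k H A).flip 1).rTensor M z =
        (1 : A) ⊗ₜ[k] TensorProduct.lid k M ((Coalgebra.counit (R := k) (A := H)).rTensor M z) := by
      induction z using TensorProduct.induction_on with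
      | zero => simp
      | add z z' hz hz' => simp only [map_add, tmul_add, hz, hz']
      | tmul p m =>
        change (p • (1 : A)) ⊗ₜ[k] m = (1 : A) ⊗ₜ[k] (Coalgebra.counit (R := k) p • m)
        rw [HModuleAlgebra.smul_one (k := k), tmul_smul, smul_tmul']
    rw [chi_apply, h, LeftComodule.counit]
    simp

/-- Without coefficients, the operators of the cyclic module of an algebra come from `χ = id`. -/
theorem algCompat_refl [Ring A] [Algebra k A] :
    AlgCompat (LinearEquiv.refl k (A ⊗[k] M)) where
  mul x := by
    suffices mrg k A M 0 0 ∘ₗ (rot (.refl k (A ⊗[k] M)) 1).toLinearMap ∘ₗ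
        (rot (.refl k (A ⊗[k] M)) 1).toLinearMap =
      (rot (.refl k (A ⊗[k] M)) 0).toLinearMap ∘ₗ mrg k A M 0 0 from LinearMap.congr_fun this x
    exact ext2 fun a b m ↦ rfl
  one m := rfl

end Compat

end

end HopfCyclic

namespace HopfCyclic

noncomputable section

open CategoryTheory CategoryTheory.Limits TensorProduct

universe u v w u' v' w'

set_option linter.unusedSectionVars false

section Powers

variable {k : Type u} [Field k]

theorem end_pow_ofHom (X : ModuleCat.{u} k) (t : X →ₗ[k] X) (m : ℕ)
    (ht : ∀ x, (t ^ m) x = x) : ((End.of (ModuleCat.ofHom t)) ^ m : End X) = 𝟙 _ := by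
  have h (m : ℕ) : ((End.of (ModuleCat.ofHom t)) ^ m : End X) = ModuleCat.ofHom (t ^ m) := by
    induction m with
    | zero => rfl
    | succ m ih =>
      rw [pow_succ', ih, pow_succ']
      rfl
  rw [h]
  exact ModuleCat.hom_ext (LinearMap.ext ht)

theorem end_pow_op (X : ModuleCat.{u} k) (t : X →ₗ[k] X) (m : ℕ)
    (ht : ∀ x, (t ^ m) x = x) :
    ((End.of (ModuleCat.ofHom t).op) ^ m : End (Opposite.op X)) = 𝟙 _ := by
  have h (m : ℕ) : ((End.of (ModuleCat.ofHom t).op) ^ m : End (Opposite.op X)) =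
      (ModuleCat.ofHom (t ^ m)).op := by
    induction m with
    | zero => rfl
    | succ m ih =>
      rw [pow_succ, ih, pow_succ']
      rfl
  rw [h]
  exact congrArg Quiver.Hom.op (ModuleCat.hom_ext (LinearMap.ext ht))

end Powers

section Quot

variable {k V M : Type u} [Field k] [AddCommGroup M] [Module k M]

/-- The cocyclic module structure on a quotient `Y` of the graded module `V^{⊗ n+1} ⊗ M` of a
coalgebra `V`, if all operators descend to `Y` and `τ^{n+1} = 1` on `Y n`. -/
def coalgData [AddCommGroup V] [Module k V] [Coalgebra k V] (χ : V ⊗[k] M ≃ₗ[k] V ⊗[k] M)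
    (hχ : CoCompat χ) (Y : ℕ → ModuleCat.{u} k) (π : ∀ n, TP k V M (n + 1) →ₗ[k] Y n)
    (hπ : ∀ n, Function.Surjective (π n)) (f : ∀ n, ℕ → (Y n →ₗ[k] Y (n + 1)))
    (d : ∀ n, ℕ → (Y (n + 1) →ₗ[k] Y n)) (t : ∀ n, Y n →ₗ[k] Y n)
    (hf : ∀ n j x, f n j (π n x) = π (n + 1) (coface χ n j x))
    (hd : ∀ n j x, d n j (π (n + 1) x) = π n (codeg χ n j x))
    (ht : ∀ n x, t n (π n x) = π n (rot χ n x))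
    (hpow : ∀ n y, ((t n) ^ (n + 1)) y = y) : CocyclicData (ModuleCat.{u} k) where
  X n := Y n
  δ n i := ModuleCat.ofHom (f n i)
  σ n i := ModuleCat.ofHom (d n i)
  τ n := ModuleCat.ofHom (t n)
  δ_τ n i _ := ModuleCat.hom_ext (LinearMap.ext ((hπ _).forall.2 fun x ↦ by
    change t _ (f _ _ _) = f _ _ (t _ _)
    rw [hf, ht, ht, hf, rot_coface]))
  δ_zero_τ n := ModuleCat.hom_ext (LinearMap.ext ((hπ _).forall.2 fun x ↦ by
    change t _ (f _ _ _) = f _ _ _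
    rw [hf, ht, hf, hχ.coface_last]))
  σ_τ n j _ := ModuleCat.hom_ext (LinearMap.ext ((hπ _).forall.2 fun x ↦ by
    change t _ (d _ _ _) = d _ _ (t _ _)
    rw [hd, ht, ht, hd, rot_codeg]))
  σ_zero_τ n := ModuleCat.hom_ext (LinearMap.ext ((hπ _).forall.2 fun x ↦ by
    change t _ (d _ _ _) = d _ _ (t _ (t _ _))
    rw [hd, ht, ht, ht, hd, hχ.codeg_last]))
  τ_pow n := end_pow_ofHom _ _ _ (hpow n)
  δ_δ n j h := ModuleCat.hom_ext (LinearMap.ext ((hπ _).forall.2 fun x ↦ by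
    change f _ _ (f _ _ _) = f _ _ (f _ _ _)
    rw [hf, hf, hf, hf, coface_eq_spl χ _ _ (by omega), coface_eq_spl χ _ _ (by omega),
      coface_eq_spl χ _ _ (by omega), coface_eq_spl χ _ _ (by omega), spl_spl n j h]))
  σ_σ n j h := ModuleCat.hom_ext (LinearMap.ext ((hπ _).forall.2 fun x ↦ by
    change d _ _ (d _ _ _) = d _ _ (d _ _ _)
    rw [hd, hd, hd, hd, codeg_eq_ctr χ _ _ (by omega), codeg_eq_ctr χ _ _ (by omega),
      codeg_eq_ctr χ _ _ (by omega), codeg_eq_ctr χ _ _ (by omega), ctr_ctr n j h]))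
  δ_σ_lt n j h := ModuleCat.hom_ext (LinearMap.ext ((hπ _).forall.2 fun x ↦ by
    change d _ _ (f _ _ _) = f _ _ (d _ _ _)
    rw [hf, hd, hd, hf, coface_eq_spl χ _ _ (by omega), codeg_eq_ctr χ _ _ (by omega),
      coface_eq_spl χ _ _ (by omega), codeg_eq_ctr χ _ _ (by omega), ctr_spl_lt n j h]))
  δ_σ_self n := ModuleCat.hom_ext (LinearMap.ext ((hπ _).forall.2 fun x ↦ by
    change d _ _ (f _ _ _) = π _ x
    rw [hf, hd, coface_eq_spl χ _ _ (by omega), codeg_eq_ctr χ _ _ (by omega), ctr_spl_self]))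
  δ_σ_succ n := ModuleCat.hom_ext (LinearMap.ext ((hπ _).forall.2 fun x ↦ by
    change d _ _ (f _ _ _) = π _ x
    rw [hf, hd, hχ.codeg_coface_one]))
  δ_σ_gt n j h h' := ModuleCat.hom_ext (LinearMap.ext ((hπ _).forall.2 fun x ↦ by
    change d _ _ (f _ _ _) = f _ _ (d _ _ _)
    rw [hf, hd, hd, hf, coface_eq_spl χ _ _ (by omega), codeg_eq_ctr χ _ _ (by omega),
      coface_eq_spl χ _ _ (by omega), codeg_eq_ctr χ _ _ (by omega), ctr_spl_gt n j h h']))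

/-- The cyclic module structure on a quotient `Y` of the graded module `V^{⊗ n+1} ⊗ M` of an
algebra `V`, if all operators descend to `Y` and `τ^{n+1} = 1` on `Y n`. -/
def algData [Ring V] [Algebra k V] (χ : V ⊗[k] M ≃ₗ[k] V ⊗[k] M)
    (hχ : AlgCompat χ) (Y : ℕ → ModuleCat.{u} k) (π : ∀ n, TP k V M (n + 1) →ₗ[k] Y n)
    (hπ : ∀ n, Function.Surjective (π n)) (f : ∀ n, ℕ → (Y (n + 1) →ₗ[k] Y n))
    (d : ∀ n, ℕ → (Y n →ₗ[k] Y (n + 1))) (t : ∀ n, Y n →ₗ[k] Y n)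
    (hf : ∀ n j x, f n j (π (n + 1) x) = π n (face χ n j x))
    (hd : ∀ n j x, d n j (π n x) = π (n + 1) (degen χ n j x))
    (ht : ∀ n x, t n (π n x) = π n ((rot χ n).symm x))
    (hpow : ∀ n y, ((t n) ^ (n + 1)) y = y) : CocyclicData (ModuleCat.{u} k)ᵒᵖ where
  X n := .op (Y n)
  δ n i := (ModuleCat.ofHom (f n i)).op
  σ n i := (ModuleCat.ofHom (d n i)).op
  τ n := (ModuleCat.ofHom (t n)).op
  δ_τ n i _ := congrArg Quiver.Hom.op
    (ModuleCat.hom_ext (LinearMap.ext ((hπ _).forall.2 fun x ↦ by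
    change f _ _ (t _ _) = t _ (f _ _ _)
    rw [hf, ht, ht, hf, (LinearEquiv.eq_symm_apply _).2 (rot_face χ n i _),
      LinearEquiv.apply_symm_apply])))
  δ_zero_τ n := congrArg Quiver.Hom.op
    (ModuleCat.hom_ext (LinearMap.ext ((hπ _).forall.2 fun x ↦ by
    change f _ _ (t _ _) = f _ _ _
    rw [ht, hf, hf, ← hχ.face_last, LinearEquiv.apply_symm_apply])))
  σ_τ n j _ := congrArg Quiver.Hom.op
    (ModuleCat.hom_ext (LinearMap.ext ((hπ _).forall.2 fun x ↦ by
    change d _ _ (t _ _) = t _ (d _ _ _)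
    rw [hd, ht, ht, hd, (LinearEquiv.eq_symm_apply _).2 (rot_degen χ n j _),
      LinearEquiv.apply_symm_apply])))
  σ_zero_τ n := congrArg Quiver.Hom.op
    (ModuleCat.hom_ext (LinearMap.ext ((hπ _).forall.2 fun x ↦ by
    change d _ _ (t _ _) = t _ (t _ (d _ _ _))
    have h := hχ.degen_last n ((rot χ n).symm x)
    rw [LinearEquiv.apply_symm_apply] at h
    rw [ht, hd, hd, ht, ht, h, LinearEquiv.symm_apply_apply, LinearEquiv.symm_apply_apply])))
  τ_pow n := end_pow_op _ _ _ (hpow n)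
  δ_δ n j h := congrArg Quiver.Hom.op
    (ModuleCat.hom_ext (LinearMap.ext ((hπ _).forall.2 fun x ↦ by
    change f _ _ (f _ _ _) = f _ _ (f _ _ _)
    rw [hf, hf, hf, hf, face_eq_mrg χ _ _ (by omega), face_eq_mrg χ _ _ (by omega),
      face_eq_mrg χ _ _ (by omega), face_eq_mrg χ _ _ (by omega), mrg_mrg n j h])))
  σ_σ n j h := congrArg Quiver.Hom.op
    (ModuleCat.hom_ext (LinearMap.ext ((hπ _).forall.2 fun x ↦ by
    change d _ _ (d _ _ _) = d _ _ (d _ _ _)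
    rw [hd, hd, hd, hd, degen_eq_ins χ _ _ (by omega), degen_eq_ins χ _ _ (by omega),
      degen_eq_ins χ _ _ (by omega), degen_eq_ins χ _ _ (by omega), ins_ins n j h])))
  δ_σ_lt n j h := congrArg Quiver.Hom.op
    (ModuleCat.hom_ext (LinearMap.ext ((hπ _).forall.2 fun x ↦ by
    change f _ _ (d _ _ _) = d _ _ (f _ _ _)
    rw [hf, hd, hd, hf, face_eq_mrg χ _ _ (by omega), degen_eq_ins χ _ _ (by omega),
      face_eq_mrg χ _ _ (by omega), degen_eq_ins χ _ _ (by omega), mrg_ins_lt n j h])))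
  δ_σ_self n := congrArg Quiver.Hom.op
    (ModuleCat.hom_ext (LinearMap.ext ((hπ _).forall.2 fun x ↦ by
    change f _ _ (d _ _ _) = π _ x
    rw [hd, hf, face_eq_mrg χ _ _ (by omega), degen_eq_ins χ _ _ (by omega), mrg_ins_self])))
  δ_σ_succ n := congrArg Quiver.Hom.op
    (ModuleCat.hom_ext (LinearMap.ext ((hπ _).forall.2 fun x ↦ by
    change f _ _ (d _ _ _) = π _ x
    rw [hd, hf, hχ.face_one_degen])))
  δ_σ_gt n j h h' := congrArg Quiver.Hom.op
    (ModuleCat.hom_ext (LinearMap.ext ((hπ _).forall.2 fun x ↦ by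
    change f _ _ (d _ _ _) = d _ _ (f _ _ _)
    rw [hf, hd, hd, hf, face_eq_mrg χ _ _ (by omega), degen_eq_ins χ _ _ (by omega),
      face_eq_mrg χ _ _ (by omega), degen_eq_ins χ _ _ (by omega), mrg_ins_gt n j h h'])))

end Quot

section Cyc

variable {k V M : Type u} [Field k] [AddCommGroup V] [Module k V] [AddCommGroup M] [Module k M]

/-- The sequence `a, v 0, v 1, …`. -/
def cons (a : V) (v : ℕ → V) : ℕ → V
  | 0 => a
  | i + 1 => v i

variable (k) in
/-- The pure tensor `v 0 ⊗ ⋯ ⊗ v (n-1) ⊗ m`. -/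
def pureTensor : (n : ℕ) → (ℕ → V) → M → TP k V M n
  | 0, _, m => m
  | n + 1, v, m => v 0 ⊗ₜ[k] pureTensor n (fun i ↦ v (i + 1)) m

theorem pureTensor_congr (n : ℕ) (v w : ℕ → V) (m : M) (h : ∀ i < n, v i = w i) :
    pureTensor k n v m = pureTensor k n w m := by
  induction n generalizing v w with
  | zero => rfl
  | succ n ih =>
    change v 0 ⊗ₜ[k] pureTensor k n (fun i ↦ v (i + 1)) m = w 0 ⊗ₜ[k] pureTensor k n (fun i ↦ w (i + 1)) m
    rw [h 0 (by omega), ih (fun i ↦ v (i + 1)) (fun i ↦ w (i + 1)) fun i hi ↦ h _ (by omega)]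

theorem ext_pure (n : ℕ) {X : Type u} [AddCommGroup X] [Module k X] (f g : TP k V M n →ₗ[k] X)
    (h : ∀ v m, f (pureTensor k n v m) = g (pureTensor k n v m)) : f = g := by
  induction n generalizing X with
  | zero => exact LinearMap.ext fun m ↦ h (fun _ ↦ 0) m
  | succ n ih =>
    refine TensorProduct.ext' fun a x ↦ ?_
    have := ih (f ∘ₗ TensorProduct.mk k V (TP k V M n) a) (g ∘ₗ TensorProduct.mk k V (TP k V M n) a)
      fun v m ↦ h (cons a v) m
    exact LinearMap.congr_fun this x

theorem rot_pure (n : ℕ) (v w : ℕ → V) (m : M) (h : ∀ i < n, w i = v (i + 1)) (h' : w n = v 0) :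
    rot (.refl k (V ⊗[k] M)) n (pureTensor k (n + 1) v m) = pureTensor k (n + 1) w m := by
  induction n generalizing v w with
  | zero =>
    change v 0 ⊗ₜ[k] m = w 0 ⊗ₜ[k] m
    rw [h']
  | succ n ih =>
    change v 1 ⊗ₜ[k] rot (.refl k (V ⊗[k] M)) n (v 0 ⊗ₜ[k] pureTensor k n (fun i ↦ v (i + 1 + 1)) m) =
      w 0 ⊗ₜ[k] pureTensor k (n + 1) (fun i ↦ w (i + 1)) m
    rw [h 0 (by omega)]
    congr 1
    exact ih (cons (v 0) fun i ↦ v (i + 1 + 1)) (fun i ↦ w (i + 1))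
      (fun i hi ↦ h _ (by omega)) h'

theorem rot_refl_pow (n : ℕ) (x : TP k V M (n + 1)) :
    ((rot (.refl k (V ⊗[k] M)) n) ^ (n + 1)) x = x := by
  suffices ((rot (.refl k (V ⊗[k] M)) n) ^ (n + 1)).toLinearMap = LinearMap.id from
    LinearMap.congr_fun this x
  refine ext_pure (n + 1) _ _ fun v m ↦ ?_
  have h1 : pureTensor k (n + 1) v m = pureTensor k (n + 1) (fun i ↦ v (i % (n + 1))) m :=
    pureTensor_congr _ _ _ _ fun i hi ↦ by rw [Nat.mod_eq_of_lt hi]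
  have h2 (j : ℕ) : ((rot (.refl k (V ⊗[k] M)) n) ^ j)
      (pureTensor k (n + 1) (fun i ↦ v (i % (n + 1))) m) =
      pureTensor k (n + 1) (fun i ↦ v ((i + j) % (n + 1))) m := by
    induction j with
    | zero => rfl
    | succ j ih =>
      rw [pow_succ', LinearEquiv.mul_apply, ih]
      refine rot_pure n _ _ m (fun i hi ↦ ?_) ?_
      · rw [add_right_comm, add_assoc i]
      · rw [show n + (j + 1) = 0 + j + (n + 1) by omega, Nat.add_mod_right]
  change ((rot (.refl k (V ⊗[k] M)) n) ^ (n + 1)) (pureTensor k (n + 1) v m) = pureTensor k (n + 1) v m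
  rw [h1, h2]
  simp only [Nat.add_mod_right]

theorem symm_pow_apply {X : Type u} [AddCommGroup X] [Module k X] (e : X ≃ₗ[k] X) (m : ℕ) (x : X) :
    (e.symm.toLinearMap ^ m) x = (e ^ m).symm x := by
  induction m generalizing x with
  | zero => rfl
  | succ m ih =>
    rw [pow_succ', pow_succ]
    change e.symm ((e.symm.toLinearMap ^ m) x) = _
    rw [ih]
    rfl

end Cyc

variable (k A : Type u) [Field k] [Ring A] [Algebra k A] in
/-- The operators of the classical cyclic module of an algebra. -/
def cycData : CocyclicData (ModuleCat.{u} k)ᵒᵖ :=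
  algData (.refl k (A ⊗[k] k)) (algCompat_refl A k) (fun n ↦ TP k A k (n + 1))
    (fun _ ↦ LinearMap.id) (fun _ ↦ Function.surjective_id)
    (face (.refl k (A ⊗[k] k))) (degen (.refl k (A ⊗[k] k)))
    (fun n ↦ (rot (.refl k (A ⊗[k] k)) n).symm.toLinearMap)
    (fun _ _ _ ↦ rfl) (fun _ _ _ ↦ rfl) (fun _ _ ↦ rfl) (fun n y ↦ by
      rw [symm_pow_apply, LinearEquiv.symm_apply_eq]
      exact (rot_refl_pow n y).symm)

variable (k A : Type u) [Field k] [Ring A] [Algebra k A] in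
/-- The classical cyclic module `Cyc(A)`, given in degree `n` by `A^{⊗ n+1}` (written as
`A^{⊗ n+1} ⊗ k`). -/
def Cyc : CyclicCatᵒᵖ ⥤ ModuleCat.{u} k := (cycData k A).toFunctor.leftOp

end

end HopfCyclic

namespace HopfCyclic

noncomputable section

open CategoryTheory CategoryTheory.Limits TensorProduct

universe u v w u' v' w'

set_option linter.unusedSectionVars false

/-- A graded `k`-module with degree raising operators `up`, degree lowering operators `down`,
invertible operators `τ` and operators `L h` for `h ∈ H`. -/
structure ParaData (k H : Type u) [Field k] [Ring H] [HopfAlgebra k H] where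
  X : ℕ → ModuleCat.{u} k
  up (n : ℕ) : ℕ → (X n →ₗ[k] X (n + 1))
  down (n : ℕ) : ℕ → (X (n + 1) →ₗ[k] X n)
  τ (n : ℕ) : X n ≃ₗ[k] X n
  L (n : ℕ) : H →ₗ[k] Module.End k (X n)

namespace ParaData

variable {k H : Type u} [Field k] [Ring H] [HopfAlgebra k H] (T : ParaData k H)

/-- The smallest graded `k`-submodule `J` which is stable under all the operators `up`, `down`,
`τ`, `τ⁻¹` and `L h`, and contains the elements `[L_h, τ^i](Ψ) + (τ^{n+1} - 1)(Φ)` for `i ∈ ℤ`.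
(In the applications, the operators `up n j` and `down n j` with `j` beyond the usual range are
composites of those in the range with powers of `τ`.) -/
inductive J : (n : ℕ) → T.X n → Prop
  | gen (n : ℕ) (h : H) (i : ℤ) (Ψ Φ : T.X n) :
      J n (T.L n h ((T.τ n ^ i) Ψ) - (T.τ n ^ i) (T.L n h Ψ) + ((T.τ n ^ (n + 1)) Φ - Φ))
  | add {n : ℕ} {x y : T.X n} : J n x → J n y → J n (x + y)
  | smul {n : ℕ} (c : k) {x : T.X n} : J n x → J n (c • x)
  | up {n : ℕ} (j : ℕ) {x : T.X n} : J n x → J (n + 1) (T.up n j x)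
  | down {n : ℕ} (j : ℕ) {x : T.X (n + 1)} : J (n + 1) x → J n (T.down n j x)
  | τ {n : ℕ} {x : T.X n} : J n x → J n (T.τ n x)
  | τ_symm {n : ℕ} {x : T.X n} : J n x → J n ((T.τ n).symm x)
  | L {n : ℕ} (h : H) {x : T.X n} : J n x → J n (T.L n h x)

theorem J_comm (n : ℕ) (h : H) (i : ℤ) (Ψ : T.X n) :
    T.J n (T.L n h ((T.τ n ^ i) Ψ) - (T.τ n ^ i) (T.L n h Ψ)) := by
  have := J.gen (T := T) n h i Ψ 0
  rwa [map_zero, sub_zero, add_zero] at this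

theorem J_pow (n : ℕ) (Φ : T.X n) : T.J n ((T.τ n ^ (n + 1)) Φ - Φ) := by
  have := J.gen (T := T) n 0 0 0 Φ
  rwa [map_zero, map_zero, map_zero, map_zero, sub_zero, zero_add] at this

/-- The submodule `J` in degree `n`. -/
def JSub (n : ℕ) : Submodule k (T.X n) where
  carrier := {x | T.J n x}
  add_mem' := J.add
  zero_mem' := by
    have := J.smul (T := T) 0 (T.J_pow n 0)
    rwa [zero_smul] at this
  smul_mem' c _ := J.smul c

/-- The submodule spanned by the elements `h x - ε(h) x`. -/
def ISub (n : ℕ) : Submodule k (T.X n) :=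
  Submodule.span k (Set.range fun p : H × T.X n ↦
    T.L n p.1 p.2 - Coalgebra.counit (R := k) p.1 • p.2)

/-- The kernel of the projection of `X n` onto the coinvariants `k ⊗_H (X n / J n)`. -/
def K (n : ℕ) : Submodule k (T.X n) := T.JSub n ⊔ T.ISub n

/-- The space of coinvariants `k ⊗_H (X n / J n)`, that is, the quotient of `X n` by `J n` and by
all elements `h x - ε(h) x`. -/
abbrev C (n : ℕ) : ModuleCat.{u} k := .of k (T.X n ⧸ T.K n)

variable {T}

theorem J_le_K {n : ℕ} {x : T.X n} (hx : T.J n x) : x ∈ T.K n :=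
  Submodule.mem_sup_left (show x ∈ T.JSub n from hx)

theorem I_mem_K {n : ℕ} (h : H) (x : T.X n) :
    T.L n h x - Coalgebra.counit (R := k) h • x ∈ T.K n :=
  Submodule.mem_sup_right (Submodule.subset_span ⟨(h, x), rfl⟩)

theorem K_map {T T' : ParaData k H} {n m : ℕ} (f : T.X n →ₗ[k] T'.X m)
    (hJ : ∀ x, T.J n x → f x ∈ T'.K m)
    (hI : ∀ h x, f (T.L n h x - Coalgebra.counit (R := k) h • x) ∈ T'.K m)
    {x : T.X n} (hx : x ∈ T.K n) : f x ∈ T'.K m := by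
  have : T.K n ≤ (T'.K m).comap f := by
    refine sup_le (fun x hx ↦ hJ x hx) (Submodule.span_le.2 ?_)
    rintro _ ⟨⟨h, x⟩, rfl⟩
    exact hI h x
  exact this hx

theorem K_τ {n : ℕ} {x : T.X n} (hx : x ∈ T.K n) : T.τ n x ∈ T.K n := by
  refine K_map (T.τ n).toLinearMap (fun x hx ↦ J_le_K hx.τ) (fun h x ↦ ?_) hx
  have h1 := J_le_K (T.J_comm n h 1 x)
  have h2 := I_mem_K h (T.τ n x)
  rw [zpow_one] at h1
  have h3 := (T.K n).sub_mem h2 h1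
  refine (congrArg (· ∈ T.K n) ?_).mp h3
  change _ = T.τ n _
  rw [map_sub, map_smul]
  abel

theorem K_τ_symm {n : ℕ} {x : T.X n} (hx : x ∈ T.K n) : (T.τ n).symm x ∈ T.K n := by
  refine K_map (T.τ n).symm.toLinearMap (fun x hx ↦ J_le_K hx.τ_symm) (fun h x ↦ ?_) hx
  have h1 := J_le_K (T.J_comm n h (-1) x)
  have h2 := I_mem_K h ((T.τ n).symm x)
  rw [zpow_neg_one] at h1
  have h3 := (T.K n).sub_mem h2 h1
  refine (congrArg (· ∈ T.K n) ?_).mp h3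
  change T.L n h ((T.τ n).symm x) - _ - (T.L n h ((T.τ n).symm x) - (T.τ n).symm (T.L n h x)) =
    (T.τ n).symm _
  rw [map_sub, map_smul]
  abel

theorem K_up {n j : ℕ} (hL : ∀ h x, T.up n j (T.L n h x) = T.L (n + 1) h (T.up n j x))
    {x : T.X n} (hx : x ∈ T.K n) : T.up n j x ∈ T.K (n + 1) :=
  K_map (T.up n j) (fun _ hx ↦ J_le_K (hx.up j)) (fun h x ↦ by
    rw [map_sub, map_smul, hL]
    exact I_mem_K h _) hx

theorem K_down {n j : ℕ} (hL : ∀ h x, T.down n j (T.L (n + 1) h x) = T.L n h (T.down n j x))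
    {x : T.X (n + 1)} (hx : x ∈ T.K (n + 1)) : T.down n j x ∈ T.K n :=
  K_map (T.down n j) (fun _ hx ↦ J_le_K (hx.down j)) (fun h x ↦ by
    rw [map_sub, map_smul, hL]
    exact I_mem_K h _) hx

variable (T) in
theorem K_pow (n : ℕ) (t : T.C n →ₗ[k] T.C n)
    (ht : ∀ x, t ((T.K n).mkQ x) = (T.K n).mkQ (T.τ n x)) (y : T.C n) : (t ^ (n + 1)) y = y := by
  obtain ⟨x, rfl⟩ := (T.K n).mkQ_surjective y
  have h (m : ℕ) : (t ^ m) ((T.K n).mkQ x) = (T.K n).mkQ ((T.τ n ^ m) x) := by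
    induction m with
    | zero => rfl
    | succ m ih => rw [pow_succ', pow_succ', Module.End.mul_apply, ih, ht, LinearEquiv.mul_apply]
  rw [h]
  exact (Submodule.Quotient.eq _).2 (J_le_K (T.J_pow n x))

end ParaData

section DiagAction

variable {k H : Type u} [Field k] [Ring H] [HopfAlgebra k H]

theorem diagAct_map {V W V' W' : Type u} [AddCommGroup V] [Module k V] [AddCommGroup W]
    [Module k W] [AddCommGroup V'] [Module k V'] [AddCommGroup W'] [Module k W']
    {ρ : H →ₗ[k] Module.End k V} {σ : H →ₗ[k] Module.End k W}
    {ρ' : H →ₗ[k] Module.End k V'} {σ' : H →ₗ[k] Module.End k W'}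
    (f : V →ₗ[k] V') (g : W →ₗ[k] W') (hf : ∀ h v, f (ρ h v) = ρ' h (f v))
    (hg : ∀ h w, g (σ h w) = σ' h (g w)) (h : H) (x : V ⊗[k] W) :
    TensorProduct.map f g (diagAct ρ σ h x) = diagAct ρ' σ' h (TensorProduct.map f g x) := by
  induction x with
  | zero => simp
  | add z z' hz hz' => simp only [map_add, hz, hz']
  | tmul v w =>
    rw [TensorProduct.map_tmul, diagAct_apply, diagAct_apply]
    induction Coalgebra.comul (R := k) h with
    | zero => simp
    | add z z' hz hz' => simp only [map_add, hz, hz']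
    | tmul p q =>
      change f (ρ p v) ⊗ₜ[k] g (σ q w) = ρ' p (f v) ⊗ₜ[k] σ' q (g w)
      rw [hf, hg]

theorem diagAct_assoc {U V W : Type u} [AddCommGroup U] [Module k U] [AddCommGroup V]
    [Module k V] [AddCommGroup W] [Module k W]
    (ρ : H →ₗ[k] Module.End k U) (σ : H →ₗ[k] Module.End k V) (θ : H →ₗ[k] Module.End k W)
    (h : H) (x : (U ⊗[k] V) ⊗[k] W) :
    TensorProduct.assoc k U V W (diagAct (diagAct ρ σ) θ h x) =
      diagAct ρ (diagAct σ θ) h (TensorProduct.assoc k U V W x) := by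
  suffices (TensorProduct.assoc k U V W).toLinearMap ∘ₗ diagAct (diagAct ρ σ) θ h =
    diagAct ρ (diagAct σ θ) h ∘ₗ (TensorProduct.assoc k U V W).toLinearMap from
    LinearMap.congr_fun this x
  refine TensorProduct.ext_threefold fun a b c ↦ ?_
  change TensorProduct.assoc k U V W (diagAct (diagAct ρ σ) θ h ((a ⊗ₜ b) ⊗ₜ c)) =
    diagAct ρ (diagAct σ θ) h (a ⊗ₜ (b ⊗ₜ c))
  let G : H ⊗[k] (H ⊗[k] H) →ₗ[k] U ⊗[k] (V ⊗[k] W) :=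
    TensorProduct.map (ρ.flip a) (TensorProduct.map (σ.flip b) (θ.flip c))
  have h1 (z : H ⊗[k] H) : TensorProduct.assoc k U V W
      (TensorProduct.map ((diagAct ρ σ).flip (a ⊗ₜ b)) (θ.flip c) z) =
      G (TensorProduct.assoc k H H H ((Coalgebra.comul (R := k) (A := H)).rTensor H z)) := by
    induction z with
    | zero => simp
    | add z z' hz hz' => simp only [map_add, hz, hz']
    | tmul p q =>
      change TensorProduct.assoc k U V W (diagAct ρ σ p (a ⊗ₜ b) ⊗ₜ θ q c) =
        G (TensorProduct.assoc k H H H (Coalgebra.comul (R := k) p ⊗ₜ q))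
      rw [diagAct_apply]
      induction Coalgebra.comul (R := k) p with
      | zero => simp
      | add z z' hz hz' => simp only [map_add, add_tmul, hz, hz']
      | tmul r s => rfl
  have h2 (z : H ⊗[k] H) : TensorProduct.map (ρ.flip a) ((diagAct σ θ).flip (b ⊗ₜ c)) z =
      G ((Coalgebra.comul (R := k) (A := H)).lTensor H z) := by
    induction z with
    | zero => simp
    | add z z' hz hz' => simp only [map_add, hz, hz']
    | tmul p q =>
      change ρ p a ⊗ₜ[k] diagAct σ θ q (b ⊗ₜ c) = G (p ⊗ₜ Coalgebra.comul (R := k) q)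
      rw [diagAct_apply]
      rfl
  rw [diagAct_apply, diagAct_apply, h1, h2, Coalgebra.coassoc_apply]

/-- An invariant element on the left can be pulled out of the diagonal action. -/
theorem diagAct_inv {V W X : Type u} [AddCommGroup V] [Module k V] [AddCommGroup W] [Module k W]
    [AddCommGroup X] [Module k X]
    (ρ : H →ₗ[k] Module.End k V) (σ : H →ₗ[k] Module.End k W) (f : V →ₗ[k] X) (v : V)
    (hv : ∀ h, f (ρ h v) = Coalgebra.counit (R := k) h • f v) (h : H) (w : W) :
    f.rTensor W (diagAct ρ σ h (v ⊗ₜ w)) = f v ⊗ₜ σ h w := by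
  have h1 (z : H ⊗[k] H) : f.rTensor W (TensorProduct.map (ρ.flip v) (σ.flip w) z) =
      f v ⊗ₜ[k] σ (TensorProduct.lid k H
        ((Coalgebra.counit (R := k) (A := H)).rTensor H z)) w := by
    induction z with
    | zero => simp
    | add z z' hz hz' => simp only [map_add, LinearMap.add_apply, tmul_add, hz, hz']
    | tmul p q =>
      change f (ρ p v) ⊗ₜ[k] σ q w = f v ⊗ₜ[k] σ (Coalgebra.counit (R := k) p • q) w
      rw [hv, map_smul, LinearMap.smul_apply, tmul_smul, smul_tmul']
  rw [diagAct_apply, h1, Coalgebra.rTensor_counit_comul]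
  simp

variable (k H) in
/-- The diagonal action of `H` on `V^{⊗ n} ⊗ M`. -/
def diagL (V M : Type u) [AddCommGroup V] [Module k V] [Module H V] [IsScalarTower k H V]
    [AddCommGroup M] [Module k M] [Module H M] [IsScalarTower k H M] :
    (n : ℕ) → H →ₗ[k] Module.End k (TP k V M n)
  | 0 => lact k H M
  | n + 1 => diagAct (lact k H V) (diagL V M n)

variable (M : Type u) [AddCommGroup M] [Module k M] [Module H M] [IsScalarTower k H M]

section
variable (C : Type u) [AddCommGroup C] [Module k C] [Coalgebra k C] [Module H C]
    [IsScalarTower k H C] [HModuleCoalgebra k H C]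

theorem spl_diagL (j n : ℕ) (h : H) (x : TP k C M (n + 1)) :
    spl k C M j n (diagL k H C M (n + 1) h x) = diagL k H C M (n + 2) h (spl k C M j n x) := by
  induction n generalizing j h with
  | zero =>
    cases j with
    | zero =>
      refine Eq.trans ?_ (diagAct_assoc _ _ _ _ _)
      refine congrArg (TensorProduct.assoc k C C (TP k C M 0)) ?_
      exact diagAct_map _ _ (HModuleCoalgebra.comul_smul) (fun _ _ ↦ rfl) h x
    | succ j => exact (map_zero (diagL k H C M 2 h)).symm
  | succ n ih =>
    cases j with
    | zero =>
      refine Eq.trans ?_ (diagAct_assoc _ _ _ _ _)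
      refine congrArg (TensorProduct.assoc k C C (TP k C M (n + 1))) ?_
      exact diagAct_map _ _ (HModuleCoalgebra.comul_smul) (fun _ _ ↦ rfl) h x
    | succ j => exact diagAct_map _ _ (fun _ _ ↦ rfl) (fun h x ↦ ih j h x) h x

variable (k) in
/-- The counit applied to the first tensor factor. -/
def ctrFirst (n : ℕ) : TP k C M (n + 1) →ₗ[k] TP k C M n :=
  (TensorProduct.lid k (TP k C M n)).toLinearMap ∘ₗ
      (Coalgebra.counit (R := k) (A := C)).rTensor (TP k C M n)

theorem ctrFirst_diagL (n : ℕ) (h : H) (x : TP k C M (n + 1)) :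
    ctrFirst k M C n (diagL k H C M (n + 1) h x) = diagL k H C M n h (ctrFirst k M C n x) := by
  induction x using TensorProduct.induction_on with
  | zero => simp
  | add z z' hz hz' => simp only [map_add, hz, hz']
  | tmul c x =>
    refine (congrArg (TensorProduct.lid k (TP k C M n)) (diagAct_inv _ _ _ _ (fun h ↦
      HModuleCoalgebra.counit_smul h c) _ _)).trans ?_
    change Coalgebra.counit (R := k) c • diagL k H C M n h x =
      diagL k H C M n h (Coalgebra.counit (R := k) c • x)
    rw [map_smul]

theorem ctr_diagL (j n : ℕ) (h : H) (x : TP k C M (n + 2)) :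
    ctr k C M j n (diagL k H C M (n + 2) h x) = diagL k H C M (n + 1) h (ctr k C M j n x) := by
  induction n generalizing j h with
  | zero =>
    cases j with
    | zero => exact diagAct_map _ _ (fun _ _ ↦ rfl) (fun h x ↦ ctrFirst_diagL M C 0 h x) h x
    | succ j => exact (map_zero (diagL k H C M 1 h)).symm
  | succ n ih =>
    cases j with
    | zero => exact diagAct_map _ _ (fun _ _ ↦ rfl) (fun h x ↦ ctrFirst_diagL M C (n + 1) h x) h x
    | succ j => exact diagAct_map _ _ (fun _ _ ↦ rfl) (fun h x ↦ ih j h x) h x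

end

section
variable (A : Type u) [Ring A] [Algebra k A] [Module H A] [IsScalarTower k H A]
  [HModuleAlgebra k H A]

theorem mrg_diagL (n : ℕ) (h : H) (x : TP k A M (n + 2)) :
    mrg k A M 0 n (diagL k H A M (n + 2) h x) = diagL k H A M (n + 1) h (mrg k A M 0 n x) := by
  have h1 : (TensorProduct.assoc k A A (TP k A M n)).symm (diagL k H A M (n + 2) h x) =
      diagAct (diagAct (lact k H A) (lact k H A)) (diagL k H A M n) h
        ((TensorProduct.assoc k A A (TP k A M n)).symm x) := by
    rw [LinearEquiv.symm_apply_eq, diagAct_assoc, LinearEquiv.apply_symm_apply]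
    rfl
  refine (congrArg ((LinearMap.mul' k A).rTensor (TP k A M n)) h1).trans ?_
  refine diagAct_map _ _ (fun h y ↦ ?_) (fun _ _ ↦ rfl) h _
  induction y with
  | zero => simp
  | add z z' hz hz' => simp only [map_add, hz, hz']
  | tmul a b => exact (HModuleAlgebra.smul_mul h a b).symm

theorem ins_diagL (n : ℕ) (h : H) (x : TP k A M (n + 1)) :
    ins k A M 0 n (diagL k H A M (n + 1) h x) = diagL k H A M (n + 2) h (ins k A M 0 n x) := by
  refine diagAct_map _ _ (fun _ _ ↦ rfl) (fun h y ↦ ?_) h x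
  exact (diagAct_inv (lact k H A) (diagL k H A M n) LinearMap.id (1 : A)
    (fun h ↦ HModuleAlgebra.smul_one h) h y).symm.trans
      (LinearMap.congr_fun (LinearMap.rTensor_id _ _) _)

end

end DiagAction

section Covers

variable (k H A C M : Type u) [Field k] [Ring H] [HopfAlgebra k H] [InvertibleAntipode k H]
  [AddCommGroup M] [Module k M] [Module H M] [IsScalarTower k H M] [LeftComodule k H M]

section
variable [AddCommGroup C] [Module k C] [Coalgebra k C] [Module H C] [IsScalarTower k H C]

/-- The cover complex `T_n(C, M) = C^{⊗ n+1} ⊗ M` of a module coalgebra. -/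
def coverCoalg : ParaData k H where
  X n := TP k C M (n + 1)
  up := coface (chi k H C M)
  down := codeg (chi k H C M)
  τ := rot (chi k H C M)
  L n := diagL k H C M (n + 1)

variable [HModuleCoalgebra k H C]

theorem coverCoalg_up (n j : ℕ) (x : (coverCoalg k H C M).X n) (hx : x ∈ (coverCoalg k H C M).K n) :
    (coverCoalg k H C M).up n j x ∈ (coverCoalg k H C M).K (n + 1) := by
  induction j generalizing x with
  | zero => exact ParaData.K_up (fun h x ↦ spl_diagL M C 0 n h x) hx
  | succ j ih => exact ParaData.K_τ_symm (ih _ (ParaData.K_τ hx))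

theorem coverCoalg_down (n j : ℕ) (x : (coverCoalg k H C M).X (n + 1))
    (hx : x ∈ (coverCoalg k H C M).K (n + 1)) :
    (coverCoalg k H C M).down n j x ∈ (coverCoalg k H C M).K n := by
  induction j generalizing x with
  | zero => exact ParaData.K_down (fun h x ↦ ctr_diagL M C 0 n h x) hx
  | succ j ih => exact ParaData.K_τ_symm (ih _ (ParaData.K_τ hx))

/-- The operators of the Hopf-cocyclic module of `(C, M)`. -/
def hopfCocyclicData : CocyclicData (ModuleCat.{u} k) :=
  let T := coverCoalg k H C M
  coalgData (chi k H C M) (coCompat_chi C M) T.C (fun n ↦ (T.K n).mkQ)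
    (fun n ↦ (T.K n).mkQ_surjective)
    (fun n j ↦ (T.K n).mapQ (T.K (n + 1)) (T.up n j) (coverCoalg_up k H C M n j))
    (fun n j ↦ (T.K (n + 1)).mapQ (T.K n) (T.down n j) (coverCoalg_down k H C M n j))
    (fun n ↦ (T.K n).mapQ (T.K n) (T.τ n).toLinearMap fun _ ↦ ParaData.K_τ)
    (fun _ _ _ ↦ rfl) (fun _ _ _ ↦ rfl) (fun _ _ ↦ rfl)
    (fun n ↦ ParaData.K_pow T n _ fun _ ↦ rfl)

/-- The Hopf-cocyclic module `C_•(C, M)`. -/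
def hopfCocyclic : CyclicCat ⥤ ModuleCat.{u} k := (hopfCocyclicData k H C M).toFunctor

end

section
variable [Ring A] [Algebra k A] [Module H A] [IsScalarTower k H A]

/-- The cover complex `T_n(A, M) = A^{⊗ n+1} ⊗ M` of a module algebra. -/
def coverAlg : ParaData k H where
  X n := TP k A M (n + 1)
  up := degen (chi k H A M)
  down := face (chi k H A M)
  τ n := (rot (chi k H A M) n).symm
  L n := diagL k H A M (n + 1)

variable [HModuleAlgebra k H A]

theorem coverAlg_up (n j : ℕ) (x : (coverAlg k H A M).X n) (hx : x ∈ (coverAlg k H A M).K n) :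
    (coverAlg k H A M).up n j x ∈ (coverAlg k H A M).K (n + 1) := by
  induction j generalizing x with
  | zero => exact ParaData.K_up (fun h x ↦ ins_diagL M A n h x) hx
  | succ j ih => exact ParaData.K_τ (ih _ (ParaData.K_τ_symm hx))

theorem coverAlg_down (n j : ℕ) (x : (coverAlg k H A M).X (n + 1))
    (hx : x ∈ (coverAlg k H A M).K (n + 1)) :
    (coverAlg k H A M).down n j x ∈ (coverAlg k H A M).K n := by
  induction j generalizing x with
  | zero => exact ParaData.K_down (fun h x ↦ mrg_diagL M A n h x) hx
  | succ j ih => exact ParaData.K_τ (ih _ (ParaData.K_τ_symm hx))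

/-- The operators of the Hopf-cyclic module of `(A, M)`. -/
def hopfCyclicData : CocyclicData (ModuleCat.{u} k)ᵒᵖ :=
  let T := coverAlg k H A M
  algData (chi k H A M) (algCompat_chi A M) T.C (fun n ↦ (T.K n).mkQ)
    (fun n ↦ (T.K n).mkQ_surjective)
    (fun n j ↦ (T.K (n + 1)).mapQ (T.K n) (T.down n j) (coverAlg_down k H A M n j))
    (fun n j ↦ (T.K n).mapQ (T.K (n + 1)) (T.up n j) (coverAlg_up k H A M n j))
    (fun n ↦ (T.K n).mapQ (T.K n) (T.τ n).toLinearMap fun _ ↦ ParaData.K_τ)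
    (fun _ _ _ ↦ rfl) (fun _ _ _ ↦ rfl) (fun _ _ ↦ rfl)
    (fun n ↦ ParaData.K_pow T n _ fun _ ↦ rfl)

/-- The Hopf-cyclic module `C_•(A, M)`. -/
def hopfCyclic : CyclicCatᵒᵖ ⥤ ModuleCat.{u} k := (hopfCyclicData k H A M).toFunctor.leftOp

end

end Covers

end

end HopfCyclic

namespace HopfCyclic

noncomputable section

open CategoryTheory CategoryTheory.Limits TensorProduct

universe u v w u' v' w'

set_option linter.unusedSectionVars false

section JCoalg

variable (k H C M : Type u) [Field k] [Ring H] [HopfAlgebra k H] [InvertibleAntipode k H]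
  [AddCommGroup M] [Module k M] [Module H M] [IsScalarTower k H M] [LeftComodule k H M]
  [AddCommGroup C] [Module k C] [Module H C] [IsScalarTower k H C]

/-! The submodule `J` of the cover complex of a coalgebra needs no closure under cofaces and
codegeneracies. -/

/-- The smallest graded submodule stable under `τ`, `τ⁻¹` and `H` which contains all
`[L_h, τ](Ψ)` and `(τ^{n+1} - 1)(Φ)`. -/
inductive JMin : (n : ℕ) → TP k C M (n + 1) → Prop
  | comm (n : ℕ) (h : H) (Ψ : TP k C M (n + 1)) :
      JMin n (diagL k H C M (n + 1) h (rot (chi k H C M) n Ψ) -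
        rot (chi k H C M) n (diagL k H C M (n + 1) h Ψ))
  | pow (n : ℕ) (Φ : TP k C M (n + 1)) : JMin n (((rot (chi k H C M) n) ^ (n + 1)) Φ - Φ)
  | add {n : ℕ} {x y : TP k C M (n + 1)} : JMin n x → JMin n y → JMin n (x + y)
  | smul {n : ℕ} (c : k) {x : TP k C M (n + 1)} : JMin n x → JMin n (c • x)
  | τ {n : ℕ} {x : TP k C M (n + 1)} : JMin n x → JMin n (rot (chi k H C M) n x)
  | τ_symm {n : ℕ} {x : TP k C M (n + 1)} : JMin n x → JMin n ((rot (chi k H C M) n).symm x)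
  | L {n : ℕ} (h : H) {x : TP k C M (n + 1)} : JMin n x → JMin n (diagL k H C M (n + 1) h x)

namespace JMin

variable {k H C M}

theorem zero (n : ℕ) : JMin k H C M n 0 := by
  have := JMin.smul (0 : k) (JMin.pow (k := k) (H := H) (C := C) (M := M) n 0)
  rwa [zero_smul] at this

theorem sub {n : ℕ} {x y : TP k C M (n + 1)} (hx : JMin k H C M n x) (hy : JMin k H C M n y) :
    JMin k H C M n (x - y) := by
  have := hx.add (hy.smul (-1))
  rwa [neg_one_smul, ← sub_eq_add_neg] at this

theorem comm_zpow (n : ℕ) (h : H) (i : ℤ) (Ψ : TP k C M (n + 1)) :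
    JMin k H C M n (diagL k H C M (n + 1) h (((rot (chi k H C M) n) ^ i) Ψ) -
        ((rot (chi k H C M) n) ^ i) (diagL k H C M (n + 1) h Ψ)) := by
  induction i with
  | zero =>
    rw [zpow_zero]
    change JMin k H C M n (diagL k H C M (n + 1) h Ψ - diagL k H C M (n + 1) h Ψ)
    rw [sub_self]
    exact zero n
  | succ i ih =>
    rw [add_comm (i : ℤ) 1, zpow_one_add, LinearEquiv.mul_apply, LinearEquiv.mul_apply]
    have h1 := (JMin.comm n h (((rot (chi k H C M) n) ^ (i : ℤ)) Ψ)).add ih.τ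
    rw [map_sub] at h1
    refine (congrArg (JMin k H C M n) ?_).mp h1
    abel
  | pred i ih =>
    rw [show -(i : ℤ) - 1 = -1 + -(i : ℤ) by omega, zpow_add, zpow_neg_one,
      LinearEquiv.mul_apply, LinearEquiv.mul_apply]
    generalize ((rot (chi k H C M) n) ^ (-(i : ℤ))) Ψ = y at *
    generalize ((rot (chi k H C M) n) ^ (-(i : ℤ))) _ = z at *
    have h1 := ih.τ_symm.sub
      (JMin.comm n h ((rot (chi k H C M) n).symm y)).τ_symm
    rw [LinearEquiv.apply_symm_apply, map_sub, map_sub, LinearEquiv.symm_apply_apply] at h1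
    refine (congrArg (JMin k H C M n) ?_).mp h1
    change _ = diagL k H C M (n + 1) h ((rot (chi k H C M) n).symm y) -
      (rot (chi k H C M) n).symm z
    abel

section

variable [Coalgebra k C] [HModuleCoalgebra k H C]

theorem coface_diagL (n j : ℕ) (hj : j ≤ n) (h : H) (x : TP k C M (n + 1)) :
    coface (chi k H C M) n j (diagL k H C M (n + 1) h x) =
      diagL k H C M (n + 2) h (coface (chi k H C M) n j x) := by
  rw [coface_eq_spl _ n j hj, spl_diagL]

theorem codeg_diagL (n j : ℕ) (hj : j ≤ n) (h : H) (x : TP k C M (n + 2)) :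
    codeg (chi k H C M) n j (diagL k H C M (n + 2) h x) =
      diagL k H C M (n + 1) h (codeg (chi k H C M) n j x) := by
  rw [codeg_eq_ctr _ n j hj, ctr_diagL]

theorem coface_add (n j : ℕ) (x : TP k C M (n + 1)) :
    coface (chi k H C M) n (j + (n + 1)) x =
      rot (chi k H C M) (n + 1) (coface (chi k H C M) n j x) := by
  induction j generalizing x with
  | zero =>
    rw [zero_add]
    exact (coCompat_chi C M).coface_last n x
  | succ j ih =>
    apply (rot (chi k H C M) (n + 1)).injective
    rw [show j + 1 + (n + 1) = j + (n + 1) + 1 by omega, rot_coface, ih, rot_coface]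

theorem codeg_add (n j : ℕ) (x : TP k C M (n + 2)) :
    rot (chi k H C M) n (codeg (chi k H C M) n (j + (n + 2)) x) =
      codeg (chi k H C M) n j x := by
  induction j generalizing x with
  | zero =>
    apply (rot (chi k H C M) n).injective
    rw [zero_add, rot_codeg, rot_codeg, (coCompat_chi C M).codeg_last]
  | succ j ih =>
    apply (rot (chi k H C M) n).injective
    rw [show j + 1 + (n + 2) = j + (n + 2) + 1 by omega, rot_codeg, ih, rot_codeg]

theorem coface_pow (n j m : ℕ) (x : TP k C M (n + 1)) :
    coface (chi k H C M) n j (((rot (chi k H C M) n) ^ m) x) =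
      ((rot (chi k H C M) (n + 1)) ^ m) (coface (chi k H C M) n (j + m) x) := by
  induction m generalizing j with
  | zero => rfl
  | succ m ih =>
    rw [pow_succ', LinearEquiv.mul_apply, ← rot_coface, ih, pow_succ', LinearEquiv.mul_apply,
      show j + 1 + m = j + (m + 1) by omega]

theorem codeg_pow (n j m : ℕ) (x : TP k C M (n + 2)) :
    codeg (chi k H C M) n j (((rot (chi k H C M) (n + 1)) ^ m) x) =
      ((rot (chi k H C M) n) ^ m) (codeg (chi k H C M) n (j + m) x) := by
  induction m generalizing j with
  | zero => rfl
  | succ m ih =>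
    rw [pow_succ', LinearEquiv.mul_apply, ← rot_codeg, ih, pow_succ', LinearEquiv.mul_apply,
      show j + 1 + m = j + (m + 1) by omega]

theorem codeg_last (n : ℕ) (x : TP k C M (n + 2)) :
    codeg (chi k H C M) n n (rot (chi k H C M) (n + 1) x) = ctrFirst k M C (n + 1) x := by
  rw [codeg_eq_ctr _ n n le_rfl]
  induction n with
  | zero =>
    suffices ctr k C M 0 0 ∘ₗ (rot (chi k H C M) 1).toLinearMap = ctrFirst k M C (0 + 1) from
      LinearMap.congr_fun this x
    refine ext2 fun a b m ↦ ?_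
    change b ⊗ₜ[k] (TensorProduct.lid k M ((Coalgebra.counit (R := k) (A := C)).rTensor M
      (chi k H C M (a ⊗ₜ m)))) = Coalgebra.counit (R := k) a • (b ⊗ₜ[k] m)
    rw [(coCompat_chi C M).counit]
    exact TensorProduct.tmul_smul (Coalgebra.counit (R := k) a) b m
  | succ n ih =>
    suffices ctr k C M (n + 1) (n + 1) ∘ₗ (rot (chi k H C M) (n + 2)).toLinearMap =
      ctrFirst k M C (n + 2) from LinearMap.congr_fun this x
    refine ext2 fun a b x ↦ ?_
    change b ⊗ₜ[k] ctr k C M n n (rot (chi k H C M) (n + 1) (a ⊗ₜ x)) =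
      Coalgebra.counit (R := k) a • (b ⊗ₜ[k] x)
    rw [ih]
    exact TensorProduct.tmul_smul (Coalgebra.counit (R := k) a) b x

theorem coface_comm (n j : ℕ) (hj : j ≤ n) (h : H) (Ψ : TP k C M (n + 1)) :
    JMin k H C M (n + 1) (coface (chi k H C M) n j
      (diagL k H C M (n + 1) h (rot (chi k H C M) n Ψ) -
        rot (chi k H C M) n (diagL k H C M (n + 1) h Ψ))) := by
  rw [map_sub, coface_diagL n j hj, ← rot_coface, ← rot_coface]
  rcases Nat.lt_or_ge j n with h1 | h1
  · rw [coface_diagL n (j + 1) h1]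
    exact JMin.comm _ _ _
  · obtain rfl : j = n := by omega
    have e (x : TP k C M (j + 1)) : coface (chi k H C M) j (j + 1) x =
      rot (chi k H C M) (j + 1) (coface (chi k H C M) j 0 x) := (coCompat_chi C M).coface_last j x
    rw [e, e, coface_diagL j 0 (by omega)]
    have h2 := (JMin.comm (j + 1) h (rot (chi k H C M) (j + 1) (coface (chi k H C M) j 0 Ψ))).add
      (JMin.comm (j + 1) h (coface (chi k H C M) j 0 Ψ)).τ
    rw [map_sub] at h2
    refine (congrArg (JMin k H C M (j + 1)) ?_).mp h2
    abel

theorem codeg_comm (n j : ℕ) (hj : j ≤ n + 1) (h : H) (Ψ : TP k C M (n + 2)) :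
    JMin k H C M n (codeg (chi k H C M) n j
      (diagL k H C M (n + 2) h (rot (chi k H C M) (n + 1) Ψ) -
        rot (chi k H C M) (n + 1) (diagL k H C M (n + 2) h Ψ))) := by
  rcases Nat.lt_or_ge j n with h1 | h1
  · rw [map_sub, codeg_diagL n j (by omega), ← rot_codeg, ← rot_codeg, codeg_diagL n (j + 1) h1]
    exact JMin.comm _ _ _
  rcases Nat.lt_or_ge j (n + 1) with h2 | h2
  · obtain rfl : j = n := by omega
    rw [map_sub, codeg_diagL j j (by omega), codeg_last, codeg_last, ctrFirst_diagL, sub_self]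
    exact zero _
  · obtain rfl : j = n + 1 := by omega
    have e (x : TP k C M (n + 2)) : codeg (chi k H C M) n (n + 1)
        (rot (chi k H C M) (n + 1) x) = codeg (chi k H C M) n 0 x := by
      have := codeg_add (k := k) (H := H) n 0 x
      rw [zero_add] at this
      rw [← rot_codeg, this]
    have e' (x : TP k C M (n + 2)) : rot (chi k H C M) n (codeg (chi k H C M) n (n + 1) x) =
        ctrFirst k M C (n + 1) x := by
      rw [rot_codeg, codeg_last]
    have h3 : JMin k H C M n (rot (chi k H C M) n (codeg (chi k H C M) n (n + 1)
        (diagL k H C M (n + 2) h (rot (chi k H C M) (n + 1) Ψ) -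
        rot (chi k H C M) (n + 1) (diagL k H C M (n + 2) h Ψ)))) := by
      rw [map_sub, map_sub, e', ctrFirst_diagL, ← e', e, e, codeg_diagL n 0 (by omega)]
      exact JMin.comm _ _ _
    have h4 := h3.τ_symm
    rwa [LinearEquiv.symm_apply_apply] at h4

theorem coface_mem {n : ℕ} {x : TP k C M (n + 1)} (hx : JMin k H C M n x) (j : ℕ)
    (hj : j ≤ n + 1) : JMin k H C M (n + 1) (coface (chi k H C M) n j x) := by
  induction hx generalizing j with
  | comm h Ψ =>
    rcases Nat.lt_or_ge j (n + 1) with h1 | h1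
    · exact coface_comm n j (by omega) h Ψ
    · obtain rfl : j = 0 + (n + 1) := by omega
      rw [coface_add]
      exact (coface_comm n 0 (by omega) h Ψ).τ
  | pow Φ =>
    rw [map_sub, coface_pow, coface_add, ← LinearEquiv.mul_apply, ← pow_succ]
    exact JMin.pow _ _
  | add _ _ h1 h2 =>
    rw [map_add]
    exact (h1 j hj).add (h2 j hj)
  | smul c _ h1 =>
    rw [map_smul]
    exact (h1 j hj).smul c
  | @τ x _ h1 =>
    rw [← rot_coface]
    rcases Nat.lt_or_ge j (n + 1) with h2 | h2
    · exact (h1 _ (by omega)).τ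
    · rw [show j + 1 = 1 + (n + 1) by omega, coface_add]
      exact (h1 _ (by omega)).τ.τ
  | @τ_symm x _ h1 =>
    cases j with
    | zero =>
      have h2 : JMin k H C M (n + 1) (rot (chi k H C M) (n + 1)
          (coface (chi k H C M) n 0 ((rot (chi k H C M) n).symm x))) := by
        rw [← coface_add, zero_add]
        have := (h1 n (by omega)).τ_symm
        refine (congrArg (JMin k H C M (n + 1)) ?_).mp this
        rw [LinearEquiv.symm_apply_eq, rot_coface, LinearEquiv.apply_symm_apply]
      have h3 := h2.τ_symm
      rwa [LinearEquiv.symm_apply_apply] at h3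
    | succ j =>
      have := (h1 j (by omega)).τ_symm
      refine (congrArg (JMin k H C M (n + 1)) ?_).mp this
      rw [LinearEquiv.symm_apply_eq, rot_coface, LinearEquiv.apply_symm_apply]
  | @L h x _ h1 =>
    rcases Nat.lt_or_ge j (n + 1) with h2 | h2
    · rw [coface_diagL n j (by omega)]
      exact (h1 j hj).L h
    · obtain rfl : j = 0 + (n + 1) := by omega
      rw [coface_add, coface_diagL n 0 (by omega)]
      exact ((h1 0 (by omega)).L h).τ

theorem codeg_mem {n : ℕ} {x : TP k C M (n + 2)} (hx : JMin k H C M (n + 1) x) (j : ℕ)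
    (hj : j ≤ n + 1) : JMin k H C M n (codeg (chi k H C M) n j x) := by
  induction hx generalizing j with
  | comm h Ψ => exact codeg_comm n j hj h Ψ
  | pow Φ =>
    rw [map_sub, codeg_pow, pow_succ, LinearEquiv.mul_apply, codeg_add]
    exact JMin.pow _ _
  | add _ _ h1 h2 =>
    rw [map_add]
    exact (h1 j hj).add (h2 j hj)
  | smul c _ h1 =>
    rw [map_smul]
    exact (h1 j hj).smul c
  | @τ x _ h1 =>
    rw [← rot_codeg]
    rcases Nat.lt_or_ge j (n + 1) with h2 | h2
    · exact (h1 _ (by omega)).τ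
    · rw [show j + 1 = 0 + (n + 2) by omega, codeg_add]
      exact h1 _ (by omega)
  | @τ_symm x _ h1 =>
    cases j with
    | zero =>
      rw [← codeg_add, zero_add, rot_codeg, LinearEquiv.apply_symm_apply]
      exact h1 (n + 1) le_rfl
    | succ j =>
      have := (h1 j (by omega)).τ_symm
      refine (congrArg (JMin k H C M n) ?_).mp this
      rw [LinearEquiv.symm_apply_eq, rot_codeg, LinearEquiv.apply_symm_apply]
  | @L h x _ h1 =>
    rcases Nat.lt_or_ge j (n + 1) with h2 | h2
    · rw [codeg_diagL n j (by omega)]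
      exact (h1 j hj).L h
    · obtain rfl : j = n + 1 := by omega
      have e' (x : TP k C M (n + 2)) : rot (chi k H C M) n (codeg (chi k H C M) n (n + 1) x) =
          ctrFirst k M C (n + 1) x := by
        rw [rot_codeg, codeg_last]
      have h3 : JMin k H C M n (rot (chi k H C M) n (codeg (chi k H C M) n (n + 1)
          (diagL k H C M (n + 2) h x))) := by
        rw [e', ctrFirst_diagL, ← e']
        exact ((h1 (n + 1) le_rfl).τ).L h
      have h4 := h3.τ_symm
      rwa [LinearEquiv.symm_apply_apply] at h4

theorem coface_mem_all {n : ℕ} {x : TP k C M (n + 1)} (hx : JMin k H C M n x) (j : ℕ) :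
    JMin k H C M (n + 1) (coface (chi k H C M) n j x) := by
  induction j using Nat.strong_induction_on with
  | _ j ih =>
    rcases Nat.lt_or_ge j (n + 1) with h2 | h2
    · exact hx.coface_mem j h2.le
    · obtain ⟨i, rfl⟩ : ∃ i, j = i + (n + 1) := ⟨j - (n + 1), by omega⟩
      rw [coface_add]
      exact (ih i (by omega)).τ

theorem codeg_mem_all {n : ℕ} {x : TP k C M (n + 2)} (hx : JMin k H C M (n + 1) x) (j : ℕ) :
    JMin k H C M n (codeg (chi k H C M) n j x) := by
  induction j using Nat.strong_induction_on with
  | _ j ih =>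
    rcases Nat.lt_or_ge j (n + 2) with h2 | h2
    · exact hx.codeg_mem j (by omega)
    · obtain ⟨i, rfl⟩ : ∃ i, j = i + (n + 2) := ⟨j - (n + 2), by omega⟩
      have := (ih i (by omega)).τ_symm
      rwa [← codeg_add, LinearEquiv.symm_apply_apply] at this

theorem of_J (n : ℕ) (x : (coverCoalg k H C M).X n) (hx : (coverCoalg k H C M).J n x) :
    JMin k H C M n x := by
  induction hx with
  | gen n h i Ψ Φ => exact (comm_zpow n h i Ψ).add (JMin.pow n Φ)
  | add _ _ h1 h2 => exact h1.add h2
  | smul c _ h1 => exact h1.smul c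
  | up j _ h1 => exact h1.coface_mem_all j
  | down j _ h1 => exact h1.codeg_mem_all j
  | τ _ h1 => exact h1.τ
  | τ_symm _ h1 => exact h1.τ_symm
  | L h _ h1 => exact h1.L h

end

end JMin

end JCoalg

end

end HopfCyclic

namespace HopfCyclic

noncomputable section

open CategoryTheory CategoryTheory.Limits TensorProduct

universe u v w u' v' w'

set_option linter.unusedSectionVars false

section Alpha

variable {k H A C : Type u} (M : Type u) [Field k] [Ring H] [HopfAlgebra k H]
  [AddCommGroup M] [Module k M] [Module H M] [IsScalarTower k H M]
  [Ring A] [Algebra k A] [Module H A] [IsScalarTower k H A]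
  [AddCommGroup C] [Module k C] [Coalgebra k C] [Module H C] [IsScalarTower k H C]
  (E : EquivariantAction k H A C)

/-- The map
`α(a₀ ⊗ ⋯ ⊗ aₙ ⊗ s)(c⁰ ⊗ ⋯ ⊗ cⁿ ⊗ m) = φ(c⁰, a₀) ⊗ ⋯ ⊗ φ(cⁿ, aₙ) ⊗ s m`. -/
def alpha : (n : ℕ) → TP k A k n →ₗ[k] (TP k C M n →ₗ[k] TP k A M n)
  | 0 => LinearMap.lsmul k M
  | n + 1 => TensorProduct.homTensorHomMap (RingHom.id k) C (TP k C M n) A (TP k A M n) ∘ₗ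
      TensorProduct.map E.φ.flip (alpha n)

theorem alpha_tmul (n : ℕ) (a : A) (c : C) (x : TP k A k n) (y : TP k C M n) :
    alpha M E (n + 1) (a ⊗ₜ x) (c ⊗ₜ y) = E.φ c a ⊗ₜ alpha M E n x y := rfl

theorem alpha_diagL (n : ℕ) (a : TP k A k n) (h : H) (x : TP k C M n) :
    alpha M E n a (diagL k H C M n h x) = diagL k H A M n h (alpha M E n a x) := by
  induction n generalizing h with
  | zero =>
    change a • (h • (x : M)) = h • (a • (x : M))
    rw [smul_comm]
  | succ n ih =>
    induction a using TensorProduct.induction_on with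
    | zero => simp
    | add a a' h1 h2 => simp only [map_add, LinearMap.add_apply, h1, h2]
    | tmul a y =>
      exact diagAct_map (E.φ.flip a) (alpha M E n y) (fun h c ↦ (E.smul_map h c a).symm)
        (fun h x ↦ ih y h x) h x

theorem alpha_mrg (n : ℕ) (a : TP k A k (n + 2)) (x : TP k C M (n + 1)) :
    alpha M E (n + 1) (mrg k A k 0 n a) x =
      mrg k A M 0 n (alpha M E (n + 2) a (spl k C M 0 n x)) := by
  suffices alpha M E (n + 1) ∘ₗ mrg k A k 0 n =
      (LinearMap.llcomp k _ _ _ (mrg k A M 0 n)) ∘ₗ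
        (LinearMap.lcomp k _ (spl k C M 0 n)) ∘ₗ alpha M E (n + 2) from
    LinearMap.congr_fun (LinearMap.congr_fun this a) x
  refine ext2 fun a b y ↦ TensorProduct.ext' fun c x ↦ ?_
  change E.φ c (a * b) ⊗ₜ[k] alpha M E n y x = mrg k A M 0 n (alpha M E (n + 2) (a ⊗ₜ (b ⊗ₜ y))
    (TensorProduct.assoc k C C (TP k C M n) (Coalgebra.comul (R := k) c ⊗ₜ x)))
  rw [E.map_mul]
  induction Coalgebra.comul (R := k) c with
  | zero => simp
  | add z z' hz hz' => simp only [map_add, add_tmul, hz, hz']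
  | tmul p q => rfl

theorem alpha_ins (n : ℕ) (a : TP k A k (n + 1)) (x : TP k C M (n + 2)) :
    alpha M E (n + 2) (ins k A k 0 n a) x =
      ins k A M 0 n (alpha M E (n + 1) a (ctr k C M 0 n x)) := by
  suffices alpha M E (n + 2) ∘ₗ ins k A k 0 n =
      (LinearMap.llcomp k _ _ _ (ins k A M 0 n)) ∘ₗ
        (LinearMap.lcomp k _ (ctr k C M 0 n)) ∘ₗ alpha M E (n + 1) from
    LinearMap.congr_fun (LinearMap.congr_fun this a) x
  refine TensorProduct.ext' fun a y ↦ ext2 fun c c' x ↦ ?_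
  change E.φ c a ⊗ₜ[k] (E.φ c' 1 ⊗ₜ[k] alpha M E n y x) =
    E.φ c a ⊗ₜ[k] ((1 : A) ⊗ₜ[k] alpha M E n y (Coalgebra.counit (R := k) c' • x))
  rw [E.map_one, map_smul, tmul_smul, smul_tmul']

variable [InvertibleAntipode k H] [LeftComodule k H M]

theorem alpha_rot (n : ℕ) (a : TP k A k (n + 1)) (x : TP k C M (n + 1)) :
    alpha M E (n + 1) (rot (.refl k (A ⊗[k] k)) n a) (rot (chi k H C M) n x) =
      rot (chi k H A M) n (alpha M E (n + 1) a x) := by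
  induction n with
  | zero =>
    suffices (LinearMap.lcomp k _ (rot (chi k H C M) 0).toLinearMap) ∘ₗ alpha M E 1 =
        (LinearMap.llcomp k _ _ _ (rot (chi k H A M) 0).toLinearMap) ∘ₗ alpha M E 1 from
      LinearMap.congr_fun (LinearMap.congr_fun this a) x
    refine TensorProduct.ext' fun a y ↦ TensorProduct.ext' fun c m ↦ ?_
    change alpha M E 1 (a ⊗ₜ y) (chi k H C M (c ⊗ₜ m)) =
      chi k H A M (E.φ c a ⊗ₜ ((y : k) • (m : M)))
    rw [tmul_smul, map_smul, chi_apply, chi_apply]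
    induction LeftComodule.coact (k := k) (H := H) m using TensorProduct.induction_on with
    | zero => simp
    | add z z' hz hz' => simp only [map_add, smul_add, hz, hz']
    | tmul h m =>
      change E.φ (h • c) a ⊗ₜ[k] ((y : k) • m) = (y : k) • ((h • E.φ c a) ⊗ₜ[k] m)
      rw [tmul_smul, E.smul_map]
  | succ n ih =>
    suffices (LinearMap.lcomp k _ (rot (chi k H C M) (n + 1)).toLinearMap) ∘ₗ alpha M E (n + 2) ∘ₗ
        (rot (.refl k (A ⊗[k] k)) (n + 1)).toLinearMap =
        (LinearMap.llcomp k _ _ _ (rot (chi k H A M) (n + 1)).toLinearMap) ∘ₗ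
          alpha M E (n + 2) from
      LinearMap.congr_fun (LinearMap.congr_fun this a) x
    refine ext2 fun a b y ↦ ext2 fun c d x ↦ ?_
    change E.φ d b ⊗ₜ[k] alpha M E (n + 1) (rot (.refl k (A ⊗[k] k)) n (a ⊗ₜ y))
      (rot (chi k H C M) n (c ⊗ₜ x)) = E.φ d b ⊗ₜ[k] rot (chi k H A M) n (E.φ c a ⊗ₜ alpha M E n y x)
    rw [ih]
    rfl

theorem alpha_rot' (n : ℕ) (a : TP k A k (n + 1)) (x : TP k C M (n + 1)) :
    alpha M E (n + 1) a (rot (chi k H C M) n x) = rot (chi k H A M) n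
      (alpha M E (n + 1) ((rot (.refl k (A ⊗[k] k)) n).symm a) x) := by
  rw [← alpha_rot, LinearEquiv.apply_symm_apply]

theorem alpha_rot_symm (n : ℕ) (a : TP k A k (n + 1)) (x : TP k C M (n + 1)) :
    alpha M E (n + 1) a ((rot (chi k H C M) n).symm x) = (rot (chi k H A M) n).symm
      (alpha M E (n + 1) (rot (.refl k (A ⊗[k] k)) n a) x) := by
  rw [LinearEquiv.eq_symm_apply, ← alpha_rot, LinearEquiv.apply_symm_apply]

theorem alpha_symm_rot (n : ℕ) (a : TP k A k (n + 1)) (x : TP k C M (n + 1)) :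
    alpha M E (n + 1) ((rot (.refl k (A ⊗[k] k)) n).symm a) x = (rot (chi k H A M) n).symm
      (alpha M E (n + 1) a (rot (chi k H C M) n x)) := by
  rw [alpha_rot', LinearEquiv.symm_apply_apply]

theorem alpha_rot_pow (n : ℕ) (a : TP k A k (n + 1)) (x : TP k C M (n + 1)) :
    alpha M E (n + 1) a (((rot (chi k H C M) n) ^ (n + 1)) x) =
      ((rot (chi k H A M) n) ^ (n + 1)) (alpha M E (n + 1) a x) := by
  have h (m : ℕ) : alpha M E (n + 1) (((rot (.refl k (A ⊗[k] k)) n) ^ m) a)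
      (((rot (chi k H C M) n) ^ m) x) = ((rot (chi k H A M) n) ^ m) (alpha M E (n + 1) a x) := by
    induction m with
    | zero => rfl
    | succ m ih =>
      rw [pow_succ', pow_succ', pow_succ', LinearEquiv.mul_apply, LinearEquiv.mul_apply,
        LinearEquiv.mul_apply, alpha_rot, ih]
  rw [← h, rot_refl_pow]

theorem alpha_face (n j : ℕ) (a : TP k A k (n + 2)) (x : TP k C M (n + 1)) :
    alpha M E (n + 1) (face (.refl k (A ⊗[k] k)) n j a) x =
      face (chi k H A M) n j (alpha M E (n + 2) a (coface (chi k H C M) n j x)) := by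
  induction j generalizing a x with
  | zero => exact alpha_mrg M E n a x
  | succ j ih =>
    change alpha M E (n + 1) ((rot (.refl k (A ⊗[k] k)) n).symm
      (face (.refl k (A ⊗[k] k)) n j (rot (.refl k (A ⊗[k] k)) (n + 1) a))) x =
      (rot (chi k H A M) n).symm (face (chi k H A M) n j (rot (chi k H A M) (n + 1) _))
    rw [alpha_symm_rot, ih, ← rot_coface, alpha_rot]

theorem alpha_degen (n j : ℕ) (a : TP k A k (n + 1)) (x : TP k C M (n + 2)) :
    alpha M E (n + 2) (degen (.refl k (A ⊗[k] k)) n j a) x =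
      degen (chi k H A M) n j (alpha M E (n + 1) a (codeg (chi k H C M) n j x)) := by
  induction j generalizing a x with
  | zero => exact alpha_ins M E n a x
  | succ j ih =>
    change alpha M E (n + 2) ((rot (.refl k (A ⊗[k] k)) (n + 1)).symm
      (degen (.refl k (A ⊗[k] k)) n j (rot (.refl k (A ⊗[k] k)) n a))) x =
      (rot (chi k H A M) (n + 1)).symm (degen (chi k H A M) n j (rot (chi k H A M) n _))
    rw [alpha_symm_rot, ih, ← rot_codeg, alpha_rot]

theorem alpha_J (n : ℕ) (a : TP k A k (n + 1)) (x : TP k C M (n + 1)) (hx : JMin k H C M n x) :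
    (coverAlg k H A M).J n (alpha M E (n + 1) a x) := by
  induction hx generalizing a with
  | comm h Ψ =>
    rw [map_sub, alpha_diagL, alpha_rot', alpha_rot', alpha_diagL]
    have := (coverAlg k H A M).J_comm n h (-1)
      (alpha M E (n + 1) ((rot (.refl k (A ⊗[k] k)) n).symm a) Ψ)
    rw [zpow_neg_one] at this
    exact this
  | pow Φ =>
    rw [map_sub, alpha_rot_pow]
    have := (coverAlg k H A M).J_pow n
      (((rot (chi k H A M) n) ^ (n + 1)) (alpha M E (n + 1) a Φ))
    have h1 : ((coverAlg k H A M).τ n) ^ (n + 1) = ((rot (chi k H A M) n) ^ (n + 1))⁻¹ :=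
      inv_pow (rot (chi k H A M) n) (n + 1)
    rw [h1] at this
    have h2 := this.smul (-1)
    refine (congrArg ((coverAlg k H A M).J n) ?_).mp h2
    refine (neg_one_smul k _).trans ((neg_sub _ _).trans (congrArg _ ?_))
    exact LinearEquiv.symm_apply_apply ((rot (chi k H A M) n) ^ (n + 1)) _
  | add _ _ h1 h2 =>
    rw [map_add]
    exact (h1 a).add (h2 a)
  | smul c _ h1 =>
    rw [map_smul]
    exact (h1 a).smul c
  | τ _ h1 =>
    rw [alpha_rot']
    exact (h1 _).τ_symm
  | τ_symm _ h1 =>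
    rw [alpha_rot_symm]
    exact (h1 _).τ
  | L h _ h1 =>
    rw [alpha_diagL]
    exact (h1 a).L h

variable [HModuleCoalgebra k H C]

theorem alpha_K (n : ℕ) (a : TP k A k (n + 1)) :
    (coverCoalg k H C M).K n ≤ ((coverAlg k H A M).K n).comap (alpha M E (n + 1) a) := by
  intro x hx
  refine ParaData.K_map (T := coverCoalg k H C M) (T' := coverAlg k H A M)
    (alpha M E (n + 1) a) (fun x hx ↦ ParaData.J_le_K (alpha_J M E n a x (JMin.of_J n x hx)))
    (fun h x ↦ ?_) hx
  have := ParaData.I_mem_K (T := coverAlg k H A M) h (alpha M E (n + 1) a x)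
  refine (congrArg (· ∈ (coverAlg k H A M).K n) ?_).mp this
  refine Eq.trans ?_ (map_sub (alpha M E (n + 1) a) _ _).symm
  refine congrArg₂ (· - ·) (alpha_diagL M E (n + 1) a h x).symm ?_
  exact (map_smul (alpha M E (n + 1) a) _ _).symm

/-- The map induced by `alpha` on coinvariants. -/
def alphaCoinv (n : ℕ) : TP k A k (n + 1) ⟶
    ModuleCat.of k ((coverCoalg k H C M).C n ⟶ (coverAlg k H A M).C n) :=
  ModuleCat.ofHom
    { toFun := fun a ↦ ModuleCat.ofHom
        (Submodule.mapQ _ _ (alpha M E (n + 1) a) (alpha_K M E n a))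
      map_add' := fun a b ↦ ModuleCat.hom_ext (Submodule.linearMap_qext _ (LinearMap.ext fun x ↦
        congrArg (Submodule.mkQ _) (LinearMap.congr_fun (map_add (alpha M E (n + 1)) a b) x)))
      map_smul' := fun c a ↦ ModuleCat.hom_ext (Submodule.linearMap_qext _ (LinearMap.ext fun x ↦
        congrArg (Submodule.mkQ _) (LinearMap.congr_fun (map_smul (alpha M E (n + 1)) c a) x))) }

variable [HModuleAlgebra k H A]

/-- The morphism of cyclic modules `α : Cyc(A) ⟶ diagHom(C_•(C, M), C_•(A, M))`. -/
def alphaHom : Cyc k A ⟶ diagHomObj (hopfCocyclic k H C M) (hopfCyclic k H A M) where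
  app n := alphaCoinv M E n.unop.as.len
  naturality m n f := by
    refine CyclicCat.natural_of_generators (F := Cyc k A)
      (G := diagHomObj (hopfCocyclic k H C M) (hopfCyclic k H A M)) (alphaCoinv M E) ?_ ?_ ?_ f.unop
    · intro n i
      have h1 : (Cyc k A).map (CyclicCat.δ i).op = ((cycData k A).δ n i).unop :=
        congrArg Quiver.Hom.unop ((cycData k A).toFunctor_δ n i)
      have h2 := (hopfCocyclicData k H C M).toFunctor_δ n i
      have h3 : (hopfCyclic k H A M).map (CyclicCat.δ i).op =
        ((hopfCyclicData k H A M).δ n i).unop :=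
        congrArg Quiver.Hom.unop ((hopfCyclicData k H A M).toFunctor_δ n i)
      refine (congrArg (· ≫ alphaCoinv M E n) h1).trans (Eq.trans ?_
        (congrArg (alphaCoinv M E (n + 1) ≫ ·) (congrArg₂ homMap h2 h3)).symm)
      refine ModuleCat.hom_ext (LinearMap.ext fun a ↦ ModuleCat.hom_ext
        (Submodule.linearMap_qext _ (LinearMap.ext fun x ↦ ?_)))
      exact congrArg (Submodule.mkQ _) (alpha_face M E n i a x)
    · intro n i
      have h1 : (Cyc k A).map (CyclicCat.σ i).op = ((cycData k A).σ n i).unop :=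
        congrArg Quiver.Hom.unop ((cycData k A).toFunctor_σ n i)
      have h2 := (hopfCocyclicData k H C M).toFunctor_σ n i
      have h3 : (hopfCyclic k H A M).map (CyclicCat.σ i).op =
        ((hopfCyclicData k H A M).σ n i).unop :=
        congrArg Quiver.Hom.unop ((hopfCyclicData k H A M).toFunctor_σ n i)
      refine (congrArg (· ≫ alphaCoinv M E (n + 1)) h1).trans (Eq.trans ?_
        (congrArg (alphaCoinv M E n ≫ ·) (congrArg₂ homMap h2 h3)).symm)
      refine ModuleCat.hom_ext (LinearMap.ext fun a ↦ ModuleCat.hom_ext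
        (Submodule.linearMap_qext _ (LinearMap.ext fun x ↦ ?_)))
      exact congrArg (Submodule.mkQ _) (alpha_degen M E n i a x)
    · intro n
      have h1 : (Cyc k A).map (CyclicCat.τ n).op = ((cycData k A).τ n).unop :=
        congrArg Quiver.Hom.unop ((cycData k A).toFunctor_τ n)
      have h2 := (hopfCocyclicData k H C M).toFunctor_τ n
      have h3 : (hopfCyclic k H A M).map (CyclicCat.τ n).op =
        ((hopfCyclicData k H A M).τ n).unop :=
        congrArg Quiver.Hom.unop ((hopfCyclicData k H A M).toFunctor_τ n)
      refine (congrArg (· ≫ alphaCoinv M E n) h1).trans (Eq.trans ?_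
        (congrArg (alphaCoinv M E n ≫ ·) (congrArg₂ homMap h2 h3)).symm)
      refine ModuleCat.hom_ext (LinearMap.ext fun a ↦ ModuleCat.hom_ext
        (Submodule.linearMap_qext _ (LinearMap.ext fun x ↦ ?_)))
      exact congrArg (Submodule.mkQ _) (alpha_symm_rot M E n a x)

end Alpha

end

end HopfCyclic

namespace HopfCyclic

noncomputable section

open CategoryTheory CategoryTheory.Limits TensorProduct

universe u v w u' v' w'

set_option linter.unusedSectionVars false

section Cup

open Abelian

variable (k H A C M : Type u) [Field k] [Ring H] [HopfAlgebra k H] [InvertibleAntipode k H]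
  [AddCommGroup M] [Module k M] [Module H M] [IsScalarTower k H M] [LeftComodule k H M]

/-- Hopf-cyclic cohomology `HC^p_Hopf(C, M) = Ext^p_Λ(k_•, C_•(C, M))` of a module coalgebra. -/
abbrev HCCoalg [AddCommGroup C] [Module k C] [Coalgebra k C] [Module H C] [IsScalarTower k H C]
    [HModuleCoalgebra k H C] (p : ℕ) : Type u :=
  Ext.{u} (constField k CyclicCat) (hopfCocyclic k H C M) p

/-- Hopf-cyclic cohomology `HC^q_Hopf(A, M) = Ext^q_Λ(C_•(A, M), k_•^∨)` of a module algebra. -/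
abbrev HCAlg [Ring A] [Algebra k A] [Module H A] [IsScalarTower k H A] [HModuleAlgebra k H A]
    (q : ℕ) : Type u :=
  Ext.{u} (hopfCyclic k H A M) (constField k CyclicCatᵒᵖ) q

/-- Cyclic cohomology `HC^n(A) = Ext^n_Λ(Cyc(A), k_•^∨)` of an algebra. -/
abbrev HC (k A : Type u) [Field k] [Ring A] [Algebra k A] (n : ℕ) : Type u :=
  Ext.{u} (Cyc k A) (constField k CyclicCatᵒᵖ) n

variable {k H A C M}

variable [Ring A] [Algebra k A] [Module H A] [IsScalarTower k H A] [HModuleAlgebra k H A]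
  [AddCommGroup C] [Module k C] [Coalgebra k C] [Module H C] [IsScalarTower k H C]
  [HModuleCoalgebra k H C]

/-- The cup product
`ξ ⌣ ν = Ext(α, k^∨)(diagHom(ξ, C_•(A, M)) ∘ ν)`, where `diagHom(k_•, C_•(A, M))` is identified
with `C_•(A, M)`. -/
def cup (E : EquivariantAction k H A C) {p q : ℕ} (ξ : HCCoalg k H C M p) (ν : HCAlg k H A M q) :
    HC k A (p + q) :=
  (Ext.mk₀ (alphaHom M E)).comp
    ((extContra ((diagHom CyclicCat k).flip.obj (hopfCyclic k H A M)) ξ).comp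
      ((Ext.mk₀ (diagHomConst (hopfCyclic k H A M)).hom).comp ν (zero_add q))
      rfl)
    (zero_add (p + q))

/-- The cup product
`ν ⌣ ξ = Ext(α, k^∨)(diagHom(C_•(C, M), ν) ∘ diagHom(ξ, k^∨))`, where `diagHom(k_•, k^∨)` is
identified with `k^∨`. -/
def cupSwap (E : EquivariantAction k H A C) {p q : ℕ} (ν : HCAlg k H A M q)
    (ξ : HCCoalg k H C M p) : HC k A (p + q) :=
  (Ext.mk₀ (alphaHom M E)).comp
    ((Ext.mapExactFunctor ((diagHom CyclicCat k).obj (.op (hopfCocyclic k H C M))) ν).comp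
      ((extContra ((diagHom CyclicCat k).flip.obj (constField k CyclicCatᵒᵖ)) ξ).comp
        (Ext.mk₀ (diagHomConst (constField k CyclicCatᵒᵖ)).hom) (add_zero p))
      (add_comm q p))
    (zero_add (p + q))

end Cup

end

end HopfCyclic

universe u

/-! The statement is formal: it is the Koszul sign rule for a bifunctor that is exact in both
variables. The Hopf algebra and its modules enter only through the morphism `alphaHom`, with which
both products are precomposed; what has to be compared are two composites in `Ext` of cyclic
modules.

Write B(X, Y) for `diagHom`, contravariant in X and covariant in Y. A class ξ of degree p from k to
X and a class ν of degree q from Y to k^∨ give two routes from B(X, Y) to B(k, k^∨). One applies ξ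
first and passes through B(k, Y); the other applies ν first and passes through B(X, k^∨). The two
routes differ by (-1)^(pq).

The heart of the matter is p = q = 1. A pair of short exact sequences, one in each variable, gives
under B a 3 × 3 diagram E with exact rows and columns, and the two routes are the two splices along
its boundary from the corner E₃₃ to the corner E₁₁. They are opposite by
`extClass_comp_extClass_anticomm`. The reason is that the kernel N of the diagonal epimorphism E₂₂ →
E₃₃ sits in two short exact sequences, 0 → N → E₂₂ → E₃₃ → 0 and 0 → E₁₁ → N → E₁₃ ⊕ E₃₁ → 0. The
class of the second dies when pulled back along its own epimorphism N → E₁₃ ⊕ E₃₁, so pushing the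
first class along this map and then multiplying by the second gives zero. Split over the two
summands, this product is the sum of the two boundary splices.

The general case follows by counting. There are enough projectives, so every class is a splice of
short exact sequences ending in a morphism. An induction over ν (`contraClass_comp_mapExactFunctor`)
moves one short exact sequence of the first variable past q of the second, and an induction over ξ
(`contra_comp_mapExactFunctor`) moves p of them; each crossing costs one sign. The morphisms of
degree zero cost none, because extension classes are natural with respect to morphisms of short
exact sequences.

The first product involves ν itself and not B(k, ν), after the identification of B(k, Y) with Y.
This identification is natural in Y, and exact functors act on `Ext` naturally in the functor
(`mapExactFunctor_naturality`), so ν may be replaced by B(k, ν), with the identification moved to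
the end of the composite (`diagHomConst_comp`). -/

namespace HopfCyclic

noncomputable section

open CategoryTheory CategoryTheory.Limits Abelian

universe v w u' v' w' u'' v'' w''

/-! ### The 3 × 3 diagram and its two boundary splices. -/

section Grid

variable {T : Type u} [Category.{v} T] [Abelian T] [HasExt.{w} T]

/-- In a commutative `3 × 3` diagram with exact rows and columns, the two splicings of the outer
rows and columns have opposite classes in `Ext²`. -/
theorem extClass_comp_extClass_anticomm (S : ShortComplex (ShortComplex T))
    (r₁ : S.X₁.ShortExact) (r₂ : S.X₂.ShortExact) (r₃ : S.X₃.ShortExact)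
    {z₁ : S.f.τ₁ ≫ S.g.τ₁ = 0} {z₂ : S.f.τ₂ ≫ S.g.τ₂ = 0} {z₃ : S.f.τ₃ ≫ S.g.τ₃ = 0}
    (c₁ : (ShortComplex.mk S.f.τ₁ S.g.τ₁ z₁).ShortExact)
    (c₂ : (ShortComplex.mk S.f.τ₂ S.g.τ₂ z₂).ShortExact)
    (c₃ : (ShortComplex.mk S.f.τ₃ S.g.τ₃ z₃).ShortExact) :
    c₃.extClass.comp r₁.extClass rfl =
      -(r₃.extClass.comp c₁.extClass rfl : Ext.{w} S.X₃.X₃ S.X₁.X₁ 2) := by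
  have := r₁.mono_f
  have := r₂.mono_f
  have := r₃.mono_f
  have := r₁.epi_g
  have := r₂.epi_g
  have := r₃.epi_g
  have : Mono S.f.τ₁ := c₁.mono_f
  have : Mono S.f.τ₂ := c₂.mono_f
  have : Mono S.f.τ₃ := c₃.mono_f
  have : Epi S.g.τ₁ := c₁.epi_g
  have : Epi S.g.τ₂ := c₂.epi_g
  have : Epi S.g.τ₃ := c₃.epi_g
  -- Write Eᵢⱼ for `S.Xᵢ.Xⱼ`. The diagonal from the centre E₂₂ to the corner E₃₃ can be read along
  -- the row first or along the column first. Both readings are needed: the first produces a map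
  -- from its kernel N to E₁₃, the second a map from N to E₃₁.
  let d : S.X₂.X₂ ⟶ S.X₃.X₃ := S.X₂.g ≫ S.g.τ₃
  have hd : S.g.τ₂ ≫ S.X₃.g = d := S.g.comm₂₃
  have hN : (ShortComplex.mk (kernel.ι d) d (kernel.condition d)).ShortExact :=
    { exact := ShortComplex.exact_of_f_is_kernel _ (kernelIsKernel _)
      epi_g := epi_comp _ _ }
  have hι : kernel.ι d ≫ S.X₂.g ≫ S.g.τ₃ = 0 := kernel.condition d
  -- On N, the row map E₂₂ → E₂₃ lands in the kernel of E₂₃ → E₃₃, which is E₁₃. Symmetrically, `b`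
  -- below comes from the column map E₂₂ → E₃₂, which on N lands in E₃₁.
  let a : kernel d ⟶ S.X₁.X₃ := c₃.exact.lift (kernel.ι d ≫ S.X₂.g)
    ((Category.assoc _ _ _).trans hι)
  have ha : a ≫ S.f.τ₃ = kernel.ι d ≫ S.X₂.g := c₃.exact.lift_f _ _
  let b : kernel d ⟶ S.X₃.X₁ := r₃.exact.lift (kernel.ι d ≫ S.g.τ₂)
    (by rw [Category.assoc, hd, kernel.condition])
  have hb : b ≫ S.X₃.f = kernel.ι d ≫ S.g.τ₂ := r₃.exact.lift_f _ _
  -- Both E₁₂ and E₂₁ embed into the centre inside N. With respect to the pair (a, b) they behave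
  -- like coordinate axes: E₁₂ is killed by b and mapped by a through its row epimorphism, while E₂₁
  -- is killed by a and mapped by b through its column epimorphism.
  let l₁ : S.X₁.X₂ ⟶ kernel d := kernel.lift d S.f.τ₂ (by
    rw [← hd, reassoc_of% z₂, zero_comp])
  have hl₁ : l₁ ≫ kernel.ι d = S.f.τ₂ := kernel.lift_ι _ _ _
  let l₂ : S.X₂.X₁ ⟶ kernel d := kernel.lift d S.X₂.f (by
    rw [S.X₂.zero_assoc, zero_comp])
  have hl₂ : l₂ ≫ kernel.ι d = S.X₂.f := kernel.lift_ι _ _ _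
  have l₁a : l₁ ≫ a = S.X₁.g := by
    rw [← cancel_mono S.f.τ₃, Category.assoc, ha, reassoc_of% hl₁, S.f.comm₂₃]
  have l₁b : l₁ ≫ b = 0 := by
    rw [← cancel_mono S.X₃.f, Category.assoc, hb, reassoc_of% hl₁, z₂, zero_comp]
  have l₂a : l₂ ≫ a = 0 := by
    rw [← cancel_mono S.f.τ₃, Category.assoc, ha, reassoc_of% hl₂, S.X₂.zero, zero_comp]
  have l₂b : l₂ ≫ b = S.g.τ₁ := by
    rw [← cancel_mono S.X₃.f, Category.assoc, hb, reassoc_of% hl₂, S.g.comm₁₂]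
  have e₁ : S.f.τ₁ ≫ l₂ = S.X₁.f ≫ l₁ := by
    rw [← cancel_mono (kernel.ι d), Category.assoc, Category.assoc, hl₁, hl₂, S.f.comm₁₂]
  have hz : (S.X₁.f ≫ l₁) ≫ biprod.lift a b = 0 := by
    ext
    · simp [l₁a]
    · simp [l₁b]
  have e₂ : l₂ ≫ biprod.lift a b = S.g.τ₁ ≫ biprod.inr := by
    ext <;> simp [l₂a, l₂b]
  -- The kernel of (a, b) is E₁₁. A map into N killed by b dies in E₃₂, hence factors through E₁₂ by
  -- exactness of the middle column. If a also kills it, the factorization dies in E₁₃, hence comes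
  -- from E₁₁ by exactness of the first row.
  have hl {A : T} (x : A ⟶ kernel d) (xa : x ≫ a = 0) (xb : x ≫ b = 0) :
      ∃ y : A ⟶ S.X₁.X₁, y ≫ S.X₁.f ≫ l₁ = x := by
    have h₁ : (x ≫ kernel.ι d) ≫ S.g.τ₂ = 0 := by
      rw [Category.assoc, ← hb, reassoc_of% xb, zero_comp]
    obtain ⟨y, hy⟩ : ∃ y, y ≫ S.f.τ₂ = x ≫ kernel.ι d := ⟨_, c₂.exact.lift_f _ h₁⟩
    have h₂ : y ≫ S.X₁.g = 0 := by
      rw [← cancel_mono S.f.τ₃, Category.assoc, ← S.f.comm₂₃, reassoc_of% hy, ← ha,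
        reassoc_of% xa, zero_comp]
    obtain ⟨t, ht⟩ : ∃ t, t ≫ S.X₁.f = y := ⟨_, r₁.exact.lift_f _ h₂⟩
    refine ⟨t, ?_⟩
    rw [← cancel_mono (kernel.ι d), Category.assoc, Category.assoc, hl₁, reassoc_of% ht, hy]
  have hK : (ShortComplex.mk (S.X₁.f ≫ l₁) (biprod.lift a b) hz).ShortExact := by
    have m₁ : Mono l₁ := mono_of_mono_fac hl₁
    have m₂ : Epi (biprod.lift a b) := by
      -- Surjectivity of (a, b) is already visible on the two axes: restricted to E₁₂ ⊕ E₂₁ it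
      -- becomes the diagonal matrix of two epimorphisms.
      have : biprod.desc l₁ l₂ ≫ biprod.lift a b = biprod.map S.X₁.g S.g.τ₁ := by
        ext <;> simp [l₁a, l₁b, l₂a, l₂b]
      have : Epi (biprod.desc l₁ l₂ ≫ biprod.lift a b) := this ▸ inferInstance
      exact epi_of_epi (biprod.desc l₁ l₂) _
    exact { exact := ShortComplex.exact_of_f_is_kernel _
              (KernelFork.IsLimit.ofι' _ _ fun {A} x hx ↦
                have h := hl x (by simpa using hx =≫ biprod.fst) (by simpa using hx =≫ biprod.snd)
                ⟨h.choose, h.choose_spec⟩)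
            mono_f := mono_comp _ _, epi_g := m₂ }
  -- The row and the column reading of the diagonal give two morphisms out of 0 → N → E₂₂ → E₃₃ → 0
  -- that are the identity on E₃₃. Their targets are the last column and the last row, so these
  -- classes are the pushouts of the class of N along a and along b.
  have n₁ : hN.extClass.comp (Ext.mk₀ a) (add_zero 1) = c₃.extClass := by
    refine (ShortComplex.ShortExact.extClass_naturality hN c₃
      { τ₁ := a, τ₂ := S.X₂.g, τ₃ := 𝟙 _, comm₁₂ := ha, comm₂₃ := ?_ }).trans
      (Ext.mk₀_id_comp _)
    exact (Category.comp_id _).symm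
  have n₂ : hN.extClass.comp (Ext.mk₀ b) (add_zero 1) = r₃.extClass := by
    refine (ShortComplex.ShortExact.extClass_naturality hN r₃
      { τ₁ := b, τ₂ := S.g.τ₂, τ₃ := 𝟙 _, comm₁₂ := hb, comm₂₃ := ?_ }).trans
      (Ext.mk₀_id_comp _)
    exact hd.trans (Category.comp_id _).symm
  -- Dually, the inclusions of the two axes give morphisms into 0 → E₁₁ → N → E₁₃ ⊕ E₃₁ → 0 that are
  -- the identity on E₁₁. So the first row and the first column are the pullbacks of this sequence
  -- to the two summands.
  have n₃ : (Ext.mk₀ (biprod.inl : S.X₁.X₃ ⟶ S.X₁.X₃ ⊞ S.X₃.X₁)).comp hK.extClass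
      (zero_add 1) = r₁.extClass := by
    refine (ShortComplex.ShortExact.extClass_naturality r₁ hK
      { τ₁ := 𝟙 _, τ₂ := l₁, τ₃ := biprod.inl, comm₁₂ := ?_, comm₂₃ := ?_ }).symm.trans
      (Ext.comp_mk₀_id _)
    · exact Category.id_comp _
    · ext <;> simp [l₁a, l₁b]
  have n₄ : (Ext.mk₀ (biprod.inr : S.X₃.X₁ ⟶ S.X₁.X₃ ⊞ S.X₃.X₁)).comp hK.extClass
      (zero_add 1) = c₁.extClass := by
    refine (ShortComplex.ShortExact.extClass_naturality c₁ hK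
      { τ₁ := 𝟙 _, τ₂ := l₂, τ₃ := biprod.inr, comm₁₂ := ?_, comm₂₃ := ?_ }).symm.trans
      (Ext.comp_mk₀_id _)
    · exact (Category.id_comp _).trans e₁.symm
    · exact e₂
  -- The class of a short exact sequence vanishes after pullback along its own epimorphism, here (a,
  -- b).
  have key : hN.extClass.comp ((Ext.mk₀ (biprod.lift a b)).comp hK.extClass (zero_add 1)) rfl =
      (0 : Ext.{w} _ _ 2) := by
    have : (Ext.mk₀ (biprod.lift a b)).comp hK.extClass (zero_add 1) = 0 := hK.comp_extClass
    rw [this, Ext.comp_zero]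
  have hab : Ext.mk₀ (biprod.lift a b) =
      (Ext.mk₀ a).comp (Ext.mk₀ biprod.inl) (zero_add 0) +
        (Ext.mk₀ b).comp (Ext.mk₀ biprod.inr) (zero_add 0) := by
    rw [Ext.mk₀_comp_mk₀, Ext.mk₀_comp_mk₀, ← Ext.mk₀_add, biprod.lift_eq]
  -- Decomposing (a, b) over the two summands turns the vanishing product into the class of the last
  -- column times that of the first row, plus the class of the last row times that of the first
  -- column.
  rw [hab, Ext.add_comp, Ext.comp_add,
    Ext.comp_assoc _ _ _ _ (zero_add 1) (by omega), Ext.comp_assoc _ _ _ _ (zero_add 1) (by omega),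
    n₃, n₄, ← Ext.comp_assoc _ _ _ (add_zero 1) _ (by omega), n₁,
    ← Ext.comp_assoc _ _ _ (add_zero 1) _ (by omega), n₂] at key
  exact eq_neg_of_add_eq_zero_left key

end Grid

end

end HopfCyclic

namespace HopfCyclic

noncomputable section

open CategoryTheory CategoryTheory.Limits Abelian

universe v w u' v' w' u'' v'' w''

set_option linter.unusedSectionVars false

/-! ### Exact covariant functors acting on `Ext`. -/

section Naturality

variable {D : Type u'} [Category.{v'} D] [Abelian D] [HasExt.{w'} D] [EnoughProjectives D]
  {T : Type u''} [Category.{v''} T] [Abelian T] [HasExt.{w''} T]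

variable (F : D ⥤ T) [F.Additive] [PreservesFiniteLimits F] [PreservesFiniteColimits F]

/-- The class in `Ext¹(F X, F K)` of the short exact sequence `0 → F K → F E → F X → 0`. -/
def covClass {K E X : D} {i : K ⟶ E} {π : E ⟶ X} {w : i ≫ π = 0}
    (h : (ShortComplex.mk i π w).ShortExact) : Ext.{w''} (F.obj X) (F.obj K) 1 :=
  (h.map_of_exact F).extClass

/-- An exact functor respects Yoneda products and carries the class of a short exact sequence to the
class of its image. Together with the degree zero case below, this reduces statements about the
action on `Ext` to inductions over a representing sequence. -/
theorem mapExactFunctor_toExt_splice {K E X Y : D} {n : ℕ} {i : K ⟶ E} {π : E ⟶ X}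
    {w : i ≫ π = 0} (h : (ShortComplex.mk i π w).ShortExact) (e : YonedaSeq D K Y n) :
    Ext.mapExactFunctor F (YonedaSeq.splice i π w h e).toExt =
      (covClass F h).comp (Ext.mapExactFunctor F e.toExt) (Nat.add_comm 1 n) :=
  (Ext.mapExactFunctor_comp F _ _ _).trans
    (congrArg (fun z ↦ Ext.comp z _ _) (Ext.mapExactFunctor_extClass F h))

theorem mapExactFunctor_toExt_hom {X Y : D} (f : X ⟶ Y) :
    Ext.mapExactFunctor F (YonedaSeq.hom f).toExt = (Ext.mk₀ (F.map f) : Ext.{w''} _ _ 0) :=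
  Ext.mapExactFunctor_mk₀ F f

variable {F}

/-- The action of exact functors on `Ext` is natural in the functor. -/
theorem mapExactFunctor_naturality {G : D ⥤ T} [G.Additive] [PreservesFiniteLimits G]
    [PreservesFiniteColimits G] (η : F ⟶ G) {Y Y' : D} {q : ℕ} (ν : Ext.{w'} Y Y' q) :
    (Ext.mapExactFunctor F ν).comp (Ext.mk₀ (η.app Y')) (add_zero q) =
      (Ext.mk₀ (η.app Y)).comp (Ext.mapExactFunctor G ν : Ext.{w''} _ _ q) (zero_add q) := by
  -- Enough projectives in `D` provide a representing sequence, which makes the class accessible to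
  -- induction on its length.
  obtain ⟨e, rfl⟩ := YonedaSeq.toExt_surjective ν
  induction e with
  | hom f =>
    rw [mapExactFunctor_toExt_hom, mapExactFunctor_toExt_hom, Ext.mk₀_comp_mk₀,
      Ext.mk₀_comp_mk₀, η.naturality]
  | @splice K E X Y n i π w h e ih =>
    -- The components of `η` at the three terms form a morphism from the F-image to the G-image of
    -- the short exact sequence. Naturality of extension classes moves `η` across this one factor;
    -- the induction hypothesis moves it across the remaining ones.
    have hη : (covClass F h).comp (Ext.mk₀ (η.app K)) (add_zero 1) =
        (Ext.mk₀ (η.app X)).comp (covClass G h) (zero_add 1) :=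
      ShortComplex.ShortExact.extClass_naturality (h.map_of_exact F) (h.map_of_exact G)
        (ShortComplex.mapNatTrans _ η)
    rw [mapExactFunctor_toExt_splice, mapExactFunctor_toExt_splice,
      Ext.comp_assoc_of_third_deg_zero, ih,
      ← Ext.comp_assoc _ _ _ (add_zero 1) (zero_add _) (by omega), hη]
    exact Ext.comp_assoc _ _ _ (zero_add 1) _ (by omega)

/-- Needed because evaluation at 1 is a natural transformation with target the identity functor:
naturality then produces the action of `𝟭 D`, which has to be recognised as ν itself. -/
theorem mapExactFunctor_id {Y Y' : D} {q : ℕ} (ν : Ext.{w'} Y Y' q) :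
    Ext.mapExactFunctor (𝟭 D) ν = ν := by
  obtain ⟨e, rfl⟩ := YonedaSeq.toExt_surjective ν
  induction e with
  | hom f => exact mapExactFunctor_toExt_hom _ f
  | splice i π w h e ih =>
    rw [mapExactFunctor_toExt_splice, ih]
    -- The image of a short exact sequence under `𝟭 D` is that sequence by definition.
    rfl

end Naturality

/-! ### The Koszul sign rule for a biexact bifunctor. -/

section Bifunctor

variable {C : Type u} [Category.{v} C] [Abelian C] [HasExt.{w} C]
  {D : Type u'} [Category.{v'} D] [Abelian D] [HasExt.{w'} D] [EnoughProjectives D]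
  {T : Type u''} [Category.{v''} T] [Abelian T] [HasExt.{w''} T]

theorem ext_zsmul_comp {X Y Z : T} {a b c : ℕ} (z : ℤ) (α : Ext.{w''} X Y a)
    (β : Ext.{w''} Y Z b) (h : a + b = c) : (z • α).comp β h = z • α.comp β h :=
  (AddMonoidHom.mk' (fun α : Ext.{w''} X Y a ↦ α.comp β h)
    (fun _ _ ↦ Ext.add_comp _ _ _ _)).map_zsmul z α

theorem ext_comp_zsmul {X Y Z : T} {a b c : ℕ} (z : ℤ) (α : Ext.{w''} X Y a)
    (β : Ext.{w''} Y Z b) (h : a + b = c) : α.comp (z • β) h = z • α.comp β h :=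
  (AddMonoidHom.mk' (fun β : Ext.{w''} Y Z b ↦ α.comp β h)
    (fun _ _ ↦ Ext.comp_add _ _ _ _)).map_zsmul z β

/-- Two adjacent squares in `Ext` which commute up to a sign paste to such a square. -/
theorem ext_square_paste {X₁ X₂ X₃ Y₁ Y₂ Y₃ : T} {p a b c d₁ d₂ d : ℕ} {s t : ℤ}
    {α₁ : Ext.{w''} X₁ Y₁ p} {α₂ : Ext.{w''} X₂ Y₂ p} {α₃ : Ext.{w''} X₃ Y₃ p}
    {β : Ext.{w''} X₁ X₂ a} {β' : Ext.{w''} Y₁ Y₂ a} {γ : Ext.{w''} X₂ X₃ b}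
    {γ' : Ext.{w''} Y₂ Y₃ b} {h₁ : p + a = d₁} {h₁' : a + p = d₁} {h₂ : p + b = d₂}
    {h₂' : b + p = d₂} (h : a + b = c) (hd : p + c = d)
    (e₁ : α₁.comp β' h₁ = s • β.comp α₂ h₁') (e₂ : α₂.comp γ' h₂ = t • γ.comp α₃ h₂') :
    α₁.comp (β'.comp γ' h) hd = (s * t) • (β.comp γ h).comp α₃ (by omega) := by
  rw [← Ext.comp_assoc _ _ _ h₁ h (by omega), e₁, ext_zsmul_comp,
    Ext.comp_assoc _ _ _ h₁' h₂ (by omega), e₂, ext_comp_zsmul,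
    Ext.comp_assoc _ _ _ h h₂' (by omega), mul_smul]

variable (B : Cᵒᵖ ⥤ D ⥤ T) [∀ X, (B.obj X).Additive] [∀ X, PreservesFiniteLimits (B.obj X)]
  [∀ X, PreservesFiniteColimits (B.obj X)] [∀ Y, (B.flip.obj Y).Additive]
  [∀ Y, PreservesFiniteLimits (B.flip.obj Y)] [∀ Y, PreservesFiniteColimits (B.flip.obj Y)]

/-- For a bifunctor which is exact in both variables, the classes of two short exact sequences,
one in each variable, anticommute. -/
theorem contraClass_comp_extClass {K E X : C} {i : K ⟶ E} {π : E ⟶ X} {w : i ≫ π = 0}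
    (h : (ShortComplex.mk i π w).ShortExact) {L G Y : D} {j : L ⟶ G} {ρ : G ⟶ Y} {w' : j ≫ ρ = 0}
    (h' : (ShortComplex.mk j ρ w').ShortExact) :
    (YonedaSeq.contraClass (B.flip.obj Y) h).comp (h'.map_of_exact (B.obj (.op X))).extClass rfl =
      -((h'.map_of_exact (B.obj (.op K))).extClass.comp
        (YonedaSeq.contraClass (B.flip.obj L) h) rfl :
          Ext.{w''} ((B.obj (.op K)).obj Y) ((B.obj (.op X)).obj L) 2) :=
  extClass_comp_extClass_anticomm
    -- The columns of the grid are indexed by L, G, Y. The rows are indexed by X, E, K in this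
    -- order, since contravariance reverses the first sequence: π induces the map from the first row
    -- to the second, and i the map from the second to the third. The two corners joined by the
    -- splices are thus B(K, Y) and B(X, L).
    (ShortComplex.mk (ShortComplex.mapNatTrans (ShortComplex.mk j ρ w') (B.map π.op))
      (ShortComplex.mapNatTrans (ShortComplex.mk j ρ w') (B.map i.op)) (by
        -- The composite of the row maps is checked one column at a time, where it is the image of i
        -- ≫ π = 0 under B(-, L), B(-, G) or B(-, Y).
        ext1
        · exact ((ShortComplex.mk i π w).op.map (B.flip.obj L)).zero
        · exact ((ShortComplex.mk i π w).op.map (B.flip.obj G)).zero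
        · exact ((ShortComplex.mk i π w).op.map (B.flip.obj Y)).zero))
    (h'.map_of_exact (B.obj (.op X))) (h'.map_of_exact (B.obj (.op E)))
    (h'.map_of_exact (B.obj (.op K))) (h.op.map_of_exact (B.flip.obj L))
    (h.op.map_of_exact (B.flip.obj G)) (h.op.map_of_exact (B.flip.obj Y))

/-- A morphism g of the second variable is a natural transformation from B(-, Y) to B(-, Y'), so it
maps one image of the short exact sequence to the other. This is the case of bidegree (1, 0) of the
sign rule, where no sign arises. -/
theorem contraClass_naturality {K E X : C} {i : K ⟶ E} {π : E ⟶ X} {w : i ≫ π = 0}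
    (h : (ShortComplex.mk i π w).ShortExact) {Y Y' : D} (g : Y ⟶ Y') :
    (YonedaSeq.contraClass (B.flip.obj Y) h).comp (Ext.mk₀ ((B.obj (.op X)).map g))
      (add_zero 1) = (Ext.mk₀ ((B.obj (.op K)).map g)).comp
        (YonedaSeq.contraClass (B.flip.obj Y') h : Ext.{w''} _ _ 1) (zero_add 1) :=
  ShortComplex.ShortExact.extClass_naturality (h.op.map_of_exact (B.flip.obj Y))
    (h.op.map_of_exact (B.flip.obj Y')) (ShortComplex.mapNatTrans _ (B.flip.map g))

/-- The case of bidegree (1, q). A single extension in the first variable is moved past the q short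
exact sequences that make up ν, and each of them contributes one sign by anticommutativity in the 3
× 3 diagram; the terminal morphism of the sequence contributes none. -/
theorem contraClass_comp_mapExactFunctor {K E X : C} {i : K ⟶ E} {π : E ⟶ X} {w : i ≫ π = 0}
    (h : (ShortComplex.mk i π w).ShortExact) {Y Y' : D} {q : ℕ} (ν : Ext.{w'} Y Y' q) :
    (YonedaSeq.contraClass (B.flip.obj Y) h).comp (Ext.mapExactFunctor (B.obj (.op X)) ν) rfl =
      (-1 : ℤ) ^ q • (Ext.mapExactFunctor (B.obj (.op K)) ν).comp
        (YonedaSeq.contraClass (B.flip.obj Y') h : Ext.{w''} _ _ 1) (add_comm q 1) := by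
  obtain ⟨e, rfl⟩ := YonedaSeq.toExt_surjective ν
  induction e with
  | hom g =>
    rw [pow_zero, one_smul, mapExactFunctor_toExt_hom, mapExactFunctor_toExt_hom]
    exact contraClass_naturality B h g
  | splice j ρ w' h' e ih =>
    -- The sign is split as (-1) * (-1)^n, in the order in which the factors are crossed: first the
    -- short exact sequence at the head of ν, then the remaining sequence, for which the induction
    -- hypothesis applies with the kernel L in place of Y.
    rw [mapExactFunctor_toExt_splice, mapExactFunctor_toExt_splice, pow_succ']
    exact ext_square_paste _ _
      ((contraClass_comp_extClass B h h').trans (neg_one_zsmul _).symm) ih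

/-- For a bifunctor which is exact in both variables, the actions on `Ext` in the two variables
commute up to the Koszul sign. -/
theorem contra_comp_mapExactFunctor {X X' : C} {p : ℕ} (e : YonedaSeq C X X' p) {Y Y' : D} {q : ℕ}
    (ν : Ext.{w'} Y Y' q) :
    (e.contra (B.flip.obj Y)).comp (Ext.mapExactFunctor (B.obj (.op X)) ν) rfl =
      (-1 : ℤ) ^ (p * q) • (Ext.mapExactFunctor (B.obj (.op X')) ν).comp
        (e.contra (B.flip.obj Y') : Ext.{w''} _ _ p) (add_comm q p) := by
  induction e with
  | hom f =>
    have key := (mapExactFunctor_naturality (B.map f.op) ν).symm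
    -- The goal lives in degree `0 + q`, which is not `q` by definition, while naturality is stated
    -- in degree `q`. With the degree left variable it can be substituted by `q + 0`, which does
    -- reduce to `q`.
    have key' : ∀ (r : ℕ) (h₁ : 0 + q = r) (h₂ : q + 0 = r),
        (Ext.mk₀ ((B.map f.op).app Y)).comp (Ext.mapExactFunctor (B.obj (.op _)) ν) h₁ =
          (Ext.mapExactFunctor (B.obj (.op _)) ν).comp
            (Ext.mk₀ ((B.map f.op).app Y') : Ext.{w''} _ _ 0) h₂ := by
      rintro r h₁ rfl
      exact key
    rw [zero_mul, pow_zero, one_smul]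
    exact key' _ _ _
  | @splice K E X X' n i π w h e ih =>
    have h₁ := contraClass_comp_mapExactFunctor B h ν
    -- Pasting expects the factor that moves, here the action of ν, on the left at the start. The
    -- induction hypothesis and the case of bidegree (1, q) move it the other way, so both are
    -- inverted by multiplying with their own sign once more, the square of a sign being 1.
    have h₂ : (Ext.mapExactFunctor (B.obj (.op X')) ν).comp (e.contra (B.flip.obj Y'))
        (add_comm q n) = (-1 : ℤ) ^ (n * q) • (e.contra (B.flip.obj Y)).comp
          (Ext.mapExactFunctor (B.obj (.op K)) ν : Ext.{w''} _ _ q) rfl := by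
      rw [ih, smul_smul, ← mul_pow, neg_one_mul, neg_neg, one_pow, one_smul]
    have h₃ : (Ext.mapExactFunctor (B.obj (.op K)) ν).comp
        (YonedaSeq.contraClass (B.flip.obj Y') h) (add_comm q 1) =
        (-1 : ℤ) ^ q • (YonedaSeq.contraClass (B.flip.obj Y) h).comp
          (Ext.mapExactFunctor (B.obj (.op X)) ν : Ext.{w''} _ _ q) rfl := by
      rw [h₁, smul_smul, ← mul_pow, neg_one_mul, neg_neg, one_pow, one_smul]
    -- Contravariance reverses the splice: on B the remaining sequence `e` acts first and the short
    -- exact sequence `h` last. So the action of ν crosses `e` with sign (-1)^(nq) and then `h` with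
    -- sign (-1)^q, changing from B(X', -) to B(K, -) and then to B(X, -).
    have h₄ := ext_square_paste (rfl : n + 1 = n + 1) (by omega : q + (n + 1) = n + 1 + q) h₂ h₃
    rw [YonedaSeq.contra, YonedaSeq.contra]
    refine Eq.symm ((congrArg (fun z ↦ _ • z) h₄).trans ?_)
    -- The sign in the goal has exponent (n + 1)q, and the two crossings contribute nq + q, which is
    -- the same number. The total exponent is even.
    rw [smul_smul, ← pow_add, ← pow_add, add_one_mul, ← two_mul, pow_mul, neg_one_sq, one_pow,
      one_smul]

/-- The induced map `extContra` does not depend on the representing sequence. One and the same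
sequence for ξ can therefore be used under B(-, Y) and under B(-, Y'), and the sign rule for that
sequence applies. -/
theorem extContra_comp_mapExactFunctor [EnoughProjectives C] {X X' : C} {p : ℕ}
    (ξ : Ext.{w} X X' p) {Y Y' : D} {q : ℕ} (ν : Ext.{w'} Y Y' q) :
    (extContra (B.flip.obj Y) ξ).comp (Ext.mapExactFunctor (B.obj (.op X)) ν) rfl =
      (-1 : ℤ) ^ (p * q) • (Ext.mapExactFunctor (B.obj (.op X')) ν).comp
        (extContra (B.flip.obj Y') ξ : Ext.{w''} _ _ p) (add_comm q p) := by
  obtain ⟨e, rfl⟩ := YonedaSeq.toExt_surjective ξ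
  rw [extContra_toExt, extContra_toExt]
  exact contra_comp_mapExactFunctor B e ν

end Bifunctor

end

end HopfCyclic

namespace HopfCyclic

noncomputable section

open CategoryTheory CategoryTheory.Limits Abelian

/-! ### The sign rule for `diagHom`, and evaluation at 1. -/

section Diag

variable {J : Type} [SmallCategory J] {k : Type u} [Field k]

/-- The natural transformation `diagHom(k, -) ⟶ 𝟭`, `f ↦ f(1)`. -/
def diagHomConstNat : (diagHom J k).obj (.op (constField k J)) ⟶ 𝟭 (Jᵒᵖ ⥤ ModuleCat.{u} k) where
  app Y := (diagHomConst Y).hom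
  naturality _ _ _ := NatTrans.ext (funext fun _ ↦ ModuleCat.hom_ext (LinearMap.ext fun _ ↦ rfl))

/-- Evaluation at 1 is natural in the cyclic module, so it intertwines the action of diagHom(k, -)
on ν with that of the identity functor, which is ν. This trades the bare class ν for a class in the
image of the bifunctor, which is the form required by the sign rule. -/
theorem diagHomConst_comp {Y Y' : Jᵒᵖ ⥤ ModuleCat.{u} k} {q : ℕ} (ν : Ext.{u} Y Y' q) :
    (Ext.mk₀ (diagHomConst Y).hom).comp ν (zero_add q) =
      (Ext.mapExactFunctor ((diagHom J k).obj (.op (constField k J))) ν).comp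
        (Ext.mk₀ (diagHomConst Y').hom) (add_zero q) := by
  refine Eq.trans ?_ (mapExactFunctor_naturality diagHomConstNat ν).symm
  rw [mapExactFunctor_id]
  rfl

/-- The two composition products of classes `ξ` and `ν` obtained from `diagHom` agree up to the
Koszul sign. -/
theorem diagHom_comp_comm {X : J ⥤ ModuleCat.{u} k} {Y : Jᵒᵖ ⥤ ModuleCat.{u} k} {p q : ℕ}
    (ξ : Ext.{u} (constField k J) X p) (ν : Ext.{u} Y (constField k Jᵒᵖ) q) :
    (extContra ((diagHom J k).flip.obj Y) ξ).comp
        ((Ext.mk₀ (diagHomConst Y).hom).comp ν (zero_add q)) rfl =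
      (-1 : ℤ) ^ (p * q) • (Ext.mapExactFunctor ((diagHom J k).obj (.op X)) ν).comp
        ((extContra ((diagHom J k).flip.obj (constField k Jᵒᵖ)) ξ).comp
          (Ext.mk₀ (diagHomConst (constField k Jᵒᵖ)).hom : Ext.{u} _ _ 0) (add_zero p))
        (add_comm q p) := by
  have h := extContra_comp_mapExactFunctor (diagHom J k) ξ ν
  -- The evaluation isomorphism stands between ξ and ν and blocks the exchange. It is first pushed
  -- past ν to the right end, where it becomes the evaluation on diagHom(k, k^∨); then the two
  -- classes are adjacent and can be interchanged. The final reassociation attaches it to the action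
  -- of ξ.
  rw [diagHomConst_comp]
  refine (Ext.comp_assoc_of_third_deg_zero _ _ _ rfl).symm.trans ?_
  refine (congrArg (fun z ↦ Ext.comp z _ (add_zero _)) h).trans ?_
  refine (ext_zsmul_comp _ _ _ _).trans ?_
  exact congrArg _ (Ext.comp_assoc_of_third_deg_zero _ _ _ _)

end Diag

end

end HopfCyclic

/-- Both products are precompositions with the class of the same morphism α. Precomposition is
additive on `Ext`, so the sign obtained for `diagHom` passes through it unchanged. -/
theorem mainTheorem2 {k H A C M : Type u}
    [Field k] [Ring H] [HopfAlgebra k H] [HopfCyclic.InvertibleAntipode k H]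
    [Ring A] [Algebra k A] [Module H A] [IsScalarTower k H A] [HopfCyclic.HModuleAlgebra k H A]
    [AddCommGroup C] [Module k C] [Coalgebra k C] [Module H C] [IsScalarTower k H C]
    [HopfCyclic.HModuleCoalgebra k H C]
    [AddCommGroup M] [Module k M] [Module H M] [IsScalarTower k H M]
    [HopfCyclic.LeftComodule k H M]
    (E : HopfCyclic.EquivariantAction k H A C) (p q : ℕ)
    (ξ : HopfCyclic.HCCoalg k H C M p) (ν : HopfCyclic.HCAlg k H A M q) :
    HopfCyclic.cup E ξ ν = (-1 : ℤ) ^ (p * q) • HopfCyclic.cupSwap E ν ξ := by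
  refine (congrArg (fun z ↦ CategoryTheory.Abelian.Ext.comp _ z _)
    (HopfCyclic.diagHom_comp_comm ξ ν)).trans ?_
  exact HopfCyclic.ext_comp_zsmul _ _ _ _
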